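/- Let $d\in\{2,3\}$, $T>0$, let $\Omega\subset\mathbb R^d$ be a connected bounded open set with smooth boundary, $\omega\subset\Omega$ open, and let $\chi\in C^\infty(\mathbb R^d)$ satisfy $\chi\ge 0$ on $\overline\Omega$ and $\chi=0$ on $\Omega\setminus\omega$. Fix constants $\rho,c_\Gamma,c_\tau,c_\chi>0$. **Discretization.** Let $N\ge1$, $\tau=T/N$, let $\mathcal T_h$ be a finite conforming triangulation (by $d$-simplices) of a polyhedral domain $\Omega_h$, and let $h>0$ be the largest diameter of a simplex of $\mathcal T_h$. We assume that every simplex of $\mathcal T_h$ contains a ball of radius $\rho h$ (quasi-uniformity), that $\operatorname{dist}(x,\partial\Omega)\le c_\Gamma h^2$ for all $x\in\partial\Omega_h$, and that $\tau\le c_\tau h$. Let $\chi_h\ge0$ be a continuous function on $\overline{\Omega_h}$, affine on each simplex, with $\|\chi-\chi_h\|_{L^\infty(\Omega_h)}+h\|\chi-\chi_h\|_{W^{1,\infty}(\Omega_h)}\le c_\chi h^2$. Let $\mathbb V_h$ be the space of continuous functions on $\overline{\Omega_h}$ that are affine on each simplex and vanish on $\partial\Omega_h$, and put $(u,v)_h=\int_{\Omega_h}uv\,dx$,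 $a_h(u,v)=\int_{\Omega_h}\nabla u\cdot\nabla v\,dx$ (with $(\cdot,\cdot)_h$ also used for gradients) and $\|u\|_h^2=(u,u)_h$. Put $\partial_\tau u^n=(u^n-u^{n-1})/\tau$, $\partial_\tau^2u^n=(u^n-2u^{n-1}+u^{n-2})/\tau^2$, $\tilde\partial_\tau^2u^n=(u^n-2u^{n+1}+u^{n+2})/\tau^2$. Let $\mathbb V_h^{4N}$ be the space of $x=(u,U,z,Z)$ with $u=(u^n)_{n=0}^N$, $U=(U^n)_{n=0}^N$, $z=(z^n)_{n=2}^N$, $Z=(Z^n)_{n=0}^{N-2}$ and all entries in $\mathbb V_h$; set $z^0=z^1=0$ and $Z^{N-1}=Z^N=0$. **Bilinear form.** Let $$\mathcal G(u,z)=\tau\sum_{n=2}^N\big((\partial_\tau^2u^n,z^n)_h+a_h(u^n,z^n)\big),\qquad \mathcal G^*(Z,U)=\tau\sum_{n=0}^{N-2}\big((Z^n,\tilde\partial_\tau^2U^n)_h+a_h(Z^n,U^n)\big),$$ and for $x=(u,U,z,Z)$, $y=(v,V,w,W)$ in $\mathbb V_h^{4N}$ let $$\begin{aligned}\mathcal A(x;y)={}&\mathcal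 G(v,z)+a_h(u^0,v^0)+a_h(u^N,v^N)+(\partial_\tau u^1,\partial_\tau v^1)_h+(\partial_\tau u^N,\partial_\tau v^N)_h\\&+\mathcal G^*(Z,V)-\tau\sum_{n=2}^N(\chi_hV^n,z^n)_h+h^2(\nabla U^N,\nabla V^N)_h+h^2(\partial_\tau\nabla U^N,\partial_\tau\nabla V^N)_h\\&+h^2(\partial_\tau\nabla U^1,\partial_\tau\nabla V^1)_h+\tau\sum_{n=1}^Nh^2(\partial_\tau\nabla U^n,\partial_\tau\nabla V^n)_h\\&+\mathcal G(u,w)-\tau\sum_{n=2}^N(\chi_hU^n,w^n)_h+\mathcal G^*(W,U).\end{aligned}$$ **Norms.** With $\mathcal Iz^n=\tau\sum_{m=0}^n(1+m\tau)z^m$ and $\tilde{\mathcal I}Z^n=\tau\sum_{m=n}^N(1+(N-m)\tau)Z^m$ let $$\begin{aligned} |||(u,U)|||_R^2={}&\|\nabla u^N\|_h^2+\|\partial_\tau u^N\|_h^2+\|\nabla u^0\|_h^2+\|\partial_\tau u^1\|_h^2+\tau\sum_{n=1}^N\|h\,\partial_\tau\nabla U^n\|_h^2\\&+h^2\|\nabla\partial_\tau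 U^N\|_h^2+h^2\|\partial_\tau\nabla U^1\|_h^2+h^2\|\nabla U^N\|_h^2,\\ |||u|||_F^2={}&\tau\sum_{n=1}^N\big(\|\partial_\tau u^n\|_h^2+\|\nabla u^n\|_h^2\big),\\ |||U|||_{F'}^2={}&\tau\sum_{n=2}^N\big(\|\partial_\tau^2U^n\|_h^2+\|\partial_\tau\nabla U^n\|_h^2+\|\partial_\tau U^n\|_h^2+\|\nabla U^n\|_h^2\big)+\|\partial_\tau U^1\|_h^2+\|\nabla U^1\|_h^2,\\ |||z|||_D^2={}&\tau\sum_{n=2}^N\|z^n\|_h^2+\tau\sum_{n=2}^N\|\nabla\mathcal Iz^n\|_h^2+\|\nabla\mathcal Iz^N\|_h^2+\|z^N\|_h^2,\\ |||Z|||_{D'}^2={}&\tau\sum_{n=0}^{N-2}\|Z^n\|_h^2+\tau\sum_{n=0}^{N-2}\|\nabla\tilde{\mathcal I}Z^n\|_h^2+\|\nabla\tilde{\mathcal I}Z^0\|_h^2+\|Z^0\|_h^2,\\ |||(u,U,z,Z)|||_C^2={}&|||(u,U)|||_R^2+\tau\sum_{n=2}^N\|z^n\|_h^2+\tau\sum_{n=0}^{N-2}\|Z^n\|_h^2.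 \end{aligned}$$ **Claim.** There are $h_0,C_1,C_2>0$, depending only on $d,T,\Omega,\omega,\chi,\rho,c_\Gamma,c_\tau,c_\chi$, such that for every discretization as above with $0<h<h_0$: (i) for every $x=(u,U,z,Z)\in\mathbb V_h^{4N}$ there is $y\in\mathbb V_h^{4N}$ with $$\mathcal A(x;y)\ge C_1\,S(x)\quad\text{and}\quad S(x)\ge C_2\,|||y|||_C^2,$$ where $S(x)=|||(u,U)|||_R^2+h^2|||u|||_F^2+h^2|||U|||_{F'}^2+|||z|||_D^2+|||Z|||_{D'}^2$; (ii) for all $g_0\in H^1(\Omega_h)$ and $g_1\in L^2(\Omega_h)$ there is a unique $x\in\mathbb V_h^{4N}$ such that $$\mathcal A(x;y)=a_h(v^0,g_0)+(\partial_\tau v^1,g_1)_h\qquad\text{for all }y=(v,V,w,W)\in\mathbb V_h^{4N}.$$ -/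

import Mathlib

open MeasureTheory Set
open scoped ContDiff

noncomputable section

namespace WaveControl

/-- Euclidean space `ℝᵈ`. -/
abbrev Euc (d : ℕ) := EuclideanSpace ℝ (Fin d)

/-- The open set `Ω` has smooth boundary: near each boundary point, `Ω` is the sublevel set
`{φ < 0}` of a smooth function `φ` whose differential does not vanish at that point. -/
def HasSmoothBoundary {d : ℕ} (Ω : Set (Euc d)) : Prop :=
  ∀ p ∈ frontier Ω, ∃ W : Set (Euc d), IsOpen W ∧ p ∈ W ∧
    ∃ φ : Euc d → ℝ, ContDiff ℝ ∞ φ ∧ fderiv ℝ φ p ≠ 0 ∧ Ω ∩ W = {x ∈ W | φ x < 0}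

/-! ### Meshes and finite element spaces -/

/-- The `d`-dimensional simplices (given by their vertex sets) of a simplicial complex. -/
def cells {d : ℕ} (K : Geometry.SimplicialComplex ℝ (Euc d)) : Set (Finset (Euc d)) :=
  {s ∈ K.faces | s.card = d + 1}

/-- The polyhedral domain `Ω_h` triangulated by `K`. -/
def meshDomain {d : ℕ} (K : Geometry.SimplicialComplex ℝ (Euc d)) : Set (Euc d) :=
  interior K.space

/-- The global mesh parameter `h`: the largest diameter of a cell. -/
def meshSize {d : ℕ} (K : Geometry.SimplicialComplex ℝ (Euc d)) : ℝ :=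
  sSup ((fun s : Finset (Euc d) => Metric.diam (convexHull ℝ (s : Set (Euc d)))) '' cells K)

/-- `K` is a finite conforming triangulation by `d`-dimensional simplices. Conformity, that is, two
simplices meet in a common face or not at all, is part of `Geometry.SimplicialComplex`. -/
def IsTriangulation {d : ℕ} (K : Geometry.SimplicialComplex ℝ (Euc d)) : Prop :=
  K.faces.Finite ∧ ∀ s ∈ K.faces, ∃ t ∈ cells K, s ⊆ t

/-- Quasi-uniformity with constant `ρ`: every cell contains a ball of radius `ρ h`. -/
def IsQuasiUniform {d : ℕ} (ρ : ℝ) (K : Geometry.SimplicialComplex ℝ (Euc d)) : Prop :=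
  ∀ s ∈ cells K, ∃ c : Euc d,
    Metric.closedBall c (ρ * meshSize K) ⊆ convexHull ℝ (s : Set (Euc d))

/-- `v` is continuous and piecewise affine on the mesh. -/
def IsPiecewiseAffine {d : ℕ} (K : Geometry.SimplicialComplex ℝ (Euc d)) (v : Euc d → ℝ) : Prop :=
  ContinuousOn v K.space ∧
    ∀ s ∈ cells K, ∃ a : Euc d →ᵃ[ℝ] ℝ, EqOn v a (convexHull ℝ (s : Set (Euc d)))

/-- The finite element space `𝕍_h`: continuous piecewise affine functions with zero boundary
values, extended by zero to the whole space. -/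
def FE {d : ℕ} (K : Geometry.SimplicialComplex ℝ (Euc d)) : Submodule ℝ (Euc d → ℝ) where
  carrier := {v | Continuous v ∧ (∀ x ∉ meshDomain K, v x = 0) ∧
    ∀ s ∈ cells K, ∃ a : Euc d →ᵃ[ℝ] ℝ, EqOn v a (convexHull ℝ (s : Set (Euc d)))}
  add_mem' := by
    rintro v w ⟨hv, hv0, hva⟩ ⟨hw, hw0, hwa⟩
    refine ⟨hv.add hw, fun x hx => by simp [hv0 x hx, hw0 x hx], fun s hs => ?_⟩
    obtain ⟨a, ha⟩ := hva s hs
    obtain ⟨b, hb⟩ := hwa s hs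
    exact ⟨a + b, fun x hx => by simp [ha hx, hb hx]⟩
  zero_mem' := ⟨continuous_const, fun _ _ => rfl, fun _ _ => ⟨0, fun _ _ => by simp⟩⟩
  smul_mem' := by
    rintro c v ⟨hv, hv0, hva⟩
    refine ⟨hv.const_smul c, fun x hx => by simp [hv0 x hx], fun s hs => ?_⟩
    obtain ⟨a, ha⟩ := hva s hs
    exact ⟨c • a, fun x hx => by simp [ha hx]⟩

/-- `(f, g)_h`, the `L²` inner product on `S = Ω_h`. -/
def ip {d : ℕ} (S : Set (Euc d)) (f g : Euc d → ℝ) : ℝ := ∫ x in S, f x * g x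

/-- `a_h(f, g)`, the Dirichlet form on `S = Ω_h`. Functions in `FE K` are differentiable at almost
every point, so that `gradient` is their weak gradient. -/
def ah {d : ℕ} (S : Set (Euc d)) (f g : Euc d → ℝ) : ℝ :=
  ∫ x in S, inner ℝ (gradient f x) (gradient g x)

/-- `‖f‖_h²`. -/
def normSq {d : ℕ} (S : Set (Euc d)) (f : Euc d → ℝ) : ℝ := ip S f f

/-- `‖∇f‖_h²`. -/
def gradSq {d : ℕ} (S : Set (Euc d)) (f : Euc d → ℝ) : ℝ := ah S f f

/-! ### Time differences and discrete space-time functions -/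

/-- `∂_τ uⁿ`, used for `n ≥ 1`. -/
def bd {d : ℕ} (τ : ℝ) (u : ℕ → Euc d → ℝ) (n : ℕ) : Euc d → ℝ :=
  fun x => (u n x - u (n - 1) x) / τ

/-- `∂_τ² uⁿ`, used for `n ≥ 2`. -/
def bd2 {d : ℕ} (τ : ℝ) (u : ℕ → Euc d → ℝ) (n : ℕ) : Euc d → ℝ :=
  fun x => (u n x - 2 * u (n - 1) x + u (n - 2) x) / τ ^ 2

/-- The second forward difference of `u` at `n`. -/
def fd2 {d : ℕ} (τ : ℝ) (u : ℕ → Euc d → ℝ) (n : ℕ) : Euc d → ℝ :=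
  fun x => (u n x - 2 * u (n + 1) x + u (n + 2) x) / τ ^ 2

/-- `𝓘 zⁿ = τ ∑_{m=0}^n (1 + mτ) z^m`. -/
def intg {d : ℕ} (τ : ℝ) (z : ℕ → Euc d → ℝ) (n : ℕ) : Euc d → ℝ :=
  fun x => τ * ∑ m ∈ Finset.range (n + 1), (1 + m * τ) * z m x

/-- The backward sum `τ ∑_{m=n}^N (1 + (N - m)τ) Z^m`. -/
def intgB {d : ℕ} (τ : ℝ) (N : ℕ) (Z : ℕ → Euc d → ℝ) (n : ℕ) : Euc d → ℝ :=
  fun x => τ * ∑ m ∈ Finset.Icc n N, (1 + ((N : ℝ) - m) * τ) * Z m x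

/-- A family of finite element functions with indices in `I`, as a sequence which is zero at the
other indices. So `z⁰ = z¹ = 0` and `Z^{N-1} = Z^N = 0` for the multipliers below. -/
def feSeq {d : ℕ} {K : Geometry.SimplicialComplex ℝ (Euc d)} {I : Finset ℕ} (f : I → FE K) (k : ℕ) :
    Euc d → ℝ :=
  if hk : k ∈ I then (f ⟨k, hk⟩ : Euc d → ℝ) else 0

/-- `𝕍_h^{4N}`: quadruples `(u, U, z, Z)` with `u = (u⁰, …, u^N)`, `U = (U⁰, …, U^N)`,
`z = (z², …, z^N)` and `Z = (Z⁰, …, Z^{N-2})`. -/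
abbrev State {d : ℕ} (K : Geometry.SimplicialComplex ℝ (Euc d)) (N : ℕ) :=
  (Finset.range (N + 1) → FE K) × (Finset.range (N + 1) → FE K) ×
    (Finset.Icc 2 N → FE K) × (Finset.range (N - 1) → FE K)

section Components

variable {d : ℕ} {K : Geometry.SimplicialComplex ℝ (Euc d)} {N : ℕ}

/-- The component `u` of `(u, U, z, Z)`. -/
def State.u (x : State K N) : ℕ → Euc d → ℝ := feSeq x.1

/-- The component `U` of `(u, U, z, Z)`. -/
def State.U (x : State K N) : ℕ → Euc d → ℝ := feSeq x.2.1

/-- The component `z` of `(u, U, z, Z)`. -/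
def State.z (x : State K N) : ℕ → Euc d → ℝ := feSeq x.2.2.1

/-- The component `Z` of `(u, U, z, Z)`. -/
def State.Z (x : State K N) : ℕ → Euc d → ℝ := feSeq x.2.2.2

end Components

/-! ### The bilinear form -/

section Forms

variable {d : ℕ} (S : Set (Euc d)) (τ h : ℝ) (N : ℕ) (χh : Euc d → ℝ)

/-- `𝓖(u, z)`. -/
def formG (u z : ℕ → Euc d → ℝ) : ℝ :=
  τ * ∑ n ∈ Finset.Icc 2 N, (ip S (bd2 τ u n) (z n) + ah S (u n) (z n))

/-- `𝓖*(Z, U)`. -/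
def formGstar (Z U : ℕ → Euc d → ℝ) : ℝ :=
  τ * ∑ n ∈ Finset.range (N - 1), (ip S (Z n) (fd2 τ U n) + ah S (Z n) (U n))

/-- `τ ∑_{n=2}^N (χ_h Uⁿ, zⁿ)_h`. -/
def formChi (U z : ℕ → Euc d → ℝ) : ℝ :=
  τ * ∑ n ∈ Finset.Icc 2 N, ip S (fun x => χh x * U n x) (z n)

/-- `𝓐₀(u, z; v)`. -/
def formA0 (u z v : ℕ → Euc d → ℝ) : ℝ :=
  formG S τ N v z + ah S (u 0) (v 0) + ah S (u N) (v N)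
    + ip S (bd τ u 1) (bd τ v 1) + ip S (bd τ u N) (bd τ v N)

/-- `𝓐₁(U, z, Z; V)`. -/
def formA1 (U z Z V : ℕ → Euc d → ℝ) : ℝ :=
  formGstar S τ N Z V - formChi S τ N χh V z
    + h ^ 2 * ah S (U N) (V N) + h ^ 2 * ah S (bd τ U N) (bd τ V N)
    + h ^ 2 * ah S (bd τ U 1) (bd τ V 1)
    + τ * ∑ n ∈ Finset.Icc 1 N, h ^ 2 * ah S (bd τ U n) (bd τ V n)

/-- `𝓐₂(u, U; w)`. -/
def formA2 (u U w : ℕ → Euc d → ℝ) : ℝ := formG S τ N u w - formChi S τ N χh U w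

/-- `𝓐₃(U; W)`. -/
def formA3 (U W : ℕ → Euc d → ℝ) : ℝ := formGstar S τ N W U

/-! ### Norms and semi-norms (squared) -/

/-- `|||(u, U)|||_R²`. -/
def normR (u U : ℕ → Euc d → ℝ) : ℝ :=
  gradSq S (u N) + normSq S (bd τ u N) + gradSq S (u 0) + normSq S (bd τ u 1)
    + τ * ∑ n ∈ Finset.Icc 1 N, h ^ 2 * gradSq S (bd τ U n)
    + h ^ 2 * gradSq S (bd τ U N) + h ^ 2 * gradSq S (bd τ U 1) + h ^ 2 * gradSq S (U N)

/-- `|||u|||_F²`. -/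
def normF (u : ℕ → Euc d → ℝ) : ℝ :=
  τ * ∑ n ∈ Finset.Icc 1 N, (normSq S (bd τ u n) + gradSq S (u n))

/-- `|||U|||_{F'}²`. -/
def normF' (U : ℕ → Euc d → ℝ) : ℝ :=
  τ * ∑ n ∈ Finset.Icc 2 N, (normSq S (bd2 τ U n) + gradSq S (bd τ U n)
      + normSq S (bd τ U n) + gradSq S (U n))
    + normSq S (bd τ U 1) + gradSq S (U 1)

/-- `|||z|||_D²`. -/
def normD (z : ℕ → Euc d → ℝ) : ℝ :=
  τ * ∑ n ∈ Finset.Icc 2 N, normSq S (z n) + τ * ∑ n ∈ Finset.Icc 2 N, gradSq S (intg τ z n)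
    + gradSq S (intg τ z N) + normSq S (z N)

/-- `|||Z|||_{D'}²`. -/
def normD' (Z : ℕ → Euc d → ℝ) : ℝ :=
  τ * ∑ n ∈ Finset.range (N - 1), normSq S (Z n)
    + τ * ∑ n ∈ Finset.range (N - 1), gradSq S (intgB τ N Z n)
    + gradSq S (intgB τ N Z 0) + normSq S (Z 0)

/-- `|||(u, U, z, Z)|||_C²`. -/
def normC (u U z Z : ℕ → Euc d → ℝ) : ℝ :=
  normR S τ h N u U + τ * ∑ n ∈ Finset.Icc 2 N, normSq S (z n)
    + τ * ∑ n ∈ Finset.range (N - 1), normSq S (Z n)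

end Forms

/-- The bilinear form `𝓐(x; y)` of the mesh `K`, with `N` time steps of length `τ = T / N`. -/
def formA {d : ℕ} (T : ℝ) (K : Geometry.SimplicialComplex ℝ (Euc d)) (N : ℕ) (χh : Euc d → ℝ)
    (x y : State K N) : ℝ :=
  formA0 (meshDomain K) (T / N) N x.u x.z y.u
    + formA1 (meshDomain K) (T / N) (meshSize K) N χh x.U x.z x.Z y.U
    + formA2 (meshDomain K) (T / N) N χh x.u x.U y.z
    + formA3 (meshDomain K) (T / N) N x.U y.Z

/-- `|||(u,U)|||_R² + h² |||u|||_F² + h² |||U|||_{F'}² + |||z|||_D² + |||Z|||_{D'}²`. -/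
def stabilityNormSq {d : ℕ} (T : ℝ) (K : Geometry.SimplicialComplex ℝ (Euc d)) (N : ℕ)
    (x : State K N) : ℝ :=
  normR (meshDomain K) (T / N) (meshSize K) N x.u x.U
    + meshSize K ^ 2 * normF (meshDomain K) (T / N) N x.u
    + meshSize K ^ 2 * normF' (meshDomain K) (T / N) N x.U
    + normD (meshDomain K) (T / N) N x.z + normD' (meshDomain K) (T / N) N x.Z

/-- `|||y|||_C²`. -/
def continuityNormSq {d : ℕ} (T : ℝ) (K : Geometry.SimplicialComplex ℝ (Euc d)) (N : ℕ)
    (y : State K N) : ℝ :=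
  normC (meshDomain K) (T / N) (meshSize K) N y.u y.U y.z y.Z

/-! ### Admissible discretizations and the discrete system -/

/-- The data `(N, K, χ_h)` are a discretization of the problem on `(0, T) × Ω` with cut-off `χ`,
with constants `ρ` (quasi-uniformity), `cΓ` (approximation of `∂Ω`), `cτ` (relation of the time step
and the mesh size) and `cχ` (approximation of `χ`). -/
structure IsDiscretization {d : ℕ} (T : ℝ) (Ω : Set (Euc d)) (χ : Euc d → ℝ) (ρ cΓ cτ cχ : ℝ)
    (N : ℕ) (K : Geometry.SimplicialComplex ℝ (Euc d)) (χh : Euc d → ℝ) : Prop where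
  one_le : 1 ≤ N
  triangulation : IsTriangulation K
  quasiUniform : IsQuasiUniform ρ K
  boundary : ∀ x ∈ frontier (meshDomain K), Metric.infDist x (frontier Ω) ≤ cΓ * meshSize K ^ 2
  timeStep : T / N ≤ cτ * meshSize K
  chi_affine : IsPiecewiseAffine K χh
  chi_nonneg : ∀ x ∈ meshDomain K, 0 ≤ χh x
  /-- `‖χ - χ_h‖_{L^∞(Ω_h)} + h ‖χ - χ_h‖_{W^{1,∞}(Ω_h)} ≤ cχ h²` -/
  chi_close :
    eLpNorm (χ - χh) ⊤ (volume.restrict (meshDomain K))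
      + ENNReal.ofReal (meshSize K) * (eLpNorm (χ - χh) ⊤ (volume.restrict (meshDomain K))
        + eLpNorm (gradient (χ - χh)) ⊤ (volume.restrict (meshDomain K)))
      ≤ ENNReal.ofReal (cχ * meshSize K ^ 2)

/-- `g` belongs to `H¹(S)` and `Dg` is its weak gradient. -/
def HasWeakGradient {d : ℕ} (S : Set (Euc d)) (g : Euc d → ℝ) (Dg : Euc d → Euc d) : Prop :=
  MemLp g 2 (volume.restrict S) ∧ MemLp Dg 2 (volume.restrict S) ∧
    ∀ φ : Euc d → ℝ, ContDiff ℝ ∞ φ → HasCompactSupport φ → tsupport φ ⊆ S →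
      ∀ i : Fin d, ∫ x in S, g x * fderiv ℝ φ x (EuclideanSpace.single i 1)
        = -∫ x in S, Dg x i * φ x

/-- `x` solves the discrete Euler–Lagrange system
`𝓐(x; y) = a_h(v⁰, g₀) + (∂_τ v¹, g₁)_h` for all `y = (v, V, w, W)`, where `Dg₀ = ∇g₀`. -/
def SolvesEulerLagrange {d : ℕ} (T : ℝ) (K : Geometry.SimplicialComplex ℝ (Euc d)) (N : ℕ)
    (χh : Euc d → ℝ) (Dg₀ : Euc d → Euc d) (g₁ : Euc d → ℝ) (x : State K N) : Prop :=
  ∀ y : State K N, formA T K N χh x y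
    = (∫ p in meshDomain K, inner ℝ (gradient (y.u 0) p) (Dg₀ p))
      + ip (meshDomain K) (bd (T / N) y.u 1) g₁

end WaveControl

end

open WaveControl

/-! The stability bound is an inf-sup estimate with explicit test functions. Testing with (u, U, -z,
-Z) cancels every coupling and leaves only the diagonal terms, which are exactly the R-norm of (u,
U). The rest of S(x) is recovered by four perturbations of this choice, each producing one missing
norm at the price of terms already controlled.

Adding the weighted time sum of z to v gives the D-norm of z: the equation 𝓖(𝓘z, z) is coercive
because the weights 1 + mτ grow, so that telescoping energies leave a sum over all time levels. The
reversed sum of Z added to V gives the D'-norm by reversal of time, but the coupling through χ_h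
costs a multiple of the D-norm of z. Adding h² times a decreasing weight times ∂_τ u to w is the
energy estimate and gives h² times the F-norm. Adding h² times the second difference of U to W gives
the second differences in the F'-norm; everything else in that norm is already controlled by the
regularization. Weights chosen in the order of these dependences absorb all losses
(`exists_weights`).

The argument only needs two symmetric semidefinite forms with a Poincaré and an inverse inequality,
and a bounded coupling. It is therefore done for abstract forms (`WaveForms`,
`exists_test_sequences`). The constants are uniform in the mesh because all the domains Ω_h lie in
one ball (`exists_radius`, `poincare_inequality`), because cells are quasi-uniform
(`inverse_inequality`), and because χ_h is uniformly bounded on Ω_h. Finite element functions are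
Lipschitz after extension by zero (`FE.exists_lipschitz`), which justifies pointwise gradients and
integration by parts.

For (ii), if 𝓐(x; ·) = 0 then (i) gives S(x) ≤ 0, whence x = 0. The state space has finite
dimension, so the injective map from it to its dual is bijective. -/

noncomputable section

namespace WaveControl

/-! ### Symmetric positive semidefinite forms: Young and Cauchy–Schwarz inequalities. -/

section SemiInner

variable {E : Type*} [AddCommGroup E] [Module ℝ E]

/-- A symmetric positive semidefinite bilinear form. -/
structure IsSemiInner (b : E →ₗ[ℝ] E →ₗ[ℝ] ℝ) : Prop where
  symm : ∀ x y, b x y = b y x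
  nonneg : ∀ x, 0 ≤ b x x

variable {b : E →ₗ[ℝ] E →ₗ[ℝ] ℝ}

theorem IsSemiInner.two_mul_le (hb : IsSemiInner b) {t : ℝ} (ht : 0 < t) (x y : E) :
    2 * b x y ≤ t * b x x + t⁻¹ * b y y := by
  have h := hb.nonneg (t • x - y)
  have h2 := hb.symm x y
  simp only [map_sub, map_smul, LinearMap.sub_apply, LinearMap.smul_apply, smul_eq_mul] at h
  have h3 : 0 ≤ t⁻¹ * (t * (t * b x x - b y x) - (t * b x y - b y y)) :=
    mul_nonneg (inv_pos.2 ht).le (by linarith)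
  have h4 : t⁻¹ * (t * (t * b x x - b y x) - (t * b x y - b y y))
      = t * b x x - b y x - b x y + t⁻¹ * b y y := by field_simp; ring
  linarith

theorem IsSemiInner.neg_le_two_mul (hb : IsSemiInner b) {t : ℝ} (ht : 0 < t) (x y : E) :
    -(t * b x x + t⁻¹ * b y y) ≤ 2 * b x y := by
  have h := hb.two_mul_le ht (-x) y
  simp only [map_neg, LinearMap.neg_apply, neg_neg] at h
  linarith

/-- Discrete chain rule for implicit differences: the two sides differ by the nonnegative term b(x -
y, x - y). -/
theorem IsSemiInner.sub_le_two_mul (hb : IsSemiInner b) (x y : E) :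
    b x x - b y y ≤ 2 * b (x - y) x := by
  have h := hb.two_mul_le one_pos y x
  simp only [map_sub, LinearMap.sub_apply]
  linarith

theorem IsSemiInner.add_le (hb : IsSemiInner b) (x y : E) :
    b (x + y) (x + y) ≤ 2 * b x x + 2 * b y y := by
  have h := hb.two_mul_le one_pos x y
  have h2 := hb.symm x y
  simp only [map_add, LinearMap.add_apply]
  linarith

theorem IsSemiInner.add_smul_le (hb : IsSemiInner b) {t : ℝ} (ht : 0 ≤ t) (ht1 : t ≤ 1)
    (x y : E) : b (x + t • y) (x + t • y) ≤ 2 * b x x + 2 * b y y := by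
  have h := hb.add_le x (t • y)
  have h1 : b (t • y) (t • y) = t ^ 2 * b y y := by
    simp only [map_smul, LinearMap.smul_apply, smul_eq_mul]; ring
  have h2 : t ^ 2 * b y y ≤ 1 * b y y :=
    mul_le_mul_of_nonneg_right (pow_le_one₀ ht ht1) (hb.nonneg y)
  linarith

theorem IsSemiInner.sum_le (hb : IsSemiInner b) {ι : Type*} (s : Finset ι) (x : ι → E) :
    b (∑ i ∈ s, x i) (∑ i ∈ s, x i) ≤ s.card * ∑ i ∈ s, b (x i) (x i) := by
  have h : b (∑ i ∈ s, x i) (∑ i ∈ s, x i) = ∑ i ∈ s, ∑ j ∈ s, b (x i) (x j) := by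
    simp only [map_sum, LinearMap.sum_apply]
    exact Finset.sum_comm
  have h2 : ∑ i ∈ s, ∑ j ∈ s, b (x i) (x j)
      ≤ ∑ i ∈ s, ∑ j ∈ s, (b (x i) (x i) / 2 + b (x j) (x j) / 2) :=
    Finset.sum_le_sum fun i _ => Finset.sum_le_sum fun j _ => by
      have := hb.two_mul_le one_pos (x i) (x j)
      linarith
  rw [h]
  refine h2.trans (le_of_eq ?_)
  simp only [Finset.sum_add_distrib, Finset.sum_const, nsmul_eq_mul, ← Finset.mul_sum,
    ← Finset.sum_div]
  ring

/-- Cauchy–Schwarz in time: a time integral is bounded by the length L of the interval times the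
integral of the squares. -/
theorem IsSemiInner.smul_sum_le (hb : IsSemiInner b) {ι : Type*} (s : Finset ι) (x : ι → E)
    {τ L : ℝ} (hτ : 0 ≤ τ) (hL : τ * s.card ≤ L) :
    b (τ • ∑ i ∈ s, x i) (τ • ∑ i ∈ s, x i) ≤ L * (τ * ∑ i ∈ s, b (x i) (x i)) := by
  have h := hb.sum_le s x
  have h0 : 0 ≤ τ * ∑ i ∈ s, b (x i) (x i) :=
    mul_nonneg hτ (Finset.sum_nonneg fun i _ => hb.nonneg _)
  calc b (τ • ∑ i ∈ s, x i) (τ • ∑ i ∈ s, x i)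
      = τ ^ 2 * b (∑ i ∈ s, x i) (∑ i ∈ s, x i) := by
        simp only [map_smul, LinearMap.smul_apply, smul_eq_mul]; ring
    _ ≤ τ ^ 2 * (s.card * ∑ i ∈ s, b (x i) (x i)) := by gcongr
    _ = (τ * s.card) * (τ * ∑ i ∈ s, b (x i) (x i)) := by ring
    _ ≤ _ := mul_le_mul_of_nonneg_right hL h0

theorem apply_smul_smul (b : E →ₗ[ℝ] E →ₗ[ℝ] ℝ) (t : ℝ) (x : E) :
    b (t • x) (t • x) = t ^ 2 * b x x := by
  simp only [map_smul, LinearMap.smul_apply, smul_eq_mul]; ring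

end SemiInner

/-! ### Discrete calculus in time: weighted sums and summation by parts. -/

section TimeDifferences

variable {E : Type*} [AddCommGroup E] [Module ℝ E]

/-- The first backward difference, as a linear map on sequences. -/
def dq (τ : ℝ) (n : ℕ) : (ℕ → E) →ₗ[ℝ] E :=
  τ⁻¹ • ((LinearMap.proj n : (ℕ → E) →ₗ[ℝ] E) - LinearMap.proj (n - 1))

/-- The second backward difference, as a linear map on sequences. -/
def dq2 (τ : ℝ) (n : ℕ) : (ℕ → E) →ₗ[ℝ] E :=
  (τ ^ 2)⁻¹ • ((LinearMap.proj n : (ℕ → E) →ₗ[ℝ] E) - (2 : ℝ) • LinearMap.proj (n - 1) + LinearMap.proj (n - 2))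

/-- The second forward difference, as a linear map on sequences. -/
def dq2f (τ : ℝ) (n : ℕ) : (ℕ → E) →ₗ[ℝ] E :=
  (τ ^ 2)⁻¹ • ((LinearMap.proj n : (ℕ → E) →ₗ[ℝ] E) - (2 : ℝ) • LinearMap.proj (n + 1) + LinearMap.proj (n + 2))

/-- The weighted sum `τ ∑_{m=0}^n (1 + mτ) z^m`. -/
def cum (τ : ℝ) (z : ℕ → E) (n : ℕ) : E :=
  τ • ∑ m ∈ Finset.range (n + 1), (1 + m * τ) • z m

/-- The weighted backward sum `τ ∑_{m=n}^N (1 + (N - m)τ) Z^m`. -/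
def cumB (τ : ℝ) (N : ℕ) (Z : ℕ → E) (n : ℕ) : E :=
  τ • ∑ m ∈ Finset.Icc n N, (1 + ((N : ℝ) - m) * τ) • Z m

theorem dq_apply (τ : ℝ) (n : ℕ) (u : ℕ → E) : dq τ n u = τ⁻¹ • (u n - u (n - 1)) := rfl

theorem dq2_apply (τ : ℝ) (n : ℕ) (u : ℕ → E) :
    dq2 τ n u = (τ ^ 2)⁻¹ • (u n - (2 : ℝ) • u (n - 1) + u (n - 2)) := rfl

theorem dq2f_apply (τ : ℝ) (n : ℕ) (u : ℕ → E) :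
    dq2f τ n u = (τ ^ 2)⁻¹ • (u n - (2 : ℝ) • u (n + 1) + u (n + 2)) := rfl

theorem cum_succ (τ : ℝ) (z : ℕ → E) (n : ℕ) :
    cum τ z (n + 1) = cum τ z n + τ • (1 + ((n + 1 : ℕ) : ℝ) * τ) • z (n + 1) := by
  rw [cum, Finset.sum_range_succ, smul_add, cum]

theorem dq_cum {τ : ℝ} (hτ : τ ≠ 0) (z : ℕ → E) (n : ℕ) (hn : 1 ≤ n) :
    dq τ n (cum τ z) = (1 + n * τ) • z n := by
  obtain ⟨k, rfl⟩ := Nat.exists_eq_add_of_le' hn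
  rw [dq_apply, Nat.add_sub_cancel, cum_succ, add_sub_cancel_left, inv_smul_smul₀ hτ]

theorem dq2_eq_dq_sub_dq {τ : ℝ} (u : ℕ → E) (n : ℕ) (hn : 1 ≤ n) :
    dq2 τ (n + 1) u = τ⁻¹ • (dq τ (n + 1) u - dq τ n u) := by
  obtain ⟨k, rfl⟩ := Nat.exists_eq_add_of_le' hn
  simp only [dq2_apply, dq_apply, Nat.add_sub_cancel, show k + 1 + 1 - 2 = k by omega, two_smul]
  module

theorem cum_one {τ : ℝ} {z : ℕ → E} (h0 : z 0 = 0) (h1 : z 1 = 0) : cum τ z 1 = 0 := by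
  simp [cum, Finset.sum_range_succ, h0, h1]

theorem cum_zero {τ : ℝ} {z : ℕ → E} (h0 : z 0 = 0) : cum τ z 0 = 0 := by
  simp [cum, h0]

variable {b : E →ₗ[ℝ] E →ₗ[ℝ] ℝ}

/-- Put q n = 1 + nτ. The first difference of the weighted sum is q n • z n, so each summand is q
(n+1) |z (n+1)|² minus q n times the product of consecutive values. Young's inequality leaves q
(n+1) - q n / 2 = q (n+1) / 2 + τ / 2: the growth of the weight supplies the sum over time, and the
rest telescopes. -/
theorem sum_dq2_cum_ge (hb : IsSemiInner b) {τ : ℝ} (hτ : 0 < τ) {z : ℕ → E} (h1 : z 1 = 0)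
    (N : ℕ) (hN : 1 ≤ N) :
    τ / 2 * ∑ n ∈ Finset.Icc 2 N, b (z n) (z n) + (1 + N * τ) / 2 * b (z N) (z N)
      ≤ ∑ n ∈ Finset.Icc 2 N, τ * b (dq2 τ n (cum τ z)) (z n) := by
  induction N, hN using Nat.le_induction with
  | base => simp [h1]
  | succ N hN ih =>
    rw [Finset.sum_Icc_succ_top (by omega), Finset.sum_Icc_succ_top (by omega),
      dq2_eq_dq_sub_dq _ _ hN, dq_cum hτ.ne' _ _ (by omega), dq_cum hτ.ne' _ _ hN]
    have h2 := hb.two_mul_le one_pos (z N) (z (N + 1))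
    have hq : 0 ≤ 1 + (N : ℝ) * τ := by positivity
    have h3 := mul_le_mul_of_nonneg_left h2 hq
    simp only [map_smul, map_sub, LinearMap.smul_apply, LinearMap.sub_apply, smul_eq_mul,
      mul_inv_cancel_left₀ hτ.ne'] at h3 ⊢
    push_cast
    linarith

/-- Here τ z n is the increment of the weighted sum divided by 1 + nτ, so the summands are
differences of squares with the decreasing weights 1 / (1 + nτ). Summation by parts turns that
decrease, at least κτ per step, into the sum over time. The subtracted last term removes the index
N, which gains nothing from the decrease. -/
theorem sum_cum_ge (hb : IsSemiInner b) {τ κ : ℝ} (hτ : 0 < τ) {z : ℕ → E} (h0 : z 0 = 0)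
    (h1 : z 1 = 0) (N : ℕ) (hN : 1 ≤ N) (hκ : κ * (1 + N * τ) ^ 2 ≤ 1) (hκ0 : 0 ≤ κ) :
    (1 + N * τ)⁻¹ / 2 * b (cum τ z N) (cum τ z N)
      + κ * τ / 2 * ∑ n ∈ Finset.Icc 2 N, b (cum τ z n) (cum τ z n)
      - κ * τ / 2 * b (cum τ z N) (cum τ z N)
      ≤ ∑ n ∈ Finset.Icc 2 N, τ * b (cum τ z n) (z n) := by
  induction N, hN using Nat.le_induction with
  | base => simp [cum_one h0 h1]
  | succ N hN ih =>
    have hq : 0 < 1 + (N : ℝ) * τ := by positivity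
    have hq' : 0 < 1 + ((N + 1 : ℕ) : ℝ) * τ := by positivity
    have hqq : 1 + ((N + 1 : ℕ) : ℝ) * τ = 1 + N * τ + τ := by push_cast; ring
    have hle : κ * (1 + N * τ) ^ 2 ≤ 1 := by
      refine le_trans ?_ hκ
      gcongr
      simp
    specialize ih hle
    rw [Finset.sum_Icc_succ_top (by omega), Finset.sum_Icc_succ_top (by omega)]
    have hz : τ * b (cum τ z (N + 1)) (z (N + 1))
        = (1 + ((N + 1 : ℕ) : ℝ) * τ)⁻¹
          * b (cum τ z (N + 1) - cum τ z N) (cum τ z (N + 1)) := by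
      rw [cum_succ τ z N, add_sub_cancel_left, hb.symm]
      simp only [map_smul, LinearMap.smul_apply, smul_eq_mul]
      field_simp
    have h2 := mul_le_mul_of_nonneg_left (hb.sub_le_two_mul (cum τ z (N + 1)) (cum τ z N))
      (inv_pos.2 hq').le
    -- The difference of the inverse weights equals τ divided by the product of the two weights, and
    -- both weights are at most the final one.
    have h3 : κ * τ ≤ (1 + N * τ)⁻¹ - (1 + ((N + 1 : ℕ) : ℝ) * τ)⁻¹ := by
      rw [inv_sub_inv hq.ne' hq'.ne', le_div_iff₀ (by positivity), hqq]
      have : κ * ((1 + N * τ) * (1 + N * τ + τ)) ≤ 1 := by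
        refine le_trans ?_ hκ
        rw [hqq]
        exact mul_le_mul_of_nonneg_left (by nlinarith) hκ0
      nlinarith
    have h4 := mul_le_mul_of_nonneg_right h3 (hb.nonneg (cum τ z N))
    rw [hz]
    linarith

/-- Kinetic part of the energy estimate. Each summand is p n times a difference, bounded below by a
difference of squares of ∂_τ u. The drop τ of the weight per step yields the sum over time, except
at the last index, which is subtracted. -/
theorem sum_energy_ge (hm : IsSemiInner b) {τ : ℝ} (hτ : 0 < τ) (u : ℕ → E) (p : ℕ → ℝ)
    (hp : ∀ n, p n - p (n + 1) = τ) (M : ℕ) (hM : 1 ≤ M) (hp0 : ∀ n, n ≤ M → 0 ≤ p n) :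
    p M / 2 * b (dq τ M u) (dq τ M u) + τ / 2 * ∑ n ∈ Finset.Icc 1 M, b (dq τ n u) (dq τ n u)
        - τ / 2 * b (dq τ M u) (dq τ M u) - p 1 / 2 * b (dq τ 1 u) (dq τ 1 u)
      ≤ ∑ n ∈ Finset.Icc 2 M, τ * b (dq2 τ n u) (p n • dq τ n u) := by
  induction M, hM using Nat.le_induction with
  | base => simp
  | succ M hM ih =>
    specialize ih fun n hn => hp0 n (by omega)
    rw [Finset.sum_Icc_succ_top (by omega), Finset.sum_Icc_succ_top (by omega),
      dq2_eq_dq_sub_dq _ _ hM]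
    have h2 := mul_le_mul_of_nonneg_left (hm.sub_le_two_mul (dq τ (M + 1) u) (dq τ M u))
      (hp0 (M + 1) le_rfl)
    have h3 : p M = p (M + 1) + τ := by linarith [hp M]
    have h4 : τ * b (τ⁻¹ • (dq τ (M + 1) u - dq τ M u)) (p (M + 1) • dq τ (M + 1) u)
        = p (M + 1) * b (dq τ (M + 1) u - dq τ M u) (dq τ (M + 1) u) := by
      simp only [map_smul, LinearMap.smul_apply, smul_eq_mul]
      field_simp
    rw [h4]
    rw [h3] at ih
    linarith

/-- Potential part of the same estimate, with u n in place of ∂_τ u. -/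
theorem sum_potential_ge (hb : IsSemiInner b) {τ : ℝ} (hτ : 0 < τ) (u : ℕ → E) (p : ℕ → ℝ)
    (hp : ∀ n, p n - p (n + 1) = τ) (M : ℕ) (hM : 1 ≤ M) (hp0 : ∀ n, n ≤ M → 0 ≤ p n) :
    p M / 2 * b (u M) (u M) + τ / 2 * ∑ n ∈ Finset.Icc 1 M, b (u n) (u n)
        - τ / 2 * b (u M) (u M) - p 1 / 2 * b (u 1) (u 1)
      ≤ ∑ n ∈ Finset.Icc 2 M, τ * b (u n) (p n • dq τ n u) := by
  induction M, hM using Nat.le_induction with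
  | base => simp
  | succ M hM ih =>
    specialize ih fun n hn => hp0 n (by omega)
    rw [Finset.sum_Icc_succ_top (by omega), Finset.sum_Icc_succ_top (by omega)]
    have h2 := mul_le_mul_of_nonneg_left (hb.sub_le_two_mul (u (M + 1)) (u M))
      (hp0 (M + 1) le_rfl)
    have h3 : p M = p (M + 1) + τ := by linarith [hp M]
    have h4 : τ * b (u (M + 1)) (p (M + 1) • dq τ (M + 1) u)
        = p (M + 1) * b (u (M + 1) - u M) (u (M + 1)) := by
      rw [hb.symm, dq_apply, Nat.add_sub_cancel]
      simp only [map_smul, LinearMap.smul_apply, smul_eq_mul]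
      field_simp
    rw [h4]
    rw [h3] at ih
    linarith

theorem dq2f_eq_dq2 (τ : ℝ) (u : ℕ → E) (n : ℕ) : dq2f τ n u = dq2 τ (n + 2) u := by
  rw [dq2f_apply, dq2_apply, Nat.add_sub_cancel, show n + 2 - 1 = n + 1 by omega]
  module

theorem dq2f_eq_dq_sub_dq (τ : ℝ) (u : ℕ → E) (n : ℕ) :
    dq2f τ n u = τ⁻¹ • (dq τ (n + 2) u - dq τ (n + 1) u) := by
  rw [dq2f_eq_dq2, dq2_eq_dq_sub_dq _ _ (by omega)]

/-- An exact summation by parts. The implicit shift leaves products of consecutive first differences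
instead of squares, so the sum on the right has no sign and must be estimated later. -/
theorem sum_dq2f_parts (hb : IsSemiInner b) {τ : ℝ} (hτ : τ ≠ 0) (u : ℕ → E) (M : ℕ) :
    ∑ n ∈ Finset.range M, τ * b (dq2f τ n u) (u n)
      = b (u M) (dq τ (M + 1) u) - b (u 0) (dq τ 1 u)
        - τ * ∑ n ∈ Finset.range M, b (dq τ (n + 1) u) (dq τ (n + 2) u) := by
  induction M with
  | zero => simp
  | succ M ih =>
    rw [Finset.sum_range_succ, ih, Finset.sum_range_succ, dq2f_eq_dq_sub_dq,
      hb.symm (τ⁻¹ • _) (u M)]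
    have h : u (M + 1) = u M + τ • dq τ (M + 1) u := by
      rw [dq_apply, Nat.add_sub_cancel, smul_inv_smul₀ hτ]; abel
    rw [h]
    simp only [map_smul, map_sub, map_add, LinearMap.smul_apply, LinearMap.add_apply, smul_eq_mul]
    have := hb.symm (u M) (dq τ (M + 1) u)
    field_simp
    ring

end TimeDifferences

/-! ### The scheme for abstract forms, and reversal of time. -/

section AbstractForms

variable {E : Type*} [AddCommGroup E] [Module ℝ E]

namespace IsSemiInner

variable {b b' : E →ₗ[ℝ] E →ₗ[ℝ] ℝ}

theorem add (hb : IsSemiInner b) (hb' : IsSemiInner b') : IsSemiInner (b + b') where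
  symm x y := by simp [hb.symm x y, hb'.symm x y]
  nonneg x := by simpa using add_nonneg (hb.nonneg x) (hb'.nonneg x)

theorem smul (hb : IsSemiInner b) {t : ℝ} (ht : 0 ≤ t) : IsSemiInner (t • b) where
  symm x y := by simp [hb.symm x y]
  nonneg x := by simpa using mul_nonneg ht (hb.nonneg x)

theorem sum {ι : Type*} (s : Finset ι) {b : ι → E →ₗ[ℝ] E →ₗ[ℝ] ℝ}
    (hb : ∀ i, IsSemiInner (b i)) : IsSemiInner (∑ i ∈ s, b i) where
  symm x y := by
    simp only [LinearMap.sum_apply]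
    exact Finset.sum_congr rfl fun i _ => (hb i).symm x y
  nonneg x := by
    simp only [LinearMap.sum_apply]
    exact Finset.sum_nonneg fun i _ => (hb i).nonneg x

theorem comap (hb : IsSemiInner b) {F : Type*} [AddCommGroup F] [Module ℝ F] (f : F →ₗ[ℝ] E) :
    IsSemiInner (b.compl₁₂ f f) where
  symm x y := by simp [hb.symm (f x) (f y)]
  nonneg x := by simpa using hb.nonneg (f x)

end IsSemiInner

variable (m a c : E →ₗ[ℝ] E →ₗ[ℝ] ℝ) (τ h : ℝ) (N : ℕ)

/-- The `n`-th entry of a sequence. -/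
abbrev pr (n : ℕ) : (ℕ → E) →ₗ[ℝ] E := LinearMap.proj n

/-- `𝓖(u, z)` for abstract mass and stiffness forms. -/
def waveG : (ℕ → E) →ₗ[ℝ] (ℕ → E) →ₗ[ℝ] ℝ :=
  τ • ∑ n ∈ Finset.Icc 2 N, (m.compl₁₂ (dq2 τ n) (pr n) + a.compl₁₂ (pr n) (pr n))

/-- `𝓖*(Z, U)` for abstract mass and stiffness forms. -/
def waveGs : (ℕ → E) →ₗ[ℝ] (ℕ → E) →ₗ[ℝ] ℝ :=
  τ • ∑ n ∈ Finset.range (N - 1), (m.compl₁₂ (pr n) (dq2f τ n) + a.compl₁₂ (pr n) (pr n))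

/-- `τ ∑_{n=2}^N c(Uⁿ, zⁿ)`. -/
def waveC : (ℕ → E) →ₗ[ℝ] (ℕ → E) →ₗ[ℝ] ℝ :=
  τ • ∑ n ∈ Finset.Icc 2 N, c.compl₁₂ (pr n) (pr n)

/-- The part of `𝓐` acting on the pair `(u, v)`. -/
def endForm : (ℕ → E) →ₗ[ℝ] (ℕ → E) →ₗ[ℝ] ℝ :=
  a.compl₁₂ (pr 0) (pr 0) + a.compl₁₂ (pr N) (pr N) + m.compl₁₂ (dq τ 1) (dq τ 1)
    + m.compl₁₂ (dq τ N) (dq τ N)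

/-- The regularizing part of `𝓐`, acting on the pair `(U, V)`. -/
def regForm : (ℕ → E) →ₗ[ℝ] (ℕ → E) →ₗ[ℝ] ℝ :=
  h ^ 2 • (a.compl₁₂ (pr N) (pr N) + a.compl₁₂ (dq τ N) (dq τ N) + a.compl₁₂ (dq τ 1) (dq τ 1)
    + τ • ∑ n ∈ Finset.Icc 1 N, a.compl₁₂ (dq τ n) (dq τ n))

theorem waveG_apply (u z : ℕ → E) :
    waveG m a τ N u z = τ * ∑ n ∈ Finset.Icc 2 N, (m (dq2 τ n u) (z n) + a (u n) (z n)) := by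
  simp [waveG]

theorem waveGs_apply (Z U : ℕ → E) :
    waveGs m a τ N Z U
      = τ * ∑ n ∈ Finset.range (N - 1), (m (Z n) (dq2f τ n U) + a (Z n) (U n)) := by
  simp [waveGs]

theorem waveC_apply (U z : ℕ → E) :
    waveC c τ N U z = τ * ∑ n ∈ Finset.Icc 2 N, c (U n) (z n) := by
  simp [waveC]

theorem endForm_apply (u v : ℕ → E) :
    endForm m a τ N u v = a (u 0) (v 0) + a (u N) (v N) + m (dq τ 1 u) (dq τ 1 v)
      + m (dq τ N u) (dq τ N v) := by
  simp [endForm]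

theorem regForm_apply (U V : ℕ → E) :
    regForm a τ h N U V = h ^ 2 * (a (U N) (V N) + a (dq τ N U) (dq τ N V)
      + a (dq τ 1 U) (dq τ 1 V) + τ * ∑ n ∈ Finset.Icc 1 N, a (dq τ n U) (dq τ n V)) := by
  simp [regForm, mul_add]

/-- The squared norm `|||u|||_F²`. -/
def energyF (u : ℕ → E) : ℝ :=
  τ * ∑ n ∈ Finset.Icc 1 N, (m (dq τ n u) (dq τ n u) + a (u n) (u n))

/-- The squared norm `|||U|||_{F'}²`. -/
def energyF' (U : ℕ → E) : ℝ :=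
  τ * ∑ n ∈ Finset.Icc 2 N, (m (dq2 τ n U) (dq2 τ n U) + a (dq τ n U) (dq τ n U)
      + m (dq τ n U) (dq τ n U) + a (U n) (U n))
    + m (dq τ 1 U) (dq τ 1 U) + a (U 1) (U 1)

/-- `τ ∑_{n=2}^N m(zⁿ, zⁿ)`. -/
def massSum (z : ℕ → E) : ℝ := τ * ∑ n ∈ Finset.Icc 2 N, m (z n) (z n)

/-- `τ ∑_{n=0}^{N-2} m(Zⁿ, Zⁿ)`. -/
def massSum' (Z : ℕ → E) : ℝ := τ * ∑ n ∈ Finset.range (N - 1), m (Z n) (Z n)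

/-- The squared norm `|||z|||_D²`. -/
def energyD (z : ℕ → E) : ℝ :=
  massSum m τ N z + τ * ∑ n ∈ Finset.Icc 2 N, a (cum τ z n) (cum τ z n)
    + a (cum τ z N) (cum τ z N) + m (z N) (z N)

/-- The squared norm `|||Z|||_{D'}²`. -/
def energyD' (Z : ℕ → E) : ℝ :=
  massSum' m τ N Z + τ * ∑ n ∈ Finset.range (N - 1), a (cumB τ N Z n) (cumB τ N Z n)
    + a (cumB τ N Z 0) (cumB τ N Z 0) + m (Z 0) (Z 0)

/-- The structural assumptions under which the stability estimate holds: `m`, `a` and `c` are the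
mass, stiffness and control forms, related by a Poincaré and an inverse inequality. -/
structure WaveForms (T cτ CP CI Cχ : ℝ) : Prop where
  mass : IsSemiInner m
  stiff : IsSemiInner a
  two_le : 2 ≤ N
  τ_pos : 0 < τ
  mul_eq : N * τ = T
  h_pos : 0 < h
  h_le_one : h ≤ 1
  τ_le : τ ≤ cτ * h
  poincare : ∀ x, m x x ≤ CP * a x x
  inverse : ∀ x, h ^ 2 * a x x ≤ CI * m x x
  control : ∀ t : ℝ, 0 < t → ∀ x y, |c x y| ≤ Cχ * (t * m x x + t⁻¹ * m y y)

/-- Reversal of time. -/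
def rev (u : ℕ → E) (n : ℕ) : E := u (N - n)

theorem sum_range_eq_sum_Icc_rev {M : Type*} [AddCommMonoid M] (f : ℕ → M) :
    ∑ n ∈ Finset.range (N - 1), f n = ∑ n ∈ Finset.Icc 2 N, f (N - n) := by
  refine Finset.sum_nbij' (fun n => N - n) (fun n => N - n) ?_ ?_ ?_ ?_ ?_ <;>
    simp only [Finset.mem_range, Finset.mem_Icc] <;> intro n hn
  · omega
  · omega
  · omega
  · omega
  · rw [show N - (N - n) = n by omega]

theorem dq2f_rev (u : ℕ → E) {n : ℕ} (hn : n ∈ Finset.Icc 2 N) :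
    dq2f τ (N - n) u = dq2 τ n (rev N u) := by
  rw [Finset.mem_Icc] at hn
  rw [dq2f_apply, dq2_apply, rev, rev, rev, show N - n + 1 = N - (n - 1) by omega,
    show N - n + 2 = N - (n - 2) by omega]

/-- Reversal exchanges forward and backward second differences. Hence the dual estimates for Z
follow from the primal ones for z. -/
theorem waveGs_eq_waveG_rev (hm : IsSemiInner m) (ha : IsSemiInner a) (Z U : ℕ → E) :
    waveGs m a τ N Z U = waveG m a τ N (rev N U) (rev N Z) := by
  rw [waveGs_apply, waveG_apply, sum_range_eq_sum_Icc_rev]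
  congr 1
  refine Finset.sum_congr rfl fun n hn => ?_
  rw [dq2f_rev τ N U hn, hm.symm, ha.symm]
  rfl

theorem cumB_eq_cum_rev (Z : ℕ → E) {n : ℕ} (hn : n ≤ N) :
    cumB τ N Z n = cum τ (rev N Z) (N - n) := by
  rw [cumB, cum]
  congr 1
  refine Finset.sum_nbij' (fun k => N - k) (fun k => N - k) ?_ ?_ ?_ ?_ ?_ <;>
    simp only [Finset.mem_range, Finset.mem_Icc] <;> intro k hk
  · omega
  · omega
  · omega
  · omega
  · rw [rev, show N - (N - k) = k by omega, Nat.cast_sub hk.2]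

theorem energyD'_eq_energyD_rev (Z : ℕ → E) :
    energyD' m a τ N Z = energyD m a τ N (rev N Z) := by
  rw [energyD', energyD, massSum', massSum, sum_range_eq_sum_Icc_rev, sum_range_eq_sum_Icc_rev,
    cumB_eq_cum_rev τ N Z (Nat.zero_le N), Nat.sub_zero]
  have h1 : ∀ n ∈ Finset.Icc 2 N, a (cumB τ N Z (N - n)) (cumB τ N Z (N - n))
      = a (cum τ (rev N Z) n) (cum τ (rev N Z) n) := fun n hn => by
    rw [Finset.mem_Icc] at hn
    rw [cumB_eq_cum_rev τ N Z (Nat.sub_le _ _), show N - (N - n) = n by omega]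
  rw [Finset.sum_congr rfl h1]
  simp [rev]

/-- Needed because the reversed backward sum agrees with the forward sum of the reversed sequence
only for indices up to N. -/
theorem waveG_congr_left {u u' : ℕ → E} (z : ℕ → E) (hu : ∀ n ≤ N, u n = u' n) :
    waveG m a τ N u z = waveG m a τ N u' z := by
  rw [waveG_apply, waveG_apply]
  congr 1
  refine Finset.sum_congr rfl fun n hn => ?_
  rw [Finset.mem_Icc] at hn
  rw [dq2_apply, dq2_apply, hu n hn.2, hu (n - 1) (by omega), hu (n - 2) (by omega)]

theorem dq_cumB {τ : ℝ} (hτ : τ ≠ 0) (Z : ℕ → E) {n : ℕ} (h1 : 1 ≤ n) (hn : n ≤ N) :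
    dq τ n (cumB τ N Z) = -((1 + ((N : ℝ) - (n - 1 : ℕ)) * τ) • Z (n - 1)) := by
  rw [dq_apply, cumB_eq_cum_rev τ N Z hn, cumB_eq_cum_rev τ N Z (by omega : n - 1 ≤ N),
    show N - (n - 1) = N - n + 1 by omega, cum_succ, rev, show N - (N - n + 1) = n - 1 by omega,
    show N - n + 1 = N - (n - 1) by omega, Nat.cast_sub (by omega : n - 1 ≤ N),
    sub_add_cancel_left, smul_neg, inv_smul_smul₀ hτ]

theorem cumB_last {Z : ℕ → E} (hZ : Z N = 0) : cumB τ N Z N = 0 := by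
  simp [cumB, hZ]

theorem sum_dq {τ : ℝ} (hτ : τ ≠ 0) (U : ℕ → E) {n : ℕ} (hn : n ≤ N) :
    τ • ∑ k ∈ Finset.Ioc n N, dq τ k U = U N - U n := by
  induction N, hn using Nat.le_induction with
  | base => simp
  | succ N hn ih =>
    rw [Finset.sum_Ioc_succ_top (by omega), smul_add, ih, dq_apply, Nat.add_sub_cancel,
      smul_inv_smul₀ hτ]
    abel

end AbstractForms

/-! ### Lower bounds for the four test sequences. -/

namespace WaveForms

variable {E : Type*} [AddCommGroup E] [Module ℝ E] {m a c : E →ₗ[ℝ] E →ₗ[ℝ] ℝ} {τ h : ℝ} {N : ℕ}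
  {T cτ CP CI Cχ : ℝ}

section Basic

variable (H : WaveForms m a c τ h N T cτ CP CI Cχ)
include H

theorem endForm_isSemiInner : IsSemiInner (endForm m a τ N) :=
  (((H.stiff.comap _).add (H.stiff.comap _)).add (H.mass.comap _)).add (H.mass.comap _)

theorem regForm_isSemiInner : IsSemiInner (regForm a τ h N) :=
  ((((H.stiff.comap _).add (H.stiff.comap _)).add (H.stiff.comap _)).add
    ((IsSemiInner.sum _ fun _ => H.stiff.comap _).smul H.τ_pos.le)).smul (sq_nonneg h)

theorem T_pos : 0 < T := by
  have := H.two_le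
  rw [← H.mul_eq]
  exact mul_pos (by exact_mod_cast (by omega : 0 < N)) H.τ_pos

theorem mul_le {n : ℕ} (hn : n ≤ N) : n * τ ≤ T := by
  rw [← H.mul_eq]
  exact mul_le_mul_of_nonneg_right (by exact_mod_cast hn) H.τ_pos.le

theorem τ_le_T : τ ≤ T := by
  have h1 := H.mul_le (n := 1) (by have := H.two_le; omega)
  simpa using h1

theorem sum_nonneg_mul {b : E →ₗ[ℝ] E →ₗ[ℝ] ℝ} (hb : IsSemiInner b) (s : Finset ℕ) (x : ℕ → E) :
    0 ≤ τ * ∑ n ∈ s, b (x n) (x n) :=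
  mul_nonneg H.τ_pos.le (Finset.sum_nonneg fun _ _ => hb.nonneg _)

theorem mul_sum_le {s : Finset ℕ} (hs : s ⊆ Finset.Icc 1 N) (f : ℕ → ℝ) {L : ℝ} (hL0 : 0 ≤ L)
    (hf : ∀ n ∈ s, f n ≤ L) : τ * ∑ n ∈ s, f n ≤ T * L := by
  have h1 : ∑ n ∈ s, f n ≤ N * L := by
    refine (Finset.sum_le_card_nsmul _ _ _ hf).trans ?_
    rw [nsmul_eq_mul]
    have h2 := Finset.card_le_card hs
    rw [Nat.card_Icc, Nat.add_sub_cancel] at h2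
    exact mul_le_mul_of_nonneg_right (by exact_mod_cast h2) hL0
  calc _ ≤ τ * (N * L) := mul_le_mul_of_nonneg_left h1 H.τ_pos.le
    _ = N * τ * L := by ring
    _ = _ := by rw [H.mul_eq]

theorem endForm_self_nonneg (u : ℕ → E) : 0 ≤ endForm m a τ N u u :=
  H.endForm_isSemiInner.nonneg u

theorem regForm_self_nonneg (U : ℕ → E) : 0 ≤ regForm a τ h N U U :=
  H.regForm_isSemiInner.nonneg U

theorem energyD_nonneg (z : ℕ → E) : 0 ≤ energyD m a τ N z := by
  have h1 := H.sum_nonneg_mul H.mass (Finset.Icc 2 N) z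
  have h2 := H.sum_nonneg_mul H.stiff (Finset.Icc 2 N) (cum τ z)
  have h3 := H.stiff.nonneg (cum τ z N)
  have h4 := H.mass.nonneg (z N)
  rw [energyD, massSum]
  linarith

theorem massSum_le (z : ℕ → E) : massSum m τ N z ≤ energyD m a τ N z := by
  have h2 := H.sum_nonneg_mul H.stiff (Finset.Icc 2 N) (cum τ z)
  have h3 := H.stiff.nonneg (cum τ z N)
  have h4 := H.mass.nonneg (z N)
  rw [energyD]
  linarith

theorem end_le_energyD (z : ℕ → E) :
    a (cum τ z N) (cum τ z N) + m (z N) (z N) ≤ energyD m a τ N z := by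
  have h1 := H.sum_nonneg_mul H.mass (Finset.Icc 2 N) z
  have h2 := H.sum_nonneg_mul H.stiff (Finset.Icc 2 N) (cum τ z)
  rw [energyD, massSum]
  linarith

theorem energyF_nonneg (u : ℕ → E) : 0 ≤ energyF m a τ N u :=
  mul_nonneg H.τ_pos.le (Finset.sum_nonneg fun _ _ =>
    add_nonneg (H.mass.nonneg _) (H.stiff.nonneg _))

theorem energyF'_nonneg (U : ℕ → E) : 0 ≤ energyF' m a τ N U :=
  add_nonneg (add_nonneg (mul_nonneg H.τ_pos.le (Finset.sum_nonneg fun _ _ =>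
    add_nonneg (add_nonneg (add_nonneg (H.mass.nonneg _) (H.stiff.nonneg _)) (H.mass.nonneg _))
      (H.stiff.nonneg _))) (H.mass.nonneg _)) (H.stiff.nonneg _)

end Basic

section Coercivity

variable (H : WaveForms m a c τ h N T cτ CP CI Cχ)
include H

theorem waveG_cum_ge {z : ℕ → E} (h0 : z 0 = 0) (h1 : z 1 = 0) :
    energyD m a τ N z / (2 * (1 + T) ^ 2) ≤ waveG m a τ N (cum τ z) z := by
  have hN : 1 ≤ N := by have := H.two_le; omega
  have hT := H.T_pos
  have hQ : 0 < (1 + T) ^ 2 := by positivity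
  have e1 := sum_dq2_cum_ge H.mass H.τ_pos h1 N hN
  have e2 := sum_cum_ge H.stiff (κ := ((1 + T) ^ 2)⁻¹) H.τ_pos h0 h1 N hN
    (by rw [H.mul_eq, inv_mul_cancel₀ hQ.ne']) (inv_pos.2 hQ).le
  rw [H.mul_eq] at e1 e2
  have e3 : waveG m a τ N (cum τ z) z
      = ∑ n ∈ Finset.Icc 2 N, τ * m (dq2 τ n (cum τ z)) (z n)
        + ∑ n ∈ Finset.Icc 2 N, τ * a (cum τ z n) (z n) := by
    rw [waveG_apply, Finset.sum_add_distrib, mul_add, Finset.mul_sum, Finset.mul_sum]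
  have n1 := H.sum_nonneg_mul H.mass (Finset.Icc 2 N) z
  have n3 := H.stiff.nonneg (cum τ z N)
  have n4 := H.mass.nonneg (z N)
  have hk : ((1 + T) ^ 2)⁻¹ ≤ 1 := inv_le_one_of_one_le₀ (one_le_pow₀ (by linarith))
  have hk0 : 0 < ((1 + T) ^ 2)⁻¹ := inv_pos.2 hQ
  -- The end term of the weighted sum has the coefficient (1 + T)⁻¹, less the part κτ lost at the
  -- last index. What remains is (1 + T)⁻² (1 + T - τ), and τ ≤ T.
  have hr : ((1 + T) ^ 2)⁻¹ ≤ (1 + T)⁻¹ - ((1 + T) ^ 2)⁻¹ * τ := by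
    have : (1 + T)⁻¹ = ((1 + T) ^ 2)⁻¹ * (1 + T) := by field_simp
    rw [this]
    nlinarith [H.τ_le_T]
  have hd : ∀ X : ℝ, X / (2 * (1 + T) ^ 2) = ((1 + T) ^ 2)⁻¹ / 2 * X := fun X => by
    field_simp
  rw [e3, hd, energyD, massSum]
  generalize ((1 + T) ^ 2)⁻¹ = k at *
  nlinarith [mul_le_mul_of_nonneg_right hk n1, mul_le_mul_of_nonneg_right hk n4,
    mul_le_mul_of_nonneg_right hr n3, mul_nonneg hT.le n4]

theorem waveGs_cumB_ge {Z : ℕ → E} (h0 : Z N = 0) (h1 : Z (N - 1) = 0) :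
    energyD' m a τ N Z / (2 * (1 + T) ^ 2) ≤ waveGs m a τ N Z (cumB τ N Z) := by
  rw [waveGs_eq_waveG_rev m a τ N H.mass H.stiff, energyD'_eq_energyD_rev,
    waveG_congr_left m a τ N (u' := cum τ (rev N Z)) _ fun n hn => by
      rw [rev, cumB_eq_cum_rev τ N Z (Nat.sub_le _ _), show N - (N - n) = n by omega]]
  exact H.waveG_cum_ge (by simpa [rev] using h0) (by simpa [rev] using h1)

/-- The zero values of z at 0 and 1 make the weighted sum and its first difference vanish at the
initial time. Testing with it therefore meets only the terms at the final time. -/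
theorem endForm_cum (u : ℕ → E) {z : ℕ → E} (h0 : z 0 = 0) (h1 : z 1 = 0) :
    endForm m a τ N u (cum τ z) = a (u N) (cum τ z N) + m (dq τ N u) ((1 + T) • z N) := by
  have hN : 1 ≤ N := by have := H.two_le; omega
  rw [endForm_apply, dq_cum H.τ_pos.ne' _ _ hN, H.mul_eq, dq_cum H.τ_pos.ne' _ _ le_rfl,
    cum_zero h0, h1]
  simp

theorem endForm_cum_self_le {z : ℕ → E} (h0 : z 0 = 0) (h1 : z 1 = 0) :
    endForm m a τ N (cum τ z) (cum τ z) ≤ (1 + T) ^ 2 * energyD m a τ N z := by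
  have hN : 1 ≤ N := by have := H.two_le; omega
  have hT := H.T_pos
  rw [H.endForm_cum _ h0 h1, dq_cum H.τ_pos.ne' _ _ hN, H.mul_eq, apply_smul_smul]
  have n3 := H.stiff.nonneg (cum τ z N)
  have h2 := mul_le_mul_of_nonneg_left (H.end_le_energyD z) (by positivity : 0 ≤ (1 + T) ^ 2)
  have h3 : 1 * a (cum τ z N) (cum τ z N) ≤ (1 + T) ^ 2 * a (cum τ z N) (cum τ z N) :=
    mul_le_mul_of_nonneg_right (one_le_pow₀ (by linarith)) n3
  linarith

theorem test_cum (u : ℕ → E) {z : ℕ → E} (h0 : z 0 = 0) (h1 : z 1 = 0) :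
    energyD m a τ N z / (4 * (1 + T) ^ 2) - (1 + T) ^ 4 * endForm m a τ N u u
      ≤ waveG m a τ N (cum τ z) z + endForm m a τ N u (cum τ z) := by
  have hT := H.T_pos
  have g := H.waveG_cum_ge h0 h1
  -- With this Young parameter the two products together use half of the gain D / (2 (1 + T)²). The
  -- fourth power is needed because z N enters with the factor 1 + T.
  have e1 := H.stiff.neg_le_two_mul (t := 2 * (1 + T) ^ 4) (by positivity) (u N) (cum τ z N)
  have e2 := H.mass.neg_le_two_mul (t := 2 * (1 + T) ^ 4) (by positivity) (dq τ N u)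
    ((1 + T) • z N)
  have hu : a (u N) (u N) + m (dq τ N u) (dq τ N u) ≤ endForm m a τ N u u := by
    rw [endForm_apply]
    linarith [H.stiff.nonneg (u 0), H.mass.nonneg (dq τ 1 u)]
  have hz := H.end_le_energyD z
  have n3 := H.stiff.nonneg (cum τ z N)
  rw [apply_smul_smul] at e2
  have i1 : (2 * (1 + T) ^ 4)⁻¹ * ((1 + T) ^ 2 * m (z N) (z N))
      = m (z N) (z N) / (2 * (1 + T) ^ 2) := by field_simp
  have i2 : (2 * (1 + T) ^ 4)⁻¹ * a (cum τ z N) (cum τ z N)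
      ≤ a (cum τ z N) (cum τ z N) / (2 * (1 + T) ^ 2) := by
    rw [inv_mul_eq_div]
    exact div_le_div_of_nonneg_left n3 (by positivity)
      (by gcongr <;> linarith)
  have i3 : (a (cum τ z N) (cum τ z N) + m (z N) (z N)) / (2 * (1 + T) ^ 2)
      ≤ energyD m a τ N z / (2 * (1 + T) ^ 2) := by gcongr
  have i4 : energyD m a τ N z / (4 * (1 + T) ^ 2)
      = energyD m a τ N z / (2 * (1 + T) ^ 2) / 2 := by field_simp; ring
  have i5 := mul_le_mul_of_nonneg_left hu (by positivity : 0 ≤ (1 + T) ^ 4)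
  rw [add_div] at i3
  rw [H.endForm_cum _ h0 h1, i4]
  linarith

/-- First differences of the backward sum are multiples of values of Z, with factor at most 1 + T.
The inverse inequality spends the factor h² of the regularization to replace their gradients by L²
norms. The terms at the final time vanish, and the one at n = 1 is the end term Z 0 of the D'-norm.
-/
theorem regForm_cumB_self_le (hCI : 0 ≤ CI) {Z : ℕ → E} (h0 : Z N = 0) (h1 : Z (N - 1) = 0) :
    regForm a τ h N (cumB τ N Z) (cumB τ N Z) ≤ CI * (1 + T) ^ 2 * energyD' m a τ N Z := by
  have hN := H.two_le
  have hT := H.T_pos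
  have hdq : ∀ n ∈ Finset.Icc 1 N, h ^ 2 * a (dq τ n (cumB τ N Z)) (dq τ n (cumB τ N Z))
      ≤ CI * (1 + T) ^ 2 * m (Z (n - 1)) (Z (n - 1)) := fun n hn => by
    rw [Finset.mem_Icc] at hn
    refine (H.inverse _).trans ?_
    rw [dq_cumB N H.τ_pos.ne' Z hn.1 hn.2, mul_assoc]
    simp only [map_neg, LinearMap.neg_apply, neg_neg]
    rw [apply_smul_smul]
    refine mul_le_mul_of_nonneg_left (mul_le_mul_of_nonneg_right ?_ (H.mass.nonneg _)) hCI
    rw [← Nat.cast_sub (by omega : n - 1 ≤ N)]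
    have := H.mul_le (Nat.sub_le N (n - 1))
    have h3 : 0 ≤ ((N - (n - 1) : ℕ) : ℝ) * τ := mul_nonneg (Nat.cast_nonneg _) H.τ_pos.le
    gcongr
  have e1 := hdq 1 (by rw [Finset.mem_Icc]; omega)
  have e2 := hdq N (by rw [Finset.mem_Icc]; omega)
  have e3 : h ^ 2 * (τ * ∑ n ∈ Finset.Icc 1 N, a (dq τ n (cumB τ N Z)) (dq τ n (cumB τ N Z)))
      ≤ CI * (1 + T) ^ 2 * massSum' m τ N Z := by
    have s1 : ∑ n ∈ Finset.Icc 1 N, h ^ 2 * a (dq τ n (cumB τ N Z)) (dq τ n (cumB τ N Z))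
        ≤ ∑ n ∈ Finset.Icc 1 N, CI * (1 + T) ^ 2 * m (Z (n - 1)) (Z (n - 1)) :=
      Finset.sum_le_sum hdq
    have s2 : ∑ n ∈ Finset.Icc 1 N, m (Z (n - 1)) (Z (n - 1))
        = ∑ n ∈ Finset.range (N - 1), m (Z n) (Z n) := by
      have hN1 : N - 1 + 1 = N := by omega
      rw [← Finset.Ico_add_one_right_eq_Icc, Finset.sum_Ico_eq_sum_range, Nat.add_sub_cancel,
        ← hN1, Finset.sum_range_succ]
      simp [h1]
    rw [← Finset.mul_sum, ← Finset.mul_sum, s2] at s1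
    rw [massSum']
    calc _ = τ * (h ^ 2 * ∑ n ∈ Finset.Icc 1 N,
          a (dq τ n (cumB τ N Z)) (dq τ n (cumB τ N Z))) := by ring
      _ ≤ τ * _ := mul_le_mul_of_nonneg_left s1 H.τ_pos.le
      _ = _ := by ring
  have n1 := H.sum_nonneg_mul H.stiff (Finset.range (N - 1)) (cumB τ N Z)
  have n2 := H.stiff.nonneg (cumB τ N Z 0)
  have hle : massSum' m τ N Z + m (Z 0) (Z 0) ≤ energyD' m a τ N Z := by
    rw [energyD']; linarith
  have hle' := mul_le_mul_of_nonneg_left hle (by positivity : 0 ≤ CI * (1 + T) ^ 2)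
  rw [h1] at e2
  simp only [map_zero, mul_zero] at e2
  rw [Nat.sub_self] at e1
  rw [regForm_apply, cumB_last τ N h0]
  simp only [map_zero]
  linarith

theorem mass_cumB_le {Z : ℕ → E} (h0 : Z N = 0) (h1 : Z (N - 1) = 0) {n : ℕ} (hn : n ≤ N) :
    m (cumB τ N Z n) (cumB τ N Z n) ≤ 2 * T * (1 + T) ^ 2 * massSum' m τ N Z := by
  have hN := H.two_le
  have hT := H.T_pos
  have hτ := H.τ_pos
  -- There may be N + 1 indices, one more than time steps, whence 2T instead of T.
  have hL : τ * ((Finset.Icc n N).card : ℝ) ≤ 2 * T := by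
    have h2 : ((Finset.Icc n N).card : ℝ) ≤ 2 * N := by
      rw [Nat.card_Icc]; exact_mod_cast (by omega)
    calc _ ≤ τ * (2 * N) := mul_le_mul_of_nonneg_left h2 hτ.le
      _ = 2 * (N * τ) := by ring
      _ = _ := by rw [H.mul_eq]
  refine (H.mass.smul_sum_le _ _ hτ.le hL).trans ?_
  rw [massSum', mul_assoc (2 * T)]
  refine mul_le_mul_of_nonneg_left ?_ (by positivity)
  rw [mul_left_comm]
  refine mul_le_mul_of_nonneg_left ?_ hτ.le
  rw [Finset.mul_sum]
  have e : ∑ k ∈ Finset.range (N - 1), (1 + T) ^ 2 * m (Z k) (Z k)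
      = ∑ k ∈ Finset.range (N + 1), (1 + T) ^ 2 * m (Z k) (Z k) := by
    refine Finset.sum_subset (fun k hk => ?_) fun k hk hk' => ?_
    · rw [Finset.mem_range] at *; omega
    · rw [Finset.mem_range] at *
      obtain rfl | rfl : k = N ∨ k = N - 1 := by omega
      · simp [h0]
      · simp [h1]
  rw [e]
  refine (Finset.sum_le_sum fun k hk => ?_).trans (Finset.sum_le_sum_of_subset_of_nonneg
    (s := Finset.Icc n N) (fun k hk => ?_) fun k _ _ =>
      mul_nonneg (by positivity) (H.mass.nonneg _))
  · rw [Finset.mem_Icc] at hk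
    rw [apply_smul_smul]
    refine mul_le_mul_of_nonneg_right ?_ (H.mass.nonneg _)
    rw [← Nat.cast_sub hk.2]
    have := H.mul_le (Nat.sub_le N k)
    have h3 : 0 ≤ ((N - k : ℕ) : ℝ) * τ := mul_nonneg (Nat.cast_nonneg _) hτ.le
    gcongr
  · rw [Finset.mem_Icc] at hk
    rw [Finset.mem_range]; omega

theorem abs_waveC_le {t : ℝ} (ht : 0 < t) (U z : ℕ → E) :
    |waveC c τ N U z| ≤ Cχ * (t * massSum m τ N U + t⁻¹ * massSum m τ N z) := by
  rw [waveC_apply, abs_mul, abs_of_pos H.τ_pos, massSum, massSum]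
  have h1 : |∑ n ∈ Finset.Icc 2 N, c (U n) (z n)|
      ≤ ∑ n ∈ Finset.Icc 2 N, Cχ * (t * m (U n) (U n) + t⁻¹ * m (z n) (z n)) :=
    (Finset.abs_sum_le_sum_abs _ _).trans (Finset.sum_le_sum fun n _ => H.control t ht _ _)
  rw [← Finset.mul_sum, Finset.sum_add_distrib, ← Finset.mul_sum, ← Finset.mul_sum] at h1
  calc _ ≤ τ * _ := mul_le_mul_of_nonneg_left h1 H.τ_pos.le
    _ = _ := by ring

theorem test_cumB (hCI : 0 < CI) (hCχ : 0 < Cχ) (U z : ℕ → E) {Z : ℕ → E} (h0 : Z N = 0)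
    (h1 : Z (N - 1) = 0) :
    energyD' m a τ N Z / (4 * (1 + T) ^ 2)
        - (16 * T ^ 2 * (1 + T) ^ 4 * Cχ ^ 2 * energyD m a τ N z
          + 2 * (1 + T) ^ 4 * CI * regForm a τ h N U U)
      ≤ waveGs m a τ N Z (cumB τ N Z) - waveC c τ N (cumB τ N Z) z
        + regForm a τ h N U (cumB τ N Z) := by
  have hT := H.T_pos
  have g := H.waveGs_cumB_ge h0 h1
  -- Both Young parameters, here and in `e2`, are chosen so that each cross term costs D' / (8 (1 +
  -- T)²). Together they use half of the gain D' / (2 (1 + T)²).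
  have e1 := H.regForm_isSemiInner.neg_le_two_mul (t := 4 * (1 + T) ^ 4 * CI) (by positivity) U
    (cumB τ N Z)
  have e2 := H.abs_waveC_le (t := (16 * T ^ 2 * (1 + T) ^ 4 * Cχ)⁻¹) (by positivity)
    (cumB τ N Z) z
  have e3 := H.regForm_cumB_self_le hCI.le h0 h1
  have e4 : massSum' m τ N Z ≤ energyD' m a τ N Z := by
    have n1 := H.sum_nonneg_mul H.stiff (Finset.range (N - 1)) (cumB τ N Z)
    have n2 := H.stiff.nonneg (cumB τ N Z 0)
    have n3 := H.mass.nonneg (Z 0)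
    rw [energyD']; linarith
  have e5 : massSum m τ N (cumB τ N Z) ≤ T * (2 * T * (1 + T) ^ 2 * energyD' m a τ N Z) := by
    refine (H.mul_sum_le (Finset.Icc_subset_Icc_left one_le_two) _ ?_ fun n hn =>
      H.mass_cumB_le h0 h1 (Finset.mem_Icc.1 hn).2).trans ?_
    · exact mul_nonneg (by positivity) (H.sum_nonneg_mul H.mass _ _)
    · gcongr
  have e6 : Cχ * ((16 * T ^ 2 * (1 + T) ^ 4 * Cχ)⁻¹ * massSum m τ N (cumB τ N Z)
      + (16 * T ^ 2 * (1 + T) ^ 4 * Cχ)⁻¹⁻¹ * massSum m τ N z)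
      ≤ energyD' m a τ N Z / (8 * (1 + T) ^ 2)
        + 16 * T ^ 2 * (1 + T) ^ 4 * Cχ ^ 2 * energyD m a τ N z := by
    have f1 : Cχ * ((16 * T ^ 2 * (1 + T) ^ 4 * Cχ)⁻¹ * massSum m τ N (cumB τ N Z))
        ≤ Cχ * ((16 * T ^ 2 * (1 + T) ^ 4 * Cχ)⁻¹
          * (T * (2 * T * (1 + T) ^ 2 * energyD' m a τ N Z))) := by gcongr
    have f2 : Cχ * ((16 * T ^ 2 * (1 + T) ^ 4 * Cχ)⁻¹
          * (T * (2 * T * (1 + T) ^ 2 * energyD' m a τ N Z)))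
        = energyD' m a τ N Z / (8 * (1 + T) ^ 2) := by field_simp; ring
    have f3 := mul_le_mul_of_nonneg_left (H.massSum_le z)
      (by positivity : 0 ≤ 16 * T ^ 2 * (1 + T) ^ 4 * Cχ ^ 2)
    rw [inv_inv]
    linarith
  have e7 : (4 * (1 + T) ^ 4 * CI)⁻¹ * regForm a τ h N (cumB τ N Z) (cumB τ N Z)
      ≤ energyD' m a τ N Z / (4 * (1 + T) ^ 2) := by
    have f1 : (4 * (1 + T) ^ 4 * CI)⁻¹ * regForm a τ h N (cumB τ N Z) (cumB τ N Z)
        ≤ (4 * (1 + T) ^ 4 * CI)⁻¹ * (CI * (1 + T) ^ 2 * energyD' m a τ N Z) := by gcongr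
    refine f1.trans (le_of_eq ?_)
    field_simp
  have e8 := (le_abs_self _).trans e2
  have i4 : energyD' m a τ N Z / (2 * (1 + T) ^ 2)
      = 4 * (energyD' m a τ N Z / (8 * (1 + T) ^ 2)) := by field_simp; ring
  have i5 : energyD' m a τ N Z / (4 * (1 + T) ^ 2)
      = 2 * (energyD' m a τ N Z / (8 * (1 + T) ^ 2)) := by field_simp; ring
  rw [i4] at g
  rw [i5] at e7 ⊢
  linarith

end Coercivity

section Energy

variable (H : WaveForms m a c τ h N T cτ CP CI Cχ)
include H

theorem stiff_dq_sum_le (U : ℕ → E) :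
    h ^ 2 * (a (U N) (U N) + τ * ∑ n ∈ Finset.Icc 1 N, a (dq τ n U) (dq τ n U))
      ≤ regForm a τ h N U U := by
  rw [regForm_apply]
  gcongr
  linarith [H.stiff.nonneg (dq τ N U), H.stiff.nonneg (dq τ 1 U)]

/-- Each value of U is its final value minus the time integral of its first difference, and the
regularization controls both with the factor h². -/
theorem stiff_le_regForm (U : ℕ → E) {n : ℕ} (hn : n ≤ N) :
    h ^ 2 * a (U n) (U n) ≤ 2 * (1 + T) * regForm a τ h N U U := by
  have hT := H.T_pos
  have hN := H.two_le
  have h1 : U n = U N + -(τ • ∑ k ∈ Finset.Ioc n N, dq τ k U) := by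
    rw [sum_dq N H.τ_pos.ne' U hn]; abel
  have h2 := H.stiff.add_le (U N) (-(τ • ∑ k ∈ Finset.Ioc n N, dq τ k U))
  rw [← h1] at h2
  have hL : τ * ((Finset.Ioc n N).card : ℝ) ≤ T := by
    rw [Nat.card_Ioc, mul_comm]
    exact H.mul_le (Nat.sub_le _ _)
  have h3 := H.stiff.smul_sum_le (Finset.Ioc n N) (fun k => dq τ k U) H.τ_pos.le hL
  have h4 : ∑ k ∈ Finset.Ioc n N, a (dq τ k U) (dq τ k U)
      ≤ ∑ k ∈ Finset.Icc 1 N, a (dq τ k U) (dq τ k U) :=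
    Finset.sum_le_sum_of_subset_of_nonneg (fun k hk => by
      rw [Finset.mem_Ioc] at hk; rw [Finset.mem_Icc]; omega) fun _ _ _ => H.stiff.nonneg _
  have h5 : T * (τ * ∑ k ∈ Finset.Ioc n N, a (dq τ k U) (dq τ k U))
      ≤ T * (τ * ∑ k ∈ Finset.Icc 1 N, a (dq τ k U) (dq τ k U)) := by
    have := H.τ_pos
    gcongr
  simp only [map_neg, LinearMap.neg_apply, neg_neg] at h2
  have n1 := H.stiff.nonneg (U N)
  have n2 := H.sum_nonneg_mul H.stiff (Finset.Icc 1 N) fun k => dq τ k U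
  have h6 : a (U n) (U n) ≤ 2 * (1 + T)
      * (a (U N) (U N) + τ * ∑ n ∈ Finset.Icc 1 N, a (dq τ n U) (dq τ n U)) := by
    nlinarith [mul_nonneg hT.le n1]
  calc _ ≤ h ^ 2 * (2 * (1 + T)
      * (a (U N) (U N) + τ * ∑ n ∈ Finset.Icc 1 N, a (dq τ n U) (dq τ n U))) := by gcongr
    _ = 2 * (1 + T) * (h ^ 2
      * (a (U N) (U N) + τ * ∑ n ∈ Finset.Icc 1 N, a (dq τ n U) (dq τ n U))) := by ring
    _ ≤ _ := mul_le_mul_of_nonneg_left (H.stiff_dq_sum_le U) (by positivity)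

theorem weight_mem {n : ℕ} (hn : n ∈ Finset.Icc 1 N) :
    0 ≤ 1 + ((N : ℝ) + 1 - n) * τ ∧ 1 + ((N : ℝ) + 1 - n) * τ ≤ 1 + T := by
  rw [Finset.mem_Icc] at hn
  have h1 : (1 : ℝ) ≤ n := by exact_mod_cast hn.1
  have h2 : (n : ℝ) ≤ N := by exact_mod_cast hn.2
  have h3 := H.τ_pos
  constructor
  · have : 0 ≤ ((N : ℝ) + 1 - n) * τ := mul_nonneg (by linarith) h3.le
    linarith
  · rw [← H.mul_eq]
    gcongr
    linarith

end Energy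

end WaveForms

section TestSequences

variable {E : Type*} [AddCommGroup E] [Module ℝ E]

/-- The test sequence `wⁿ = h² (1 + (N + 1 - n)τ) ∂_τ uⁿ` for the energy estimate. -/
def energyTest (τ h : ℝ) (N : ℕ) (u : ℕ → E) (n : ℕ) : E :=
  h ^ 2 • (1 + ((N : ℝ) + 1 - n) * τ) • dq τ n u

/-- The test sequence `Wⁿ = h² ∂̃_τ² Uⁿ`. -/
def accelTest (τ h : ℝ) (U : ℕ → E) (n : ℕ) : E := h ^ 2 • dq2f τ n U

end TestSequences

namespace WaveForms

variable {E : Type*} [AddCommGroup E] [Module ℝ E] {m a c : E →ₗ[ℝ] E →ₗ[ℝ] ℝ} {τ h : ℝ} {N : ℕ}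
  {T cτ CP CI Cχ : ℝ} (H : WaveForms m a c τ h N T cτ CP CI Cχ)
include H

/-- Initial energy for the energy estimate: u 1 differs from u 0 by τ ∂_τ u 1. The bound τ ≤ cτ h
and the inverse inequality convert the gradient of this increment into its L² norm. -/
theorem stiff_one_le (u : ℕ → E) :
    m (dq τ 1 u) (dq τ 1 u) + a (u 1) (u 1) ≤ (2 + 2 * cτ ^ 2 * CI) * endForm m a τ N u u := by
  have h1 : u 1 = u 0 + τ • dq τ 1 u := by
    rw [dq_apply, Nat.sub_self, smul_inv_smul₀ H.τ_pos.ne']; abel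
  have h2 := H.stiff.add_le (u 0) (τ • dq τ 1 u)
  rw [← h1, apply_smul_smul] at h2
  have n1 := H.stiff.nonneg (dq τ 1 u)
  have n2 := H.stiff.nonneg (u 0)
  have n3 := H.stiff.nonneg (u N)
  have n4 := H.mass.nonneg (dq τ 1 u)
  have n5 := H.mass.nonneg (dq τ N u)
  have h3 : τ ^ 2 * a (dq τ 1 u) (dq τ 1 u) ≤ cτ ^ 2 * CI * m (dq τ 1 u) (dq τ 1 u) := by
    calc _ ≤ (cτ * h) ^ 2 * a (dq τ 1 u) (dq τ 1 u) := by
          have := H.τ_pos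
          have := H.τ_le
          gcongr
      _ = cτ ^ 2 * (h ^ 2 * a (dq τ 1 u) (dq τ 1 u)) := by ring
      _ ≤ cτ ^ 2 * (CI * m (dq τ 1 u) (dq τ 1 u)) :=
        mul_le_mul_of_nonneg_left (H.inverse _) (sq_nonneg _)
      _ = _ := by ring
  have h4 : 0 ≤ cτ ^ 2 * CI * m (dq τ 1 u) (dq τ 1 u) :=
    (mul_nonneg (sq_nonneg _) n1).trans h3
  have h5 : 0 ≤ cτ ^ 2 * CI * (a (u 0) (u 0) + a (u N) (u N) + m (dq τ N u) (dq τ N u)) := by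
    -- For a negative constant the inverse inequality forces both forms to vanish.
    rcases le_or_gt 0 CI with hC | hC
    · positivity
    · have hz : ∀ x, m x x = 0 := fun x => by
        have h6 := H.inverse x
        have h7 : 0 ≤ h ^ 2 * a x x := mul_nonneg (sq_nonneg _) (H.stiff.nonneg _)
        nlinarith [H.mass.nonneg x]
      have hz' : ∀ x, a x x = 0 := fun x => by
        have h6 := H.inverse x
        rw [hz x, mul_zero] at h6
        have h7 : 0 < h ^ 2 := pow_pos H.h_pos 2
        nlinarith [H.stiff.nonneg x]
      simp [hz, hz']
  rw [endForm_apply]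
  linarith

/-- The energy estimate for u. The source is the coupling with U; the factor h² in the test sequence
is what allows U to be absorbed by the regularization, through the Poincaré inequality and
`stiff_le_regForm`. -/
theorem test_energy (hCP : 0 < CP) (hCχ : 0 < Cχ) (u U : ℕ → E) :
    h ^ 2 * energyF m a τ N u / 4
        - ((1 + T) * (1 + cτ ^ 2 * CI) * endForm m a τ N u u
          + 8 * (1 + T) ^ 3 * Cχ ^ 2 * CP * T * regForm a τ h N U U)
      ≤ waveG m a τ N u (energyTest τ h N u) - waveC c τ N U (energyTest τ h N u) := by
  have hN : 1 ≤ N := by have := H.two_le; omega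
  have hT := H.T_pos
  have hτ := H.τ_pos
  have hh := H.h_pos
  -- The shift to N + 1 gives p N = 1 + τ. The end terms at N then keep the coefficient (p N - τ) /
  -- 2 = 1 / 2 and can be dropped, whatever the size of τ.
  set p : ℕ → ℝ := fun n => 1 + ((N : ℝ) + 1 - n) * τ with hp
  have hp1 : ∀ n, p n - p (n + 1) = τ := fun n => by simp only [hp]; push_cast; ring
  have hp0 : ∀ n, n ≤ N → 0 ≤ p n := fun n hn => by
    have : (n : ℝ) ≤ N := by exact_mod_cast hn
    have h3 : 0 ≤ ((N : ℝ) + 1 - n) * τ := mul_nonneg (by linarith) hτ.le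
    simp only [hp]; linarith
  have hpN : p N = 1 + τ := by simp [hp]
  have hp1T : p 1 = 1 + T := by simp [hp, H.mul_eq]
  have e1 := sum_energy_ge H.mass hτ u p hp1 N hN hp0
  have e2 := sum_potential_ge H.stiff hτ u p hp1 N hN hp0
  rw [hpN, hp1T] at e1 e2
  have eG : waveG m a τ N u (energyTest τ h N u)
      = h ^ 2 * (∑ n ∈ Finset.Icc 2 N, τ * m (dq2 τ n u) (p n • dq τ n u)
        + ∑ n ∈ Finset.Icc 2 N, τ * a (u n) (p n • dq τ n u)) := by
    rw [waveG_apply, ← Finset.sum_add_distrib, Finset.mul_sum, Finset.mul_sum]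
    refine Finset.sum_congr rfl fun n _ => ?_
    simp only [energyTest, hp, map_smul, smul_eq_mul]
    ring
  have e3 := H.stiff_one_le u
  have e4 : h ^ 2 * (m (dq τ 1 u) (dq τ 1 u) + a (u 1) (u 1))
      ≤ (2 + 2 * cτ ^ 2 * CI) * endForm m a τ N u u := by
    refine le_trans ?_ e3
    exact mul_le_of_le_one_left (add_nonneg (H.mass.nonneg _) (H.stiff.nonneg _))
      (pow_le_one₀ hh.le H.h_le_one)
  have e5 : |waveC c τ N U (energyTest τ h N u)|
      ≤ 8 * (1 + T) ^ 3 * Cχ ^ 2 * CP * T * regForm a τ h N U U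
        + h ^ 2 * energyF m a τ N u / 4 := by
    have hQ : 0 < 1 + T := by positivity
    have f1 : waveC c τ N U (energyTest τ h N u)
        = h ^ 2 * waveC c τ N U (fun n => p n • dq τ n u) := by
      rw [waveC_apply, waveC_apply, mul_left_comm, Finset.mul_sum (a := h ^ 2)]
      congr 1
      refine Finset.sum_congr rfl fun n _ => ?_
      simp only [energyTest, hp, map_smul, smul_eq_mul]
    -- The parameter makes the part in ∂_τ u equal to a quarter of the F-norm, against the half
    -- gained in `e6`.
    have f2 := H.abs_waveC_le (t := 4 * (1 + T) ^ 2 * Cχ) (by positivity) U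
      (fun n => p n • dq τ n u)
    have f3 : massSum m τ N (fun n => p n • dq τ n u) ≤ (1 + T) ^ 2 * energyF m a τ N u := by
      rw [massSum, energyF, mul_left_comm]
      refine mul_le_mul_of_nonneg_left ?_ hτ.le
      rw [Finset.mul_sum]
      refine (Finset.sum_le_sum fun n hn => ?_).trans (Finset.sum_le_sum_of_subset_of_nonneg
        (Finset.Icc_subset_Icc_left one_le_two) fun n _ _ => ?_)
      · rw [apply_smul_smul]
        have hw := H.weight_mem (Finset.Icc_subset_Icc_left one_le_two hn)
        have hw2 : p n ^ 2 ≤ (1 + T) ^ 2 := pow_le_pow_left₀ hw.1 hw.2 2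
        calc _ ≤ (1 + T) ^ 2 * m (dq τ n u) (dq τ n u) :=
              mul_le_mul_of_nonneg_right hw2 (H.mass.nonneg _)
          _ ≤ _ := by
              refine mul_le_mul_of_nonneg_left ?_ (by positivity)
              linarith [H.stiff.nonneg (u n)]
      · exact mul_nonneg (by positivity) (add_nonneg (H.mass.nonneg _) (H.stiff.nonneg _))
    have f4 : h ^ 2 * massSum m τ N U ≤ T * (CP * (2 * (1 + T) * regForm a τ h N U U)) := by
      rw [massSum, mul_left_comm, Finset.mul_sum]
      refine H.mul_sum_le (Finset.Icc_subset_Icc_left one_le_two) _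
        (mul_nonneg hCP.le (mul_nonneg (by positivity) (H.regForm_self_nonneg U))) fun n hn => ?_
      calc _ ≤ h ^ 2 * (CP * a (U n) (U n)) :=
            mul_le_mul_of_nonneg_left (H.poincare _) (sq_nonneg _)
        _ = CP * (h ^ 2 * a (U n) (U n)) := by ring
        _ ≤ _ := mul_le_mul_of_nonneg_left (H.stiff_le_regForm U (Finset.mem_Icc.1 hn).2) hCP.le
    rw [f1, abs_mul, abs_of_nonneg (sq_nonneg h)]
    calc _ ≤ h ^ 2 * (Cχ * (4 * (1 + T) ^ 2 * Cχ * massSum m τ N U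
          + (4 * (1 + T) ^ 2 * Cχ)⁻¹ * massSum m τ N (fun n => p n • dq τ n u))) :=
          mul_le_mul_of_nonneg_left f2 (sq_nonneg _)
      _ = 4 * (1 + T) ^ 2 * Cχ ^ 2 * (h ^ 2 * massSum m τ N U)
          + h ^ 2 * (massSum m τ N (fun n => p n • dq τ n u) / (4 * (1 + T) ^ 2)) := by
          field_simp
      _ ≤ 4 * (1 + T) ^ 2 * Cχ ^ 2 * (T * (CP * (2 * (1 + T) * regForm a τ h N U U)))
          + h ^ 2 * ((1 + T) ^ 2 * energyF m a τ N u / (4 * (1 + T) ^ 2)) := by gcongr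
      _ = _ := by field_simp; ring
  have e6 : h ^ 2 * energyF m a τ N u / 2 - (1 + T) / 2
      * (h ^ 2 * (m (dq τ 1 u) (dq τ 1 u) + a (u 1) (u 1)))
      ≤ waveG m a τ N u (energyTest τ h N u) := by
    rw [eG, energyF, Finset.sum_add_distrib]
    have n1 := H.mass.nonneg (dq τ N u)
    have n2 := H.stiff.nonneg (u N)
    have := mul_le_mul_of_nonneg_left (add_le_add e1 e2) (sq_nonneg h)
    refine le_trans ?_ this
    have n3 := mul_nonneg (sq_nonneg h) (add_nonneg n1 n2)
    linarith
  have e7 := mul_le_mul_of_nonneg_left e4 (by positivity : 0 ≤ (1 + T) / 2)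
  have e8 := (le_abs_self _).trans e5
  linarith

/-- The mass part of the form is exactly the square of the second difference of U. In the stiffness
part, summation by parts leaves only first differences and values of U. These, like all the other
terms of the F'-norm, are bounded by the regularization, with the Poincaré inequality for the L²
norms. -/
theorem test_accel (hCP : 0 < CP) (U : ℕ → E) :
    h ^ 2 * energyF' m a τ N U
        - (6 + 6 * T + 2 * T ^ 2 + 2 * CP) * regForm a τ h N U U
      ≤ waveGs m a τ N (accelTest τ h U) U := by
  have hN := H.two_le
  have hT := H.T_pos
  have hτ := H.τ_pos
  have hh := H.h_pos
  have hr := H.regForm_self_nonneg U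
  have eG : waveGs m a τ N (accelTest τ h U) U
      = h ^ 2 * (τ * ∑ n ∈ Finset.range (N - 1), m (dq2f τ n U) (dq2f τ n U))
        + h ^ 2 * ∑ n ∈ Finset.range (N - 1), τ * a (dq2f τ n U) (U n) := by
    rw [waveGs_apply, ← Finset.mul_sum, ← mul_add, ← mul_add, ← Finset.sum_add_distrib,
      mul_left_comm, Finset.mul_sum (a := h ^ 2)]
    congr 1
    refine Finset.sum_congr rfl fun n _ => ?_
    simp only [accelTest, map_smul, smul_eq_mul, LinearMap.smul_apply]
    ring
  have hsh : ∑ n ∈ Finset.range (N - 1), m (dq2f τ n U) (dq2f τ n U)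
      = ∑ n ∈ Finset.Icc 2 N, m (dq2 τ n U) (dq2 τ n U) := by
    rw [← Finset.Ico_add_one_right_eq_Icc, Finset.sum_Ico_eq_sum_range,
      show N + 1 - 2 = N - 1 by omega]
    exact Finset.sum_congr rfl fun n _ => by rw [dq2f_eq_dq2, add_comm 2 n]
  rw [sum_dq2f_parts H.stiff hτ.ne', show N - 1 + 1 = N by omega] at eG
  have b1 := H.stiff.neg_le_two_mul one_pos (U (N - 1)) (dq τ N U)
  have b2 := H.stiff.two_mul_le one_pos (U 0) (dq τ 1 U)
  have hsub : ∀ s : Finset ℕ, s ⊆ Finset.Icc 1 N → ∑ n ∈ s, a (dq τ n U) (dq τ n U)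
      ≤ ∑ n ∈ Finset.Icc 1 N, a (dq τ n U) (dq τ n U) := fun s hs =>
    Finset.sum_le_sum_of_subset_of_nonneg hs fun _ _ _ => H.stiff.nonneg _
  have hshift : ∀ j, 1 ≤ j → j ≤ 2 →
      ∑ n ∈ Finset.range (N - 1), a (dq τ (n + j) U) (dq τ (n + j) U)
        ≤ ∑ n ∈ Finset.Icc 1 N, a (dq τ n U) (dq τ n U) := fun j hj1 hj2 => by
    have := hsub ((Finset.range (N - 1)).map (addRightEmbedding j)) fun k hk => by
      simp only [Finset.mem_map, Finset.mem_range, addRightEmbedding_apply] at hk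
      rw [Finset.mem_Icc]; omega
    simpa using this
  have b3 : 2 * ∑ n ∈ Finset.range (N - 1), a (dq τ (n + 1) U) (dq τ (n + 2) U)
      ≤ 2 * ∑ n ∈ Finset.Icc 1 N, a (dq τ n U) (dq τ n U) := by
    rw [Finset.mul_sum]
    refine (Finset.sum_le_sum fun n _ =>
      H.stiff.two_mul_le one_pos (dq τ (n + 1) U) (dq τ (n + 2) U)).trans ?_
    rw [Finset.sum_add_distrib, ← Finset.mul_sum, ← Finset.mul_sum, inv_one, one_mul, one_mul,
      two_mul]
    exact add_le_add (hshift 1 le_rfl one_le_two) (hshift 2 one_le_two le_rfl)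
  have b3' : τ * ∑ n ∈ Finset.range (N - 1), a (dq τ (n + 1) U) (dq τ (n + 2) U)
      ≤ τ * ∑ n ∈ Finset.Icc 1 N, a (dq τ n U) (dq τ n U) :=
    mul_le_mul_of_nonneg_left (by linarith) hτ.le
  have c0 := H.stiff_le_regForm U (Nat.zero_le N)
  have c1 := H.stiff_le_regForm U (by omega : 1 ≤ N)
  have c2 := H.stiff_le_regForm U (Nat.sub_le N 1)
  have n1 := H.stiff.nonneg (dq τ N U)
  have n2 := H.stiff.nonneg (dq τ 1 U)
  have n3 := H.stiff.nonneg (U N)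
  have n4 := H.sum_nonneg_mul H.stiff (Finset.Icc 1 N) fun k => dq τ k U
  have hreg : h ^ 2 * a (dq τ N U) (dq τ N U) + h ^ 2 * a (dq τ 1 U) (dq τ 1 U)
      + h ^ 2 * (τ * ∑ n ∈ Finset.Icc 1 N, a (dq τ n U) (dq τ n U)) ≤ regForm a τ h N U U := by
    rw [regForm_apply]
    have := mul_nonneg (sq_nonneg h) n3
    linarith
  have n1' := mul_nonneg (sq_nonneg h) n1
  have n2' := mul_nonneg (sq_nonneg h) n2
  have n4' := mul_nonneg (sq_nonneg h) n4
  have d1 : h ^ 2 * (τ * ∑ n ∈ Finset.Icc 2 N, a (dq τ n U) (dq τ n U))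
      ≤ h ^ 2 * (τ * ∑ n ∈ Finset.Icc 1 N, a (dq τ n U) (dq τ n U)) := by
    have := hsub _ (Finset.Icc_subset_Icc_left (b := N) one_le_two)
    gcongr
  have d2 : h ^ 2 * (τ * ∑ n ∈ Finset.Icc 2 N, m (dq τ n U) (dq τ n U))
      ≤ CP * (h ^ 2 * (τ * ∑ n ∈ Finset.Icc 2 N, a (dq τ n U) (dq τ n U))) := by
    have : ∑ n ∈ Finset.Icc 2 N, m (dq τ n U) (dq τ n U)
        ≤ CP * ∑ n ∈ Finset.Icc 2 N, a (dq τ n U) (dq τ n U) := by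
      rw [Finset.mul_sum]
      exact Finset.sum_le_sum fun n _ => H.poincare _
    calc _ ≤ h ^ 2 * (τ * (CP * ∑ n ∈ Finset.Icc 2 N, a (dq τ n U) (dq τ n U))) := by gcongr
      _ = _ := by ring
  have d3 : h ^ 2 * (τ * ∑ n ∈ Finset.Icc 2 N, a (U n) (U n))
      ≤ T * (2 * (1 + T) * regForm a τ h N U U) := by
    rw [mul_left_comm, Finset.mul_sum]
    exact H.mul_sum_le (Finset.Icc_subset_Icc_left one_le_two) _ (by positivity) fun n hn =>
      H.stiff_le_regForm U (Finset.mem_Icc.1 hn).2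
  have d4 : h ^ 2 * m (dq τ 1 U) (dq τ 1 U) ≤ CP * (h ^ 2 * a (dq τ 1 U) (dq τ 1 U)) := by
    calc _ ≤ h ^ 2 * (CP * a (dq τ 1 U) (dq τ 1 U)) := by gcongr; exact H.poincare _
      _ = _ := by ring
  have d5 : CP * (h ^ 2 * (τ * ∑ n ∈ Finset.Icc 2 N, a (dq τ n U) (dq τ n U)))
      ≤ CP * regForm a τ h N U U := mul_le_mul_of_nonneg_left (by linarith) hCP.le
  have d6 : CP * (h ^ 2 * a (dq τ 1 U) (dq τ 1 U)) ≤ CP * regForm a τ h N U U :=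
    mul_le_mul_of_nonneg_left (by linarith) hCP.le
  have eF : h ^ 2 * energyF' m a τ N U
      = h ^ 2 * (τ * ∑ n ∈ Finset.Icc 2 N, m (dq2 τ n U) (dq2 τ n U))
        + h ^ 2 * (τ * ∑ n ∈ Finset.Icc 2 N, a (dq τ n U) (dq τ n U))
        + h ^ 2 * (τ * ∑ n ∈ Finset.Icc 2 N, m (dq τ n U) (dq τ n U))
        + h ^ 2 * (τ * ∑ n ∈ Finset.Icc 2 N, a (U n) (U n))
        + h ^ 2 * m (dq τ 1 U) (dq τ 1 U) + h ^ 2 * a (U 1) (U 1) := by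
    rw [energyF']
    simp only [Finset.sum_add_distrib]
    ring
  have b1' := mul_le_mul_of_nonneg_left b1 (sq_nonneg h)
  have b2' := mul_le_mul_of_nonneg_left b2 (sq_nonneg h)
  have b3'' := mul_le_mul_of_nonneg_left b3' (sq_nonneg h)
  rw [eG, eF, hsh]
  simp only [inv_one, one_mul] at b1' b2'
  linarith

/-- One of the bounds of y by S(x): the test sequence carries h², so its square carries h⁴, and h ≤
1. -/
theorem massSum_energyTest_le (u : ℕ → E) :
    massSum m τ N (energyTest τ h N u) ≤ (1 + T) ^ 2 * (h ^ 2 * energyF m a τ N u) := by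
  have hτ := H.τ_pos
  have hT := H.T_pos
  rw [massSum, energyF]
  have : ∑ n ∈ Finset.Icc 2 N, m (energyTest τ h N u n) (energyTest τ h N u n)
      ≤ ∑ n ∈ Finset.Icc 1 N, (1 + T) ^ 2 * (h ^ 2 * (m (dq τ n u) (dq τ n u) + a (u n) (u n))) := by
    refine (Finset.sum_le_sum fun n hn => ?_).trans (Finset.sum_le_sum_of_subset_of_nonneg
      (Finset.Icc_subset_Icc_left one_le_two) fun n _ _ => ?_)
    · rw [energyTest, apply_smul_smul, apply_smul_smul]
      have hw := H.weight_mem (Finset.Icc_subset_Icc_left one_le_two hn)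
      have hw2 := pow_le_pow_left₀ hw.1 hw.2 2
      have hh : (h ^ 2) ^ 2 ≤ h ^ 2 :=
        pow_le_of_le_one (sq_nonneg h) (pow_le_one₀ H.h_pos.le H.h_le_one) two_ne_zero
      have n1 := H.mass.nonneg (dq τ n u)
      calc _ ≤ h ^ 2 * ((1 + T) ^ 2 * m (dq τ n u) (dq τ n u)) := by gcongr
        _ = (1 + T) ^ 2 * (h ^ 2 * m (dq τ n u) (dq τ n u)) := by ring
        _ ≤ _ := by
          have := H.stiff.nonneg (u n)
          gcongr
          linarith
    · have := H.mass.nonneg (dq τ n u)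
      have := H.stiff.nonneg (u n)
      positivity
  rw [← Finset.mul_sum, ← Finset.mul_sum] at this
  calc _ ≤ τ * _ := mul_le_mul_of_nonneg_left this hτ.le
    _ = _ := by ring

theorem massSum'_accelTest_le (U : ℕ → E) :
    massSum' m τ N (accelTest τ h U) ≤ h ^ 2 * energyF' m a τ N U := by
  have hτ := H.τ_pos
  have hN := H.two_le
  have hsh : ∑ n ∈ Finset.range (N - 1), m (accelTest τ h U n) (accelTest τ h U n)
      = (h ^ 2) ^ 2 * ∑ n ∈ Finset.Icc 2 N, m (dq2 τ n U) (dq2 τ n U) := by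
    rw [← Finset.Ico_add_one_right_eq_Icc, Finset.sum_Ico_eq_sum_range,
      show N + 1 - 2 = N - 1 by omega, Finset.mul_sum]
    exact Finset.sum_congr rfl fun n _ => by
      rw [accelTest, dq2f_eq_dq2, add_comm 2 n, apply_smul_smul]
  have hh : (h ^ 2) ^ 2 ≤ h ^ 2 :=
    pow_le_of_le_one (sq_nonneg h) (pow_le_one₀ H.h_pos.le H.h_le_one) two_ne_zero
  have n1 := H.sum_nonneg_mul H.mass (Finset.Icc 2 N) fun k => dq2 τ k U
  have n2 := H.sum_nonneg_mul H.stiff (Finset.Icc 2 N) fun k => dq τ k U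
  have n3 := H.sum_nonneg_mul H.mass (Finset.Icc 2 N) fun k => dq τ k U
  have n4 := H.sum_nonneg_mul H.stiff (Finset.Icc 2 N) U
  rw [massSum', hsh]
  calc _ = (h ^ 2) ^ 2 * (τ * ∑ n ∈ Finset.Icc 2 N, m (dq2 τ n U) (dq2 τ n U)) := by ring
    _ ≤ h ^ 2 * (τ * ∑ n ∈ Finset.Icc 2 N, m (dq2 τ n U) (dq2 τ n U)) :=
      mul_le_mul_of_nonneg_right hh n1
    _ ≤ _ := by
      refine mul_le_mul_of_nonneg_left ?_ (sq_nonneg h)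
      rw [energyF']
      simp only [Finset.sum_add_distrib]
      linarith [H.mass.nonneg (dq τ 1 U), H.stiff.nonneg (U 1)]

end WaveForms

/-! ### Combination of the four tests. -/

theorem exists_weights {c K : ℝ} (hc : 0 < c) (hc1 : c ≤ 1) (hK : 1 ≤ K) :
    ∃ α β C : ℝ, 0 < α ∧ α ≤ 1 ∧ 0 < β ∧ β ≤ 1 ∧ 0 < C ∧ ∀ R D D' F F' a₂ a₃ a₄ a₅ : ℝ,
      0 ≤ R → 0 ≤ D → 0 ≤ D' → 0 ≤ F → 0 ≤ F' → c * D - K * R ≤ a₂ →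
      c * D' - K * (D + R) ≤ a₃ → c * F - K * R ≤ a₄ → c * F' - K * R ≤ a₅ →
      C * (R + F + F' + D + D') ≤ R + α * a₂ + β * a₃ + α * a₄ + α * a₅ := by
  have hα : 0 < 1 / (8 * K) := by positivity
  have hα1 : 1 / (8 * K) ≤ 1 / 8 := by
    apply div_le_div_of_nonneg_left <;> linarith
  have hαK : 1 / (8 * K) * K = 1 / 8 := by field_simp
  have hβ : 0 < 1 / (8 * K) * c / (2 * K) := by positivity
  have hβK : 1 / (8 * K) * c / (2 * K) * K = 1 / (8 * K) * c / 2 := by field_simp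
  have hβ1 : 1 / (8 * K) * c / (2 * K) ≤ 1 / (8 * K) / 2 := by
    rw [div_le_div_iff₀ (by positivity) (by positivity)]
    have : c ≤ K := hc1.trans hK
    nlinarith
  -- Three tests with weight α = 1 / (8K) lose 3R / 8 in all. The weight β satisfies βK = αc / 2, so
  -- the remaining test loses half of the gain αcD and at most R / 16.
  refine ⟨1 / (8 * K), 1 / (8 * K) * c / (2 * K), 1 / (8 * K) * c / (2 * K) * c, hα, by linarith,
    hβ, by linarith, by positivity, ?_⟩
  generalize 1 / (8 * K) * c / (2 * K) = β at *
  generalize 1 / (8 * K) = α at *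
  intro R D D' F F' a₂ a₃ a₄ a₅ hR hD hD' hF hF' h2 h3 h4 h5
  have e2 := mul_le_mul_of_nonneg_left h2 hα.le
  have e3 := mul_le_mul_of_nonneg_left h3 hβ.le
  have e4 := mul_le_mul_of_nonneg_left h4 hα.le
  have e5 := mul_le_mul_of_nonneg_left h5 hα.le
  have k : ∀ X, α * (K * X) = 1 / 8 * X := fun X => by rw [← mul_assoc, hαK]
  have k' : ∀ X, β * (K * X) = α * c / 2 * X := fun X => by rw [← mul_assoc, hβK]
  rw [mul_sub, k] at e2 e4 e5
  rw [mul_sub, k'] at e3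
  have hαc : α * c ≤ α := mul_le_of_le_one_right hα.le hc1
  have hβc : β * c ≤ α * c / 2 := by nlinarith
  have g1 := mul_le_mul_of_nonneg_right hαc hR
  have g2 := mul_le_mul_of_nonneg_right hα1 hR
  have g3 := mul_le_mul_of_nonneg_right hβc hR
  have g4 := mul_le_mul_of_nonneg_right hβc hD
  have g5 := mul_le_mul_of_nonneg_right hβc hF
  have g6 := mul_le_mul_of_nonneg_right hβc hF'
  have p1 := mul_nonneg (mul_pos hα hc).le hF
  have p2 := mul_nonneg (mul_pos hα hc).le hF'
  have p3 := mul_nonneg (mul_pos hα hc).le hD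
  linarith

section Total

variable {E : Type*} [AddCommGroup E] [Module ℝ E] (m a c : E →ₗ[ℝ] E →ₗ[ℝ] ℝ) (τ h : ℝ) (N : ℕ)

/-- The bilinear form `𝓐((u, U, z, Z); (v, V, w, W))` for abstract forms. -/
def waveA (u U z Z v V w W : ℕ → E) : ℝ :=
  (waveG m a τ N v z + endForm m a τ N u v)
    + (waveGs m a τ N Z V - waveC c τ N V z + regForm a τ h N U V)
    + (waveG m a τ N u w - waveC c τ N U w) + waveGs m a τ N W U

/-- The signs -z and -Z cancel the couplings 𝓖(u, z), 𝓖*(Z, U) and the control term. What remains is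
the diagonal part plus the four tests. -/
theorem waveA_combine (u U z Z v V w W : ℕ → E) (α β : ℝ) :
    waveA m a c τ h N u U z Z (u + α • v) (U + β • V) (-z + α • w) (-Z + α • W)
      = (endForm m a τ N u u + regForm a τ h N U U)
        + α * (waveG m a τ N v z + endForm m a τ N u v)
        + β * (waveGs m a τ N Z V - waveC c τ N V z + regForm a τ h N U V)
        + α * (waveG m a τ N u w - waveC c τ N U w) + α * waveGs m a τ N W U := by
  simp only [waveA, map_add, map_smul, map_neg, LinearMap.add_apply, LinearMap.smul_apply,
    LinearMap.neg_apply, smul_eq_mul]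
  ring

variable {m a c τ h N} {T cτ CP CI Cχ : ℝ}

theorem IsSemiInner.mul_sum_add_smul_le {b : E →ₗ[ℝ] E →ₗ[ℝ] ℝ} (hb : IsSemiInner b)
    {τ t : ℝ} (hτ : 0 ≤ τ) (ht : 0 ≤ t) (ht1 : t ≤ 1) (s : Finset ℕ) (x y : ℕ → E) :
    τ * ∑ n ∈ s, b ((-x + t • y) n) ((-x + t • y) n)
      ≤ 2 * (τ * ∑ n ∈ s, b (x n) (x n)) + 2 * (τ * ∑ n ∈ s, b (y n) (y n)) := by
  have h : ∑ n ∈ s, b ((-x + t • y) n) ((-x + t • y) n)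
      ≤ ∑ n ∈ s, (2 * b (x n) (x n) + 2 * b (y n) (y n)) :=
    Finset.sum_le_sum fun n _ => by
      simpa using hb.add_smul_le ht ht1 (-x n) (y n)
  rw [Finset.sum_add_distrib, ← Finset.mul_sum, ← Finset.mul_sum] at h
  calc _ ≤ τ * _ := mul_le_mul_of_nonneg_left h hτ
    _ = _ := by ring

end Total

/-- The stability estimate for abstract forms. -/
theorem exists_test_sequences {T cτ CP CI Cχ : ℝ} (hT : 0 < T) (hcτ : 0 < cτ) (hCP : 0 < CP)
    (hCI : 0 < CI) (hCχ : 0 < Cχ) :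
    ∃ C₁ : ℝ, 0 < C₁ ∧ ∃ C₂ : ℝ, 0 < C₂ ∧
      ∀ {E : Type} [AddCommGroup E] [Module ℝ E] {m a c : E →ₗ[ℝ] E →ₗ[ℝ] ℝ} {τ h : ℝ} {N : ℕ},
        WaveForms m a c τ h N T cτ CP CI Cχ → ∀ u U z Z : ℕ → E,
        z 0 = 0 → z 1 = 0 → Z N = 0 → Z (N - 1) = 0 → ∃ v V w W : ℕ → E,
        C₁ * (endForm m a τ N u u + regForm a τ h N U U + h ^ 2 * energyF m a τ N u
            + h ^ 2 * energyF' m a τ N U + energyD m a τ N z + energyD' m a τ N Z)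
          ≤ waveA m a c τ h N u U z Z v V w W ∧
        C₂ * (endForm m a τ N v v + regForm a τ h N V V + massSum m τ N w + massSum' m τ N W)
          ≤ endForm m a τ N u u + regForm a τ h N U U + h ^ 2 * energyF m a τ N u
            + h ^ 2 * energyF' m a τ N U + energyD m a τ N z + energyD' m a τ N Z := by
  -- These are the losses of the four tests; one plus their sum serves as the common constant K. The
  -- common gain is 1 / (4 (1 + T)²), the smallest of the four.
  set K₂ := (1 + T) ^ 4 with hK₂
  set K₃ := 16 * T ^ 2 * (1 + T) ^ 4 * Cχ ^ 2 + 2 * (1 + T) ^ 4 * CI with hK₃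
  set K₄ := (1 + T) * (1 + cτ ^ 2 * CI) + 8 * (1 + T) ^ 3 * Cχ ^ 2 * CP * T with hK₄
  set K₅ := 6 + 6 * T + 2 * T ^ 2 + 2 * CP with hK₅
  have p2 : 0 < K₂ := by positivity
  have p3 : 0 < K₃ := by positivity
  have p4 : 0 < K₄ := by positivity
  have p5 : 0 < K₅ := by positivity
  have hK : 1 ≤ 1 + K₂ + K₃ + K₄ + K₅ := by linarith
  have hQ1 : 1 ≤ (1 + T) ^ 2 := one_le_pow₀ (by linarith)
  have hc1 : 1 / (4 * (1 + T) ^ 2) ≤ 1 := by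
    rw [div_le_one (by positivity)]; linarith
  have hc4 : 1 / (4 * (1 + T) ^ 2) ≤ 1 / 4 :=
    div_le_div_of_nonneg_left (by norm_num) (by norm_num) (by linarith)
  obtain ⟨α, β, C, hα, hα1, hβ, hβ1, hC, hw⟩ := exists_weights (c := 1 / (4 * (1 + T) ^ 2))
    (by positivity) hc1 hK
  -- The factor 2 comes from splitting each sum in the test functions. Then (1 + T)² bounds the
  -- perturbations of v and w, CI (1 + T)² that of V, and 1 the original components and the
  -- perturbation of W.
  set L := 2 * (1 + (1 + T) ^ 2 + CI * (1 + T) ^ 2) with hL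
  have hLp : 0 < L := by positivity
  refine ⟨C, hC, L⁻¹, inv_pos.2 hLp, ?_⟩
  intro E _ _ m a c τ h N H u U z Z hz0 hz1 hZ0 hZ1
  have nR := H.endForm_self_nonneg u
  have nR' := H.regForm_self_nonneg U
  have nD := H.energyD_nonneg z
  have nD' : 0 ≤ energyD' m a τ N Z := by
    rw [energyD'_eq_energyD_rev]; exact H.energyD_nonneg _
  have nF : 0 ≤ h ^ 2 * energyF m a τ N u := mul_nonneg (sq_nonneg h) (H.energyF_nonneg u)
  have nF' : 0 ≤ h ^ 2 * energyF' m a τ N U := mul_nonneg (sq_nonneg h) (H.energyF'_nonneg U)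
  refine ⟨u + α • cum τ z, U + β • cumB τ N Z, -z + α • energyTest τ h N u,
    -Z + α • accelTest τ h U, ?_, ?_⟩
  · rw [waveA_combine]
    refine hw _ _ _ _ _ _ _ _ _ (add_nonneg nR nR') nD nD' nF nF' ?_ ?_ ?_ ?_
    · refine le_trans ?_ (H.test_cum u hz0 hz1)
      rw [one_div_mul_eq_div, ← hK₂]
      have := mul_nonneg (add_pos (add_pos p3 p4) p5).le nR
      have := mul_nonneg (add_pos (add_pos (add_pos p2 p3) p4) p5).le nR'
      linarith
    · refine le_trans ?_ (H.test_cumB hCI hCχ U z hZ0 hZ1)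
      rw [one_div_mul_eq_div]
      have q1 : 16 * T ^ 2 * (1 + T) ^ 4 * Cχ ^ 2 ≤ 1 + K₂ + K₃ + K₄ + K₅ := by
        have : 0 ≤ 2 * (1 + T) ^ 4 * CI := by positivity
        linarith
      have q2 : 2 * (1 + T) ^ 4 * CI ≤ 1 + K₂ + K₃ + K₄ + K₅ := by
        have : 0 ≤ 16 * T ^ 2 * (1 + T) ^ 4 * Cχ ^ 2 := by positivity
        linarith
      have := mul_le_mul_of_nonneg_right q1 nD
      have := mul_le_mul_of_nonneg_right q2 nR'
      have := mul_nonneg (zero_le_one.trans hK) nR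
      linarith
    · refine le_trans ?_ (H.test_energy hCP hCχ u U)
      have q1 : (1 + T) * (1 + cτ ^ 2 * CI) ≤ 1 + K₂ + K₃ + K₄ + K₅ := by
        have : 0 ≤ 8 * (1 + T) ^ 3 * Cχ ^ 2 * CP * T := by positivity
        linarith
      have q2 : 8 * (1 + T) ^ 3 * Cχ ^ 2 * CP * T ≤ 1 + K₂ + K₃ + K₄ + K₅ := by
        have : 0 ≤ (1 + T) * (1 + cτ ^ 2 * CI) := by positivity
        linarith
      have := mul_le_mul_of_nonneg_right q1 nR
      have := mul_le_mul_of_nonneg_right q2 nR'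
      have := mul_le_mul_of_nonneg_right hc4 nF
      linarith
    · refine le_trans ?_ (H.test_accel hCP U)
      have q1 : K₅ ≤ 1 + K₂ + K₃ + K₄ + K₅ := by linarith
      have := mul_le_mul_of_nonneg_right q1 nR'
      have := mul_nonneg (zero_le_one.trans hK) nR
      have := mul_le_mul_of_nonneg_right hc1 nF'
      rw [← hK₅]
      linarith
  · rw [inv_mul_le_iff₀ hLp]
    have b1 := H.endForm_isSemiInner.add_smul_le hα.le hα1 u (cum τ z)
    have b2 := H.regForm_isSemiInner.add_smul_le hβ.le hβ1 U (cumB τ N Z)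
    have b3 : massSum m τ N (-z + α • energyTest τ h N u)
        ≤ 2 * massSum m τ N z + 2 * massSum m τ N (energyTest τ h N u) :=
      H.mass.mul_sum_add_smul_le H.τ_pos.le hα.le hα1 _ _ _
    have b4 : massSum' m τ N (-Z + α • accelTest τ h U)
        ≤ 2 * massSum' m τ N Z + 2 * massSum' m τ N (accelTest τ h U) :=
      H.mass.mul_sum_add_smul_le H.τ_pos.le hα.le hα1 _ _ _
    have c1 := H.endForm_cum_self_le hz0 hz1
    have c2 := H.regForm_cumB_self_le hCI.le hZ0 hZ1
    have c3 := H.massSum_energyTest_le u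
    have c4 := H.massSum'_accelTest_le U
    have d1 := H.massSum_le z
    have d2 : massSum' m τ N Z ≤ energyD' m a τ N Z := by
      have n1 := H.sum_nonneg_mul H.stiff (Finset.range (N - 1)) (cumB τ N Z)
      have n2 := H.stiff.nonneg (cumB τ N Z 0)
      have n3 := H.mass.nonneg (Z 0)
      rw [energyD']; linarith
    have hCQ : 0 < CI * (1 + T) ^ 2 := by positivity
    have r1 := mul_nonneg (by positivity : 0 ≤ (1 + T) ^ 2 + CI * (1 + T) ^ 2) nR
    have r2 := mul_nonneg (by positivity : 0 ≤ (1 + T) ^ 2 + CI * (1 + T) ^ 2) nR'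
    have r3 := mul_nonneg (by positivity : 0 ≤ CI * (1 + T) ^ 2) nD
    have r4 := mul_nonneg (by positivity : 0 ≤ (1 + T) ^ 2) nD'
    have r5 := mul_nonneg (by positivity : 0 ≤ 1 + CI * (1 + T) ^ 2) nF
    have r6 := mul_nonneg (by positivity : 0 ≤ (1 + T) ^ 2 + CI * (1 + T) ^ 2) nF'
    rw [hL]
    linarith

/-! ### Lipschitz functions glued from closed pieces. -/

section Lipschitz

/-- Induction on the number of pieces, without continuity of f. If a piece meets [p, q], jump from
its first point to its last by its own estimate. Before the first point and after the last one only
the other pieces are met, and since their union is closed it also contains these two endpoints. -/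
theorem abs_sub_le_of_finite_cover {ι : Type*} (f : ℝ → ℝ) {L : ℝ} (F : ι → Set ℝ)
    (hF : ∀ i, IsClosed (F i)) (s : Finset ι)
    (hf : ∀ i ∈ s, ∀ x ∈ F i, ∀ y ∈ F i, |f x - f y| ≤ L * |x - y|) :
    ∀ p q : ℝ, p ≤ q → Icc p q ⊆ ⋃ i ∈ s, F i → |f q - f p| ≤ L * (q - p) := by
  classical
  induction s using Finset.induction_on with
  | empty =>
    intro p q hpq h
    simpa using h (left_mem_Icc.2 hpq)
  | insert i s hi ih =>
    have ih' := ih fun j hj => hf j (Finset.mem_insert_of_mem hj)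
    have hcl : IsClosed (⋃ j ∈ s, F j) := isClosed_biUnion_finset fun j _ => hF j
    intro p q hpq h
    rw [Finset.set_biUnion_insert] at h
    by_cases hne : (F i ∩ Icc p q).Nonempty
    · have hco : IsCompact (F i ∩ Icc p q) := isCompact_Icc.inter_left (hF i)
      obtain ⟨c, ⟨hcF, hc⟩, hcmin⟩ := hco.exists_isLeast hne
      obtain ⟨e, ⟨heF, he⟩, hemax⟩ := hco.exists_isGreatest hne
      have hce : c ≤ e := hcmin ⟨heF, he⟩
      have h1 : |f c - f p| ≤ L * (c - p) := by
        rcases hc.1.eq_or_lt with rfl | hlt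
        · simp
        · refine ih' p c hc.1 ?_
          rw [← closure_Ico hlt.ne]
          refine hcl.closure_subset_iff.2 fun x hx => ?_
          refine (h ⟨hx.1, hx.2.le.trans hc.2⟩).resolve_left fun hxF => ?_
          exact hx.2.not_ge (hcmin ⟨hxF, hx.1, hx.2.le.trans hc.2⟩)
      have h2 : |f q - f e| ≤ L * (q - e) := by
        rcases he.2.eq_or_lt with rfl | hlt
        · simp
        · refine ih' e q he.2 ?_
          rw [← closure_Ioc hlt.ne]
          refine hcl.closure_subset_iff.2 fun x hx => ?_
          refine (h ⟨he.1.trans hx.1.le, hx.2⟩).resolve_left fun hxF => ?_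
          exact hx.1.not_ge (hemax ⟨hxF, he.1.trans hx.1.le, hx.2⟩)
      have h3 := hf i (Finset.mem_insert_self i s) e heF c hcF
      rw [abs_of_nonneg (by linarith : 0 ≤ e - c)] at h3
      have : f q - f p = (f q - f e) + (f e - f c) + (f c - f p) := by ring
      rw [this]
      refine (abs_add_three _ _ _).trans ?_
      linarith
    · refine ih' p q hpq fun x hx => (h hx).resolve_left fun hxF => hne ⟨x, hxF, hx⟩

theorem lipschitzWith_of_finite_closed_cover {E : Type*} [NormedAddCommGroup E] [NormedSpace ℝ E]
    {ι : Type*} (f : E → ℝ) {L : NNReal} (F : ι → Set E) (hF : ∀ i, IsClosed (F i))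
    (s : Finset ι) (hs : ∀ x, ∃ i ∈ s, x ∈ F i)
    (hf : ∀ i ∈ s, ∀ x ∈ F i, ∀ y ∈ F i, |f x - f y| ≤ L * ‖x - y‖) : LipschitzWith L f := by
  refine LipschitzWith.of_dist_le_mul fun x y => ?_
  have hcont : Continuous fun t : ℝ => y + t • (x - y) := by fun_prop
  have h := abs_sub_le_of_finite_cover (fun t => f (y + t • (x - y))) (L := L * ‖x - y‖)
    (fun i => (fun t : ℝ => y + t • (x - y)) ⁻¹' F i) (fun i => (hF i).preimage hcont) s ?_ 0 1
    zero_le_one ?_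
  · simpa [Real.dist_eq, dist_eq_norm] using h
  · intro i hi t ht r hr
    refine (hf i hi _ ht _ hr).trans (le_of_eq ?_)
    rw [add_sub_add_left_eq_sub, ← sub_smul, norm_smul, Real.norm_eq_abs]
    ring
  · intro t _
    obtain ⟨i, hi, hx⟩ := hs (y + t • (x - y))
    exact mem_biUnion hi hx

end Lipschitz

/-! ### Geometry of the mesh and regularity of finite element functions. -/

section Mesh

variable {d : ℕ} {K : Geometry.SimplicialComplex ℝ (Euc d)}

theorem isOpen_meshDomain : IsOpen (meshDomain K) := isOpen_interior

theorem IsTriangulation.cells_finite (hK : IsTriangulation K) : (cells K).Finite :=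
  hK.1.subset fun _ hs => hs.1

theorem IsTriangulation.exists_cell (hK : IsTriangulation K) {x : Euc d} (hx : x ∈ K.space) :
    ∃ s ∈ cells K, x ∈ convexHull ℝ (s : Set (Euc d)) := by
  obtain ⟨s, hs, hxs⟩ := Geometry.SimplicialComplex.mem_space_iff.1 hx
  obtain ⟨t, ht, hst⟩ := hK.2 s hs
  exact ⟨t, ht, convexHull_mono (Finset.coe_subset.2 hst) hxs⟩

theorem cell_subset_space {s : Finset (Euc d)} (hs : s ∈ cells K) :
    convexHull ℝ (s : Set (Euc d)) ⊆ K.space :=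
  Geometry.SimplicialComplex.convexHull_subset_space hs.1

theorem isCompact_cell (s : Finset (Euc d)) : IsCompact (convexHull ℝ (s : Set (Euc d))) :=
  s.finite_toSet.isCompact_convexHull ℝ

theorem IsTriangulation.space_eq (hK : IsTriangulation K) :
    K.space = ⋃ s ∈ cells K, convexHull ℝ (s : Set (Euc d)) := by
  refine Subset.antisymm (fun x hx => ?_) (iUnion₂_subset fun s hs => cell_subset_space hs)
  obtain ⟨s, hs, hxs⟩ := hK.exists_cell hx
  exact mem_biUnion hs hxs

theorem IsTriangulation.isCompact_space (hK : IsTriangulation K) : IsCompact K.space := by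
  rw [hK.space_eq]
  exact hK.cells_finite.isCompact_biUnion fun s _ => isCompact_cell s

theorem meshDomain_subset_space : meshDomain K ⊆ K.space := interior_subset

theorem IsTriangulation.isBounded_meshDomain (hK : IsTriangulation K) :
    Bornology.IsBounded (meshDomain K) :=
  hK.isCompact_space.isBounded.subset meshDomain_subset_space

theorem IsTriangulation.volume_meshDomain_lt_top (hK : IsTriangulation K) :
    volume (meshDomain K) < ⊤ := hK.isBounded_meshDomain.measure_lt_top

/-- By conformity the intersection is the hull of the common vertices. Distinct cells share at most
d vertices, which span a proper affine subspace. -/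
theorem volume_cell_inter_cell {s t : Finset (Euc d)} (hs : s ∈ cells K) (ht : t ∈ cells K)
    (hst : s ≠ t) :
    volume (convexHull ℝ (s : Set (Euc d)) ∩ convexHull ℝ (t : Set (Euc d))) = 0 := by
  classical
  rw [Geometry.SimplicialComplex.convexHull_inter_convexHull hs.1 ht.1, ← Finset.coe_inter]
  have hcard : (s ∩ t).card ≤ d := by
    have h1 : (s ∩ t).card < s.card := Finset.card_lt_card
      ⟨Finset.inter_subset_left, fun h => hst (Finset.eq_of_subset_of_card_le
        (h.trans Finset.inter_subset_right) (by rw [hs.2, ht.2]))⟩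
    rw [hs.2] at h1
    omega
  refine measure_mono_null (convexHull_subset_affineSpan _)
    (Measure.addHaar_affineSubspace _ _ fun htop => ?_)
  have hne : (s ∩ t).Nonempty := by
    rw [Finset.nonempty_iff_ne_empty]
    intro h0
    rw [h0, Finset.coe_empty, AffineSubspace.span_empty] at htop
    exact bot_ne_top htop
  obtain ⟨k, hk⟩ : ∃ k, (s ∩ t).card = k + 1 := ⟨(s ∩ t).card - 1, by
    have := hne.card_pos; omega⟩
  have h2 := finrank_vectorSpan_image_finset_le ℝ (id : Euc d → Euc d) (s ∩ t) hk
  rw [Finset.image_id] at h2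
  have h3 : vectorSpan ℝ ((s ∩ t : Finset (Euc d)) : Set (Euc d)) = ⊤ := by
    rw [← direction_affineSpan, htop, AffineSubspace.direction_top]
  rw [h3, finrank_top, finrank_euclideanSpace_fin] at h2
  omega

theorem affine_sub_eq (g : Euc d →ᵃ[ℝ] ℝ) (x y : Euc d) :
    g x - g y = LinearMap.toContinuousLinearMap g.linear (x - y) := by
  have := g.linearMap_vsub x y
  simpa using this.symm

theorem FE.exists_lipschitz (hK : IsTriangulation K) (v : FE K) :
    ∃ L : NNReal, LipschitzWith L (v : Euc d → ℝ) := by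
  classical
  have hv := v.2
  choose! g hg using hv.2.2
  set L : NNReal := ∑ s ∈ hK.cells_finite.toFinset,
    ‖LinearMap.toContinuousLinearMap (g s).linear‖₊ with hL
  -- The pieces are the cells, where the function is affine, and the complement of the mesh domain,
  -- indexed by `none`, where it vanishes.
  refine ⟨L, lipschitzWith_of_finite_closed_cover _
    (fun o : Option (Finset (Euc d)) => o.elim (meshDomain K)ᶜ
      fun s => convexHull ℝ (s : Set (Euc d))) ?_
    (insert none (hK.cells_finite.toFinset.image some)) ?_ ?_⟩
  · rintro (_ | s)
    · exact isOpen_meshDomain.isClosed_compl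
    · exact (isCompact_cell s).isClosed
  · intro x
    by_cases hx : x ∈ meshDomain K
    · obtain ⟨s, hs, hxs⟩ := hK.exists_cell (meshDomain_subset_space hx)
      exact ⟨some s, by simp [hs], hxs⟩
    · exact ⟨none, by simp, hx⟩
  · rintro (_ | s) hs x hx y hy
    · rw [hv.2.1 x hx, hv.2.1 y hy]
      simp only [sub_self, abs_zero]
      positivity
    · have hs' : s ∈ cells K := by simpa using hs
      rw [hg s hs' hx, hg s hs' hy, affine_sub_eq, ← Real.norm_eq_abs]
      refine (ContinuousLinearMap.le_opNorm _ _).trans ?_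
      refine mul_le_mul_of_nonneg_right ?_ (norm_nonneg _)
      rw [← coe_nnnorm, NNReal.coe_le_coe, hL]
      exact Finset.single_le_sum
        (f := fun s => ‖LinearMap.toContinuousLinearMap (g s).linear‖₊) (fun _ _ => zero_le)
        (by simpa using hs')

theorem FE.eq_zero_of_notMem (v : FE K) {x : Euc d} (hx : x ∉ meshDomain K) :
    (v : Euc d → ℝ) x = 0 := v.2.2.1 x hx

theorem FE.continuous (v : FE K) : Continuous (v : Euc d → ℝ) := v.2.1

theorem FE.hasCompactSupport (hK : IsTriangulation K) (v : FE K) :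
    HasCompactSupport (v : Euc d → ℝ) :=
  HasCompactSupport.intro hK.isCompact_space fun x hx =>
    FE.eq_zero_of_notMem v fun h => hx (meshDomain_subset_space h)

theorem FE.ae_differentiableAt (hK : IsTriangulation K) (v : FE K) :
    ∀ᵐ x, DifferentiableAt ℝ (v : Euc d → ℝ) x :=
  let ⟨_, hL⟩ := FE.exists_lipschitz hK v
  hL.ae_differentiableAt

theorem norm_gradient (f : Euc d → ℝ) (x : Euc d) : ‖gradient f x‖ = ‖fderiv ℝ f x‖ := by
  simp [gradient]

theorem measurable_gradient (f : Euc d → ℝ) : Measurable (gradient f) :=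
  (InnerProductSpace.toDual ℝ (Euc d)).symm.continuous.measurable.comp (measurable_fderiv ℝ f)

theorem FE.ae_gradient_add (hK : IsTriangulation K) (v w : FE K) :
    ∀ᵐ x, gradient ((v + w : FE K) : Euc d → ℝ) x
      = gradient (v : Euc d → ℝ) x + gradient (w : Euc d → ℝ) x := by
  filter_upwards [FE.ae_differentiableAt hK v, FE.ae_differentiableAt hK w] with x hv hw
  simp only [gradient, Submodule.coe_add, fderiv_add hv hw, map_add]

theorem FE.ae_gradient_smul (hK : IsTriangulation K) (t : ℝ) (v : FE K) :
    ∀ᵐ x, gradient ((t • v : FE K) : Euc d → ℝ) x = t • gradient (v : Euc d → ℝ) x := by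
  filter_upwards [FE.ae_differentiableAt hK v] with x hv
  simp only [gradient, Submodule.coe_smul, fderiv_const_smul hv, map_smul]

theorem FE.exists_bound (hK : IsTriangulation K) (v : FE K) :
    ∃ B : ℝ, ∀ x, ‖(v : Euc d → ℝ) x‖ ≤ B :=
  (FE.hasCompactSupport hK v).exists_bound_of_continuous (FE.continuous v)

theorem FE.memLp (hK : IsTriangulation K) (v : FE K) :
    MemLp (v : Euc d → ℝ) 2 (volume.restrict (meshDomain K)) :=
  ((FE.continuous v).memLp_of_hasCompactSupport (FE.hasCompactSupport hK v)).restrict _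

theorem FE.memLp_gradient (hK : IsTriangulation K) (v : FE K) :
    MemLp (gradient (v : Euc d → ℝ)) 2 (volume.restrict (meshDomain K)) := by
  obtain ⟨L, hL⟩ := FE.exists_lipschitz hK v
  have : IsFiniteMeasure (volume.restrict (meshDomain K)) :=
    ⟨by simpa using hK.volume_meshDomain_lt_top⟩
  refine MemLp.of_bound (measurable_gradient _).aestronglyMeasurable L
    (Filter.Eventually.of_forall fun x => ?_)
  rw [norm_gradient]
  exact norm_fderiv_le_of_lipschitz ℝ hL

end Mesh

/-! ### Mass, stiffness and weighted forms on the finite element space. -/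

section Forms

variable {d : ℕ} {K : Geometry.SimplicialComplex ℝ (Euc d)}

theorem integrable_inner_of_memLp {μ : Measure (Euc d)} {f g : Euc d → Euc d} (hf : MemLp f 2 μ)
    (hg : MemLp g 2 μ) : Integrable (fun x => inner ℝ (f x) (g x)) μ := by
  refine (hf.norm.integrable_mul hg.norm).mono' (hf.1.inner hg.1)
    (Filter.Eventually.of_forall fun x => ?_)
  exact norm_inner_le_norm _ _

theorem FE.integrable_mul (hK : IsTriangulation K) (v w : FE K) :
    Integrable (fun x => (v : Euc d → ℝ) x * (w : Euc d → ℝ) x)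
      (volume.restrict (meshDomain K)) :=
  (FE.memLp hK v).integrable_mul (FE.memLp hK w)

theorem FE.integrable_inner (hK : IsTriangulation K) (v w : FE K) :
    Integrable (fun x => inner ℝ (gradient (v : Euc d → ℝ) x) (gradient (w : Euc d → ℝ) x))
      (volume.restrict (meshDomain K)) :=
  integrable_inner_of_memLp (FE.memLp_gradient hK v) (FE.memLp_gradient hK w)

/-- The form `(k f, g)_h` on `𝕍_h` for an essentially bounded weight `k`. -/
def weightedForm (hK : IsTriangulation K) {k : Euc d → ℝ} {B : ℝ}
    (hk : AEStronglyMeasurable k (volume.restrict (meshDomain K)))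
    (hB : ∀ᵐ x ∂volume.restrict (meshDomain K), ‖k x‖ ≤ B) : FE K →ₗ[ℝ] FE K →ₗ[ℝ] ℝ :=
  have hi (v w : FE K) : Integrable (fun x => k x * (v : Euc d → ℝ) x * (w : Euc d → ℝ) x)
      (volume.restrict (meshDomain K)) := by
    simpa only [mul_assoc] using (FE.integrable_mul hK v w).bdd_mul hk hB
  LinearMap.mk₂ ℝ
    (fun v w => ip (meshDomain K) (fun x => k x * (v : Euc d → ℝ) x) (w : Euc d → ℝ))
    (fun v v' w => by
      simp only [ip]
      rw [← integral_add (hi v w) (hi v' w)]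
      congr 1; ext x
      simp only [Submodule.coe_add, Pi.add_apply]; ring)
    (fun t v w => by
      simp only [ip, smul_eq_mul]
      rw [← integral_const_mul]
      congr 1; ext x
      simp only [Submodule.coe_smul, Pi.smul_apply, smul_eq_mul]; ring)
    (fun v w w' => by
      simp only [ip]
      rw [← integral_add (hi v w) (hi v w')]
      congr 1; ext x
      simp only [Submodule.coe_add, Pi.add_apply]; ring)
    (fun t v w => by
      simp only [ip, smul_eq_mul]
      rw [← integral_const_mul]
      congr 1; ext x
      simp only [Submodule.coe_smul, Pi.smul_apply, smul_eq_mul]; ring)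

/-- The `L²` inner product on `𝕍_h`. -/
def massForm (hK : IsTriangulation K) : FE K →ₗ[ℝ] FE K →ₗ[ℝ] ℝ :=
  LinearMap.mk₂ ℝ (fun v w => ip (meshDomain K) (v : Euc d → ℝ) (w : Euc d → ℝ))
    (fun v v' w => by
      simp only [ip]
      rw [← integral_add (FE.integrable_mul hK v w) (FE.integrable_mul hK v' w)]
      congr 1; ext x
      simp only [Submodule.coe_add, Pi.add_apply]; ring)
    (fun t v w => by
      simp only [ip, smul_eq_mul]
      rw [← integral_const_mul]
      congr 1; ext x
      simp only [Submodule.coe_smul, Pi.smul_apply, smul_eq_mul]; ring)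
    (fun v w w' => by
      simp only [ip]
      rw [← integral_add (FE.integrable_mul hK v w) (FE.integrable_mul hK v w')]
      congr 1; ext x
      simp only [Submodule.coe_add, Pi.add_apply]; ring)
    (fun t v w => by
      simp only [ip, smul_eq_mul]
      rw [← integral_const_mul]
      congr 1; ext x
      simp only [Submodule.coe_smul, Pi.smul_apply, smul_eq_mul]; ring)

/-- The functional `v ↦ ∫ ⟨∇v, F⟩` on `𝕍_h` for a square integrable field `F`. -/
def gradientPairing (hK : IsTriangulation K) {F : Euc d → Euc d}
    (hF : MemLp F 2 (volume.restrict (meshDomain K))) : FE K →ₗ[ℝ] ℝ where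
  toFun v := ∫ x in meshDomain K, inner ℝ (gradient (v : Euc d → ℝ) x) (F x)
  map_add' v w := by
    rw [← integral_add (integrable_inner_of_memLp (FE.memLp_gradient hK v) hF)
      (integrable_inner_of_memLp (FE.memLp_gradient hK w) hF)]
    refine integral_congr_ae (ae_restrict_of_ae ?_)
    filter_upwards [FE.ae_gradient_add hK v w] with x hx
    rw [hx, inner_add_left]
  map_smul' t v := by
    rw [RingHom.id_apply, smul_eq_mul, ← integral_const_mul]
    refine integral_congr_ae (ae_restrict_of_ae ?_)
    filter_upwards [FE.ae_gradient_smul hK t v] with x hx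
    rw [hx, real_inner_smul_left]

theorem ah_comm (S : Set (Euc d)) (f g : Euc d → ℝ) : ah S f g = ah S g f := by
  simp only [ah, real_inner_comm]

/-- The Dirichlet form on `𝕍_h`. -/
def stiffForm (hK : IsTriangulation K) : FE K →ₗ[ℝ] FE K →ₗ[ℝ] ℝ :=
  LinearMap.mk₂ ℝ (fun v w => ah (meshDomain K) (v : Euc d → ℝ) (w : Euc d → ℝ))
    (fun v v' w => (gradientPairing hK (FE.memLp_gradient hK w)).map_add v v')
    (fun t v w => (gradientPairing hK (FE.memLp_gradient hK w)).map_smul t v)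
    (fun v w w' => by
      rw [ah_comm, ah_comm _ (v : Euc d → ℝ), ah_comm _ (v : Euc d → ℝ)]
      exact (gradientPairing hK (FE.memLp_gradient hK v)).map_add w w')
    (fun t v w => by
      rw [ah_comm, ah_comm _ (v : Euc d → ℝ)]
      exact (gradientPairing hK (FE.memLp_gradient hK v)).map_smul t w)

theorem massForm_apply (hK : IsTriangulation K) (v w : FE K) :
    massForm hK v w = ip (meshDomain K) (v : Euc d → ℝ) (w : Euc d → ℝ) := rfl

theorem stiffForm_apply (hK : IsTriangulation K) (v w : FE K) :
    stiffForm hK v w = ah (meshDomain K) (v : Euc d → ℝ) (w : Euc d → ℝ) := rfl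

theorem massForm_isSemiInner (hK : IsTriangulation K) : IsSemiInner (massForm hK) where
  symm v w := by simp only [massForm_apply, ip, mul_comm]
  nonneg _ := integral_nonneg fun _ => mul_self_nonneg _

theorem stiffForm_isSemiInner (hK : IsTriangulation K) : IsSemiInner (stiffForm hK) where
  symm _ _ := ah_comm _ _ _
  nonneg _ := integral_nonneg fun _ => real_inner_self_nonneg

theorem massForm_self (hK : IsTriangulation K) (v : FE K) :
    massForm hK v v = ∫ x, (v : Euc d → ℝ) x ^ 2 := by
  rw [massForm_apply, ip, setIntegral_eq_integral_of_forall_compl_eq_zero fun x hx => by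
    rw [FE.eq_zero_of_notMem v hx, zero_mul]]
  simp only [sq]

theorem integrable_sq (hK : IsTriangulation K) (v : FE K) :
    Integrable fun x => (v : Euc d → ℝ) x ^ 2 := by
  refine Continuous.integrable_of_hasCompactSupport ((FE.continuous v).pow 2) ?_
  exact HasCompactSupport.intro hK.isCompact_space fun x hx => by
    rw [FE.eq_zero_of_notMem v fun h => hx (meshDomain_subset_space h), sq, zero_mul]

theorem stiffForm_self (hK : IsTriangulation K) (v : FE K) :
    stiffForm hK v v = ∫ x in meshDomain K, ‖gradient (v : Euc d → ℝ) x‖ ^ 2 := by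
  rw [stiffForm_apply, ah]
  simp only [real_inner_self_eq_norm_sq]

theorem eq_zero_of_massForm_self (hK : IsTriangulation K) {v : FE K}
    (hv : massForm hK v v = 0) : v = 0 := by
  rw [massForm_self, integral_eq_zero_iff_of_nonneg (fun _ => sq_nonneg _)
    (integrable_sq hK v)] at hv
  have h := (Continuous.ae_eq_iff_eq volume ((FE.continuous v).pow 2) continuous_const).1 hv
  ext x
  exact pow_eq_zero_iff two_ne_zero |>.1 (congrFun h x)

theorem abs_weightedForm_le (hK : IsTriangulation K) {k : Euc d → ℝ} {B : ℝ}
    (hk : AEStronglyMeasurable k (volume.restrict (meshDomain K)))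
    (hB : ∀ᵐ x ∂volume.restrict (meshDomain K), ‖k x‖ ≤ B) (hB0 : 0 ≤ B) {t : ℝ} (ht : 0 < t)
    (v w : FE K) :
    |weightedForm hK hk hB v w| ≤ B * (t * massForm hK v v + t⁻¹ * massForm hK w w) := by
  have hi := ((FE.integrable_mul hK v v).const_mul t).add
    ((FE.integrable_mul hK w w).const_mul t⁻¹)
  have h := norm_integral_le_of_norm_le (hi.const_mul B)
    (f := fun x => k x * (v : Euc d → ℝ) x * (w : Euc d → ℝ) x) (hB.mono fun x hx => ?_)
  · rw [integral_const_mul, integral_add' ((FE.integrable_mul hK v v).const_mul t)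
      ((FE.integrable_mul hK w w).const_mul t⁻¹), integral_const_mul, integral_const_mul] at h
    exact h
  · rw [mul_assoc, norm_mul]
    refine mul_le_mul hx ?_ (norm_nonneg _) hB0
    simp only [Pi.add_apply, Real.norm_eq_abs]
    generalize (v : Euc d → ℝ) x = p
    generalize (w : Euc d → ℝ) x = q
    have e1 : t * (p * p) + t⁻¹ * (q * q) - 2 * (p * q) = t⁻¹ * (t * p - q) ^ 2 := by
      field_simp; ring
    have e2 : t * (p * p) + t⁻¹ * (q * q) + 2 * (p * q) = t⁻¹ * (t * p + q) ^ 2 := by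
      field_simp; ring
    have e3 : 0 ≤ t⁻¹ * (t * p - q) ^ 2 := by positivity
    have e4 : 0 ≤ t⁻¹ * (t * p + q) ^ 2 := by positivity
    have e5 : 0 ≤ t * (p * p) + t⁻¹ * (q * q) := by
      have := mul_self_nonneg p; have := mul_self_nonneg q; positivity
    rw [abs_le]
    constructor <;> linarith

end Forms

/-! ### The Poincaré inequality. -/

section Poincare

variable {d : ℕ} {K : Geometry.SimplicialComplex ℝ (Euc d)}

/-- Since ∂ᵢ xᵢ = 1 and the extension by zero is Lipschitz with compact support, ∫ v² = -∫ 2 v xᵢ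
∂ᵢv with no boundary term. Young's inequality bounds this by half of ∫ v² plus 2R² ∫ |∇v|². -/
theorem poincare_inequality (hK : IsTriangulation K) (i : Fin d) {R : ℝ}
    (hR : ∀ x ∈ meshDomain K, ‖x‖ ≤ R) (v : FE K) :
    massForm hK v v ≤ 4 * R ^ 2 * stiffForm hK v v := by
  obtain ⟨L, hL⟩ := FE.exists_lipschitz hK v
  obtain ⟨B, hB⟩ := FE.exists_bound hK v
  set f : Euc d → ℝ := v.1 with hf
  have hB0 : 0 ≤ B := (norm_nonneg _).trans (hB 0)
  set e : Euc d := EuclideanSpace.single i 1 with he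
  have hcoord : ∀ x : Euc d, |x i| ≤ ‖x‖ := fun x => by
    simpa using PiLp.norm_apply_le x i
  have hlip1 : LipschitzWith 1 fun x : Euc d => x i :=
    LipschitzWith.of_dist_le_mul fun x y => by
      simpa [Real.dist_eq, dist_eq_norm] using hcoord (x - y)
  have hlip2 : LipschitzWith (L * (2 * B).toNNReal) fun x => f x ^ 2 :=
    LipschitzWith.of_dist_le_mul fun x y => by
      rw [Real.dist_eq, sq_sub_sq, abs_mul, mul_comm, NNReal.coe_mul,
        Real.coe_toNNReal _ (by positivity), mul_right_comm]
      have h1 := hL.dist_le_mul x y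
      rw [Real.dist_eq] at h1
      refine mul_le_mul h1 ?_ (abs_nonneg _) (by positivity)
      refine (abs_add_le _ _).trans ?_
      have := hB x
      have := hB y
      simp only [Real.norm_eq_abs] at *
      linarith
  have hcs : HasCompactSupport fun x => f x ^ 2 :=
    HasCompactSupport.intro hK.isCompact_space fun x hx => by
      rw [hf, FE.eq_zero_of_notMem v fun h => hx (meshDomain_subset_space h), sq, zero_mul]
  have hibp := hlip1.integral_lineDeriv_mul_eq (μ := volume) hlip2 hcs e
  have hl1 : ∀ x : Euc d, lineDeriv ℝ (fun x : Euc d => x i) x e = 1 := fun x => by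
    have h1 : HasFDerivAt (fun x : Euc d => x i) (EuclideanSpace.proj i : Euc d →L[ℝ] ℝ) x :=
      (EuclideanSpace.proj i : Euc d →L[ℝ] ℝ).hasFDerivAt
    rw [(h1.hasLineDerivAt e).lineDeriv, he]
    simp
  simp only [hl1, one_mul] at hibp
  have hle : ∀ᵐ x, lineDeriv ℝ (fun x => f x ^ 2) x (-e) * x i
      ≤ (meshDomain K).indicator (fun x => f x ^ 2 / 2 + 2 * R ^ 2 * ‖gradient f x‖ ^ 2) x := by
    filter_upwards [FE.ae_differentiableAt hK v] with x hx
    have hd : lineDeriv ℝ (fun x => f x ^ 2) x (-e) = -(2 * f x * inner ℝ (gradient f x) e) := by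
      have h2 := (hx.hasFDerivAt.pow 2).hasLineDerivAt (-e)
      rw [h2.lineDeriv, inner_gradient_left]
      simp [hf]
    by_cases hxm : x ∈ meshDomain K
    · rw [indicator_of_mem hxm, hd]
      have h1 : |inner ℝ (gradient f x) e| ≤ ‖gradient f x‖ := by
        refine (abs_real_inner_le_norm _ _).trans (le_of_eq ?_)
        simp [he]
      have h2 : |x i| ≤ R := (hcoord x).trans (hR x hxm)
      have h3 : |inner ℝ (gradient f x) e * x i| ≤ ‖gradient f x‖ * R := by
        rw [abs_mul]
        exact mul_le_mul h1 h2 (abs_nonneg _) (norm_nonneg _)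
      have h4 : (inner ℝ (gradient f x) e * x i) ^ 2 ≤ (‖gradient f x‖ * R) ^ 2 :=
        sq_le_sq.2 (h3.trans (le_abs_self _))
      nlinarith [sq_nonneg (f x + 2 * (inner ℝ (gradient f x) e * x i))]
    · rw [indicator_of_notMem hxm, hd, hf, FE.eq_zero_of_notMem v hxm]
      simp
  have hg2 : IntegrableOn (fun x => ‖gradient f x‖ ^ 2) (meshDomain K) := by
    simpa only [real_inner_self_eq_norm_sq] using! FE.integrable_inner hK v v
  have hf2 : IntegrableOn (fun x => f x ^ 2) (meshDomain K) := (integrable_sq hK v).integrableOn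
  have hint : IntegrableOn (fun x => f x ^ 2 / 2 + 2 * R ^ 2 * ‖gradient f x‖ ^ 2)
      (meshDomain K) := (hf2.div_const 2).add (hg2.const_mul _)
  have hms : MeasurableSet (meshDomain K) := isOpen_meshDomain.measurableSet
  have hmass := massForm_self hK v
  have hmass' : ∫ x in meshDomain K, f x ^ 2 = massForm hK v v := by
    rw [hmass]
    exact setIntegral_eq_integral_of_forall_compl_eq_zero fun x hx => by
      rw [hf, FE.eq_zero_of_notMem v hx, sq, zero_mul]
  have hfin : massForm hK v v ≤ ∫ x, (meshDomain K).indicator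
      (fun x => f x ^ 2 / 2 + 2 * R ^ 2 * ‖gradient f x‖ ^ 2) x := by
    rw [hmass, hibp]
    -- Without integrability the integral is 0 by convention, and the bound is trivial.
    by_cases hi : Integrable fun x : Euc d => lineDeriv ℝ (fun x => f x ^ 2) x (-e) * x i
    · exact integral_mono_ae hi (hint.integrable_indicator hms) hle
    · rw [integral_undef hi]
      exact integral_nonneg fun x => indicator_nonneg (fun _ _ => by positivity) _
  rw [integral_indicator hms, integral_add (hf2.div_const 2) (hg2.const_mul _),
    integral_div, integral_const_mul, hmass', ← stiffForm_self hK v] at hfin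
  linarith

end Poincare

/-! ### The inverse inequality. -/

section Inverse

variable {d : ℕ} {K : Geometry.SimplicialComplex ℝ (Euc d)}

theorem integral_space_eq_sum (hK : IsTriangulation K) {f : Euc d → ℝ}
    (hf : IntegrableOn f K.space) :
    ∫ x in K.space, f x
      = ∑ s ∈ hK.cells_finite.toFinset, ∫ x in convexHull ℝ (s : Set (Euc d)), f x := by
  have hfin : Finite (cells K) := hK.cells_finite
  let _ : Fintype (cells K) := Fintype.ofFinite _
  set A : cells K → Set (Euc d) := fun s => convexHull ℝ (s.1 : Set (Euc d)) with hA
  have hU : K.space = ⋃ s, A s := by rw [hK.space_eq, biUnion_eq_iUnion]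
  have hm : ∀ s, NullMeasurableSet (A s) volume := fun s =>
    (isCompact_cell s.1).measurableSet.nullMeasurableSet
  have hdis : Pairwise (Function.onFun (AEDisjoint volume) A) := fun s t hst =>
    volume_cell_inter_cell s.2 t.2 fun h => hst (Subtype.ext h)
  rw [hU] at hf
  rw [hU, integral_iUnion_ae hm hdis hf, tsum_fintype]
  have key (F : Finset (Euc d) → ℝ) :
      ∑ s : cells K, F s = ∑ s ∈ hK.cells_finite.toFinset, F s :=
    (Finset.sum_subtype _ (fun s => hK.cells_finite.mem_toFinset) F).symm
  exact key fun s => ∫ x in convexHull ℝ (s : Set (Euc d)), f x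

/-- Inverse inequality on a single cell. -/
theorem inverse_inequality_cell {S : Set (Euc d)} (hS : Convex ℝ S) (hSc : IsCompact S)
    {f : Euc d → ℝ} (hf : Continuous f) {g : Euc d →ᵃ[ℝ] ℝ} (hg : EqOn f g S) {c : Euc d}
    {ρ h : ℝ} (hρ : 0 < ρ) (hh : 0 < h) (hc : Metric.closedBall c (ρ * h) ⊆ S)
    (hd : Metric.diam S ≤ h) :
    h ^ 2 * ∫ x in S, ‖gradient f x‖ ^ 2 ≤ 16 / ρ ^ 2 * (4 / ρ) ^ d * ∫ x in S, f x ^ 2 := by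
  set ℓ := LinearMap.toContinuousLinearMap g.linear with hℓ
  set G := (InnerProductSpace.toDual ℝ (Euc d)).symm ℓ with hG
  have hGi : ∀ y, inner ℝ G y = ℓ y := fun y => by
    rw [hG, InnerProductSpace.toDual_symm_apply]
  have hgd : ∀ x y, g x = g y + inner ℝ G (x - y) := fun x y => by
    rw [hGi, ← affine_sub_eq g x y]; ring
  have hr : 0 < ρ * h := by positivity
  have hcS : c ∈ S := hc (Metric.mem_closedBall_self hr.le)
  have hgrad : ∀ᵐ x, x ∈ S → ‖gradient f x‖ ^ 2 = ‖G‖ ^ 2 := by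
    -- The frontier of a convex set is null, so the gradient is the constant G almost everywhere on
    -- S.
    have h0 : ∀ᵐ x, x ∉ frontier S := compl_mem_ae_iff.2 (hS.addHaar_frontier volume)
    filter_upwards [h0] with x hx hxS
    have hxi : x ∈ interior S := by
      by_contra hni
      exact hx ⟨subset_closure hxS, hni⟩
    have h1 : HasFDerivAt g ℓ x := by
      have h2 : HasFDerivAt (fun y => g x + ℓ (y - x)) ℓ x := by
        simpa using (ℓ.hasFDerivAt.comp x ((hasFDerivAt_id x).sub_const x)).const_add (g x)
      refine h2.congr_of_eventuallyEq (Filter.Eventually.of_forall fun y => ?_)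
      rw [hgd y x, hGi]
    have h3 : HasFDerivAt f ℓ x := h1.congr_of_eventuallyEq
      (hg.eventuallyEq_of_mem (mem_interior_iff_mem_nhds.1 hxi))
    rw [gradient, h3.fderiv]
  rw [setIntegral_congr_ae hSc.measurableSet hgrad, setIntegral_const, smul_eq_mul]
  have hvolS : volume.real S ≤ h ^ d * volume.real (Metric.closedBall (0 : Euc d) 1) := by
    have h1 : S ⊆ Metric.closedBall c h := fun x hx =>
      Metric.mem_closedBall.2 ((Metric.dist_le_diam_of_mem hSc.isBounded hx hcS).trans hd)
    have h2 := Measure.addHaar_real_closedBall' (volume : Measure (Euc d)) c hh.le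
    rw [finrank_euclideanSpace_fin] at h2
    rw [← h2]
    exact measureReal_mono h1 (isCompact_closedBall c h).measure_lt_top.ne
  -- Moving from c by ρh / 2 along the gradient, with the sign of g c, raises |g| to at least ‖G‖ ρh
  -- / 2. On the ball of radius ρh / 4 about the new point, which still lies in S, |g| is at least
  -- ‖G‖ ρh / 4.
  obtain ⟨σ, hσ, hσc⟩ : ∃ σ : ℝ, σ ^ 2 = 1 ∧ 0 ≤ σ * g c := by
    rcases le_total 0 (g c) with h0 | h0
    · exact ⟨1, by norm_num, by linarith⟩
    · exact ⟨-1, by norm_num, by linarith⟩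
  have hσa : |σ| = 1 := by
    rw [← sq_eq_sq₀ (abs_nonneg _) zero_le_one, sq_abs, hσ, one_pow]
  -- For G = 0 this vector is 0, and the argument below remains valid.
  set e : Euc d := ‖G‖⁻¹ • G with he
  have hee : ‖e‖ ≤ 1 := by
    rw [he, norm_smul, norm_inv, norm_norm]
    exact inv_mul_le_one
  have hGe : inner ℝ G e = ‖G‖ := by
    rw [he, real_inner_smul_right, real_inner_self_eq_norm_sq, sq]
    by_cases h0 : ‖G‖ = 0
    · simp [h0]
    · rw [inv_mul_cancel_left₀ h0]
  set c' : Euc d := c + (σ * (ρ * h / 2)) • e with hc'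
  have hcc : ‖c' - c‖ ≤ ρ * h / 2 := by
    rw [hc', add_sub_cancel_left, norm_smul, Real.norm_eq_abs, abs_mul, hσa, one_mul,
      abs_of_pos (by positivity)]
    exact mul_le_of_le_one_right (by positivity) hee
  have hball : Metric.closedBall c' (ρ * h / 4) ⊆ S := by
    refine (Metric.closedBall_subset_closedBall' ?_).trans hc
    rw [dist_eq_norm]
    linarith
  have hlow : ∀ x ∈ Metric.closedBall c' (ρ * h / 4), (‖G‖ * (ρ * h / 4)) ^ 2 ≤ f x ^ 2 := by
    intro x hx
    have h1 : ‖x - c'‖ ≤ ρ * h / 4 := by rwa [← dist_eq_norm]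
    have h2 : |inner ℝ G (x - c')| ≤ ‖G‖ * (ρ * h / 4) :=
      (abs_real_inner_le_norm _ _).trans (mul_le_mul_of_nonneg_left h1 (norm_nonneg _))
    have h3 : |σ * inner ℝ G (x - c')| ≤ ‖G‖ * (ρ * h / 4) := by rwa [abs_mul, hσa, one_mul]
    have h4 : g x = g c + σ * (ρ * h / 2) * ‖G‖ + inner ℝ G (x - c') := by
      rw [hgd x c, show x - c = (σ * (ρ * h / 2)) • e + (x - c') by rw [hc']; abel,
        inner_add_right, real_inner_smul_right, hGe]
      ring
    have h5 : ‖G‖ * (ρ * h / 4) ≤ σ * g x := by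
      have : σ * g x = σ * g c + σ ^ 2 * (ρ * h / 2) * ‖G‖ + σ * inner ℝ G (x - c') := by
        rw [h4]; ring
      rw [this, hσ]
      have := (abs_le.1 h3).1
      linarith
    rw [hg (hball hx)]
    calc _ ≤ (σ * g x) ^ 2 := pow_le_pow_left₀ (by positivity) h5 2
      _ = _ := by rw [mul_pow, hσ, one_mul]
  have hfint : IntegrableOn (fun x => f x ^ 2) S := (hf.pow 2).continuousOn.integrableOn_compact hSc
  have hint : (‖G‖ * (ρ * h / 4)) ^ 2 * volume.real (Metric.closedBall c' (ρ * h / 4))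
      ≤ ∫ x in S, f x ^ 2 := by
    refine le_trans ?_ (setIntegral_mono_set hfint
      (Filter.Eventually.of_forall fun x => sq_nonneg _) (LE.le.eventuallyLE hball))
    have hcst := setIntegral_mono_on (μ := volume) (s := Metric.closedBall c' (ρ * h / 4))
      (f := fun _ => (‖G‖ * (ρ * h / 4)) ^ 2) (g := fun x => f x ^ 2)
      (integrableOn_const (isCompact_closedBall _ _).measure_lt_top.ne)
      (hfint.mono_set hball) Metric.isClosed_closedBall.measurableSet hlow
    rwa [setIntegral_const, smul_eq_mul, mul_comm] at hcst
  have h2 := Measure.addHaar_real_closedBall' (volume : Measure (Euc d)) c'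
    (by positivity : 0 ≤ ρ * h / 4)
  rw [finrank_euclideanSpace_fin] at h2
  rw [h2] at hint
  calc h ^ 2 * (volume.real S * ‖G‖ ^ 2)
      ≤ h ^ 2 * ((h ^ d * volume.real (Metric.closedBall (0 : Euc d) 1)) * ‖G‖ ^ 2) := by gcongr
    _ = 16 / ρ ^ 2 * (4 / ρ) ^ d * ((‖G‖ * (ρ * h / 4)) ^ 2
        * ((ρ * h / 4) ^ d * volume.real (Metric.closedBall (0 : Euc d) 1))) := by
        have : (ρ * h / 4) ^ d = h ^ d * (ρ / 4) ^ d := by rw [← mul_pow]; ring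
        have h5 : (4 / ρ) ^ d * (ρ / 4) ^ d = 1 := by
          rw [← mul_pow, div_mul_div_cancel₀ hρ.ne', div_self (by norm_num), one_pow]
        rw [this]
        have h6 : 16 / ρ ^ 2 * (‖G‖ * (ρ * h / 4)) ^ 2 = h ^ 2 * ‖G‖ ^ 2 := by
          field_simp; ring
        calc _ = (h ^ 2 * ‖G‖ ^ 2) * h ^ d * volume.real (Metric.closedBall (0 : Euc d) 1) * 1 := by
              ring
          _ = (16 / ρ ^ 2 * (‖G‖ * (ρ * h / 4)) ^ 2) * h ^ d
              * volume.real (Metric.closedBall (0 : Euc d) 1) * ((4 / ρ) ^ d * (ρ / 4) ^ d) := by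
              rw [h5, h6]
          _ = _ := by ring
    _ ≤ _ := mul_le_mul_of_nonneg_left hint (by positivity)

theorem diam_cell_le_meshSize (hK : IsTriangulation K) {s : Finset (Euc d)} (hs : s ∈ cells K) :
    Metric.diam (convexHull ℝ (s : Set (Euc d))) ≤ meshSize K :=
  le_csSup (hK.cells_finite.image _).bddAbove (mem_image_of_mem _ hs)

/-- Cells overlap in null sets, so the cellwise estimate can be summed. Quasi-uniformity with the
global mesh size makes its constant the same for all cells. -/
theorem inverse_inequality (hK : IsTriangulation K) {ρ : ℝ} (hρ : 0 < ρ)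
    (hq : IsQuasiUniform ρ K) (hh : 0 < meshSize K) (v : FE K) :
    meshSize K ^ 2 * stiffForm hK v v ≤ 16 / ρ ^ 2 * (4 / ρ) ^ d * massForm hK v v := by
  obtain ⟨L, hL⟩ := FE.exists_lipschitz hK v
  have hgi : IntegrableOn (fun x => ‖gradient (v : Euc d → ℝ) x‖ ^ 2) K.space := by
    refine IntegrableOn.of_bound hK.isCompact_space.measure_lt_top
      ((measurable_gradient _).norm.pow_const 2).aestronglyMeasurable ((L : ℝ) ^ 2)
      (Filter.Eventually.of_forall fun x => ?_)
    rw [norm_pow, norm_norm, norm_gradient]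
    exact pow_le_pow_left₀ (norm_nonneg _) (norm_fderiv_le_of_lipschitz ℝ hL) 2
  have hmass : massForm hK v v = ∫ x in K.space, (v : Euc d → ℝ) x ^ 2 := by
    rw [massForm_self]
    exact (setIntegral_eq_integral_of_forall_compl_eq_zero fun x hx => by
      rw [FE.eq_zero_of_notMem v fun h => hx (meshDomain_subset_space h), sq, zero_mul]).symm
  have hstiff : stiffForm hK v v ≤ ∫ x in K.space, ‖gradient (v : Euc d → ℝ) x‖ ^ 2 := by
    rw [stiffForm_self]
    exact setIntegral_mono_set hgi (Filter.Eventually.of_forall fun x => sq_nonneg _)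
      (LE.le.eventuallyLE meshDomain_subset_space)
  refine (mul_le_mul_of_nonneg_left hstiff (sq_nonneg _)).trans ?_
  rw [hmass, integral_space_eq_sum hK hgi,
    integral_space_eq_sum hK (integrable_sq hK v).integrableOn, Finset.mul_sum, Finset.mul_sum]
  refine Finset.sum_le_sum fun s hs => ?_
  rw [Finite.mem_toFinset] at hs
  obtain ⟨g, hg⟩ := v.2.2.2 s hs
  obtain ⟨c, hc⟩ := hq s hs
  exact inverse_inequality_cell (convex_convexHull ℝ _) (isCompact_cell s) (FE.continuous v) hg hρ
    hh hc (diam_cell_le_meshSize hK hs)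

end Inverse

/-! ### Bounds uniform in the mesh, and finite dimension. -/

section Domain

variable {d : ℕ} {K : Geometry.SimplicialComplex ℝ (Euc d)}

/-- A bounded open set is contained in every ball around `0` that contains its frontier. -/
theorem norm_le_of_frontier_subset {E : Type*} [NormedAddCommGroup E] [NormedSpace ℝ E]
    [ProperSpace E] {D : Set E} (hD : IsOpen D) (hb : Bornology.IsBounded D) {R : ℝ}
    (hR0 : 0 ≤ R) (hR : ∀ x ∈ frontier D, ‖x‖ ≤ R) : ∀ x ∈ D, ‖x‖ ≤ R := by
  intro x hx
  obtain ⟨p, hp, hmax⟩ := hb.isCompact_closure.exists_isMaxOn ⟨x, subset_closure hx⟩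
    continuous_norm.continuousOn
  have hxp : ‖x‖ ≤ ‖p‖ := hmax (subset_closure hx)
  by_cases hpD : p ∈ D
  · by_contra! hlt
    have hp0 : 0 < ‖p‖ := by linarith
    have hcont : Continuous fun t : ℝ => (1 + t) • p := by fun_prop
    have hnhds : ∀ᶠ t in nhds (0 : ℝ), (1 + t) • p ∈ D :=
      hcont.continuousAt.eventually_mem (hD.mem_nhds (by simpa using hpD))
    obtain ⟨ε, hε, hball⟩ := Metric.eventually_nhds_iff.1 hnhds
    have h1 := hball (y := ε / 2) (by simp [abs_of_pos hε]; linarith)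
    have h2 : ‖(1 + ε / 2) • p‖ ≤ ‖p‖ := hmax (subset_closure h1)
    rw [norm_smul, Real.norm_eq_abs, abs_of_pos (by positivity)] at h2
    nlinarith
  · exact hxp.trans (hR p ⟨hp, fun h => hpD (interior_subset h)⟩)

/-- The frontier of Ω_h is near that of Ω, so every Ω_h lies in one ball depending only on Ω and cΓ.
This makes the Poincaré constant uniform. -/
theorem exists_radius (hd : 1 ≤ d) {Ω : Set (Euc d)} (hne : Ω.Nonempty)
    (hb : Bornology.IsBounded Ω) {cΓ : ℝ} (hcΓ : 0 < cΓ) :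
    ∃ R : ℝ, 0 < R ∧ ∀ K : Geometry.SimplicialComplex ℝ (Euc d), IsTriangulation K →
      (∀ x ∈ frontier (meshDomain K), Metric.infDist x (frontier Ω) ≤ cΓ * meshSize K ^ 2) →
      0 < meshSize K → meshSize K ≤ 1 → ∀ x ∈ meshDomain K, ‖x‖ ≤ R := by
  have : Nonempty (Fin d) := ⟨⟨0, hd⟩⟩
  -- A distance to the empty set would be 0 by convention and carry no information.
  have hfr : (frontier Ω).Nonempty := by
    rw [nonempty_frontier_iff]
    refine ⟨hne, fun h => ?_⟩
    rw [h] at hb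
    exact NormedSpace.unbounded_univ ℝ (Euc d) hb
  obtain ⟨r, hr0, hr⟩ := hb.closure.exists_pos_norm_le
  refine ⟨r + cΓ + 1, by positivity, fun K hK hbd hh hh1 => ?_⟩
  refine norm_le_of_frontier_subset isOpen_meshDomain hK.isBounded_meshDomain (by positivity)
    fun x hx => ?_
  have h1 : Metric.infDist x (frontier Ω) < cΓ + 1 := by
    have h2 : cΓ * meshSize K ^ 2 ≤ cΓ := mul_le_of_le_one_right hcΓ.le (pow_le_one₀ hh.le hh1)
    linarith [hbd x hx]
  obtain ⟨y, hy, hxy⟩ := (Metric.infDist_lt_iff hfr).1 h1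
  have h3 := hr y (frontier_subset_closure hy)
  rw [dist_eq_norm] at hxy
  have h4 := norm_sub_norm_le x y
  linarith

theorem ae_norm_le_of_eLpNorm_top {μ : Measure (Euc d)} {f : Euc d → ℝ} {B : ℝ} (hB : 0 ≤ B)
    (hf : eLpNorm f ⊤ μ ≤ ENNReal.ofReal B) : ∀ᵐ x ∂μ, ‖f x‖ ≤ B := by
  rw [eLpNorm_exponent_top] at hf
  filter_upwards [ae_le_eLpNormEssSup (f := f) (μ := μ)] with x hx
  have h := hx.trans hf
  rw [← ofReal_norm] at h
  exact (ENNReal.ofReal_le_ofReal_iff hB).1 h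

theorem IsPiecewiseAffine.aestronglyMeasurable {χh : Euc d → ℝ} (h : IsPiecewiseAffine K χh) :
    AEStronglyMeasurable χh (volume.restrict (meshDomain K)) :=
  (h.1.mono meshDomain_subset_space).aestronglyMeasurable isOpen_meshDomain.measurableSet

/-- Values at the vertices determine a piecewise affine function. -/
theorem FE.finiteDimensional (hK : IsTriangulation K) : FiniteDimensional ℝ (FE K) := by
  set P : Set (Euc d) := ⋃ s ∈ cells K, (s : Set (Euc d)) with hP
  have hPf : P.Finite := hK.cells_finite.biUnion fun s _ => s.finite_toSet
  have : Finite P := hPf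
  have : Fintype P := Fintype.ofFinite _
  let φ : FE K →ₗ[ℝ] (P → ℝ) :=
    { toFun := fun v p => (v : Euc d → ℝ) p
      map_add' := fun _ _ => rfl
      map_smul' := fun _ _ => rfl }
  refine FiniteDimensional.of_injective φ ((injective_iff_map_eq_zero φ).2 fun v hv => ?_)
  ext x
  by_cases hx : x ∈ meshDomain K
  · obtain ⟨s, hs, hxs⟩ := hK.exists_cell (meshDomain_subset_space hx)
    obtain ⟨g, hg⟩ := v.2.2.2 s hs
    have hzero : ∀ y ∈ (s : Set (Euc d)), g y = 0 := fun y hy => by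
      rw [← hg (subset_convexHull ℝ _ hy)]
      exact congrFun hv ⟨y, mem_biUnion hs hy⟩
    have hconv : convexHull ℝ (s : Set (Euc d)) ⊆ g ⁻¹' {0} :=
      convexHull_min hzero ((convex_singleton 0).affine_preimage g)
    exact (hg hxs).trans (hconv hxs)
  · exact FE.eq_zero_of_notMem v hx

end Domain

/-! ### Dependence on finitely many time levels, and definiteness of S. -/

section Congruence

variable {E : Type*} [AddCommGroup E] [Module ℝ E] (m a c : E →ₗ[ℝ] E →ₗ[ℝ] ℝ) (τ h : ℝ) {N : ℕ}

theorem dq_congr {u u' : ℕ → E} (hu : ∀ n ≤ N, u n = u' n) {n : ℕ} (hn : n ≤ N) :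
    dq τ n u = dq τ n u' := by
  rw [dq_apply, dq_apply, hu n hn, hu (n - 1) (by omega)]

/-- The abstract test functions are infinite sequences, not zero outside the admissible indices,
whereas a state is truncated and extended by zero. The form sees no difference. -/
theorem waveA_congr (u U z Z : ℕ → E) {v v' V V' w w' W W' : ℕ → E} (hN : 1 ≤ N)
    (hv : ∀ n ≤ N, v n = v' n) (hV : ∀ n ≤ N, V n = V' n)
    (hw : ∀ n ∈ Finset.Icc 2 N, w n = w' n) (hW : ∀ n ∈ Finset.range (N - 1), W n = W' n) :
    waveA m a c τ h N u U z Z v V w W = waveA m a c τ h N u U z Z v' V' w' W' := by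
  have e1 := waveG_congr_left m a τ N z hv
  have e2 : endForm m a τ N u v = endForm m a τ N u v' := by
    rw [endForm_apply, endForm_apply, hv 0 (Nat.zero_le _), hv N le_rfl, dq_congr τ hv hN,
      dq_congr τ hv le_rfl]
  have e3 : waveGs m a τ N Z V = waveGs m a τ N Z V' := by
    rw [waveGs_apply, waveGs_apply]
    congr 1
    refine Finset.sum_congr rfl fun n hn => ?_
    rw [Finset.mem_range] at hn
    rw [dq2f_apply, dq2f_apply, hV n (by omega), hV (n + 1) (by omega), hV (n + 2) (by omega)]
  have e4 : waveC c τ N V z = waveC c τ N V' z := by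
    rw [waveC_apply, waveC_apply]
    congr 1
    exact Finset.sum_congr rfl fun n hn => by rw [hV n (Finset.mem_Icc.1 hn).2]
  have e5 : regForm a τ h N U V = regForm a τ h N U V' := by
    rw [regForm_apply, regForm_apply, hV N le_rfl, dq_congr τ hV hN, dq_congr τ hV le_rfl,
      Finset.sum_congr rfl fun n hn => by rw [dq_congr τ hV (Finset.mem_Icc.1 hn).2]]
  have e6 : waveG m a τ N u w = waveG m a τ N u w' := by
    rw [waveG_apply, waveG_apply, Finset.sum_congr rfl fun n hn => by rw [hw n hn]]
  have e7 : waveC c τ N U w = waveC c τ N U w' := by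
    rw [waveC_apply, waveC_apply, Finset.sum_congr rfl fun n hn => by rw [hw n hn]]
  have e8 : waveGs m a τ N W U = waveGs m a τ N W' U := by
    rw [waveGs_apply, waveGs_apply, Finset.sum_congr rfl fun n hn => by rw [hW n hn]]
  rw [waveA, waveA, e1, e2, e3, e4, e5, e6, e7, e8]

theorem endForm_self_congr {v v' : ℕ → E} (hN : 1 ≤ N) (hv : ∀ n ≤ N, v n = v' n) :
    endForm m a τ N v v = endForm m a τ N v' v' := by
  rw [endForm_apply, endForm_apply, hv 0 (Nat.zero_le _), hv N le_rfl, dq_congr τ hv hN,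
    dq_congr τ hv le_rfl]

theorem regForm_self_congr {V V' : ℕ → E} (hN : 1 ≤ N) (hV : ∀ n ≤ N, V n = V' n) :
    regForm a τ h N V V = regForm a τ h N V' V' := by
  rw [regForm_apply, regForm_apply, hV N le_rfl, dq_congr τ hV hN, dq_congr τ hV le_rfl,
    Finset.sum_congr rfl fun n hn => by rw [dq_congr τ hV (Finset.mem_Icc.1 hn).2]]

theorem massSum_congr {w w' : ℕ → E} (hw : ∀ n ∈ Finset.Icc 2 N, w n = w' n) :
    massSum m τ N w = massSum m τ N w' := by
  rw [massSum, massSum, Finset.sum_congr rfl fun n hn => by rw [hw n hn]]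

theorem massSum'_congr {W W' : ℕ → E} (hW : ∀ n ∈ Finset.range (N - 1), W n = W' n) :
    massSum' m τ N W = massSum' m τ N W' := by
  rw [massSum', massSum', Finset.sum_congr rfl fun n hn => by rw [hW n hn]]

end Congruence

section Definite

variable {E : Type*} [AddCommGroup E] [Module ℝ E] {m a c : E →ₗ[ℝ] E →ₗ[ℝ] ℝ} {τ h : ℝ} {N : ℕ}
  {T cτ CP CI Cχ : ℝ}

theorem WaveForms.energyD'_nonneg (H : WaveForms m a c τ h N T cτ CP CI Cχ) (Z : ℕ → E) :
    0 ≤ energyD' m a τ N Z := by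
  rw [energyD'_eq_energyD_rev]; exact H.energyD_nonneg _

theorem WaveForms.massSum'_le (H : WaveForms m a c τ h N T cτ CP CI Cχ) (Z : ℕ → E) :
    massSum' m τ N Z ≤ energyD' m a τ N Z := by
  have n1 := H.sum_nonneg_mul H.stiff (Finset.range (N - 1)) (cumB τ N Z)
  have n2 := H.stiff.nonneg (cumB τ N Z 0)
  have n3 := H.mass.nonneg (Z 0)
  rw [energyD']; linarith

/-- All parts of S vanish. The end term and the F-norm give u, the regularization gives U by
`stiff_le_regForm`, and the mass sums give z and Z; the Poincaré inequality makes the stiffness form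
definite. -/
theorem WaveForms.eq_zero_of_energy_le (H : WaveForms m a c τ h N T cτ CP CI Cχ)
    (hm : ∀ x, m x x = 0 → x = 0) (u U z Z : ℕ → E)
    (hS : endForm m a τ N u u + regForm a τ h N U U + h ^ 2 * energyF m a τ N u
      + h ^ 2 * energyF' m a τ N U + energyD m a τ N z + energyD' m a τ N Z ≤ 0) :
    (∀ n ≤ N, u n = 0) ∧ (∀ n ≤ N, U n = 0) ∧ (∀ n ∈ Finset.Icc 2 N, z n = 0) ∧
      ∀ n ∈ Finset.range (N - 1), Z n = 0 := by
  have hh : 0 < h ^ 2 := pow_pos H.h_pos 2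
  have n1 := H.endForm_self_nonneg u
  have n2 := H.regForm_self_nonneg U
  have n3 := mul_nonneg hh.le (H.energyF_nonneg u)
  have n4 := mul_nonneg hh.le (H.energyF'_nonneg U)
  have n5 := H.energyD_nonneg z
  have n6 := H.energyD'_nonneg Z
  have ha : ∀ x, a x x ≤ 0 → x = 0 := fun x hx => by
    refine hm x (le_antisymm ((H.poincare x).trans ?_) (H.mass.nonneg x))
    rw [le_antisymm hx (H.stiff.nonneg x), mul_zero]
  have hsum : ∀ (s : Finset ℕ) (x : ℕ → E), τ * ∑ n ∈ s, m (x n) (x n) ≤ 0 →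
      ∀ n ∈ s, x n = 0 := fun s x hx n hn => by
    refine hm _ (le_antisymm ?_ (H.mass.nonneg _))
    refine (Finset.single_le_sum (f := fun n => m (x n) (x n)) (fun _ _ => H.mass.nonneg _)
      hn).trans ?_
    exact nonpos_of_mul_nonpos_right hx H.τ_pos
  refine ⟨fun n hn => ha _ ?_, fun n hn => ha _ ?_, hsum _ _ ?_, hsum _ _ ?_⟩
  · rcases Nat.eq_zero_or_pos n with rfl | hpos
    · have := endForm_apply m a τ N u u
      linarith [H.stiff.nonneg (u N), H.mass.nonneg (dq τ 1 u), H.mass.nonneg (dq τ N u)]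
    · have h1 : energyF m a τ N u ≤ 0 := nonpos_of_mul_nonpos_right (by linarith) hh
      have h2 := nonpos_of_mul_nonpos_right h1 H.τ_pos
      have h3 := (Finset.single_le_sum
        (f := fun n => m (dq τ n u) (dq τ n u) + a (u n) (u n))
        (fun _ _ => add_nonneg (H.mass.nonneg _) (H.stiff.nonneg _))
        (Finset.mem_Icc.2 ⟨hpos, hn⟩)).trans h2
      linarith [H.mass.nonneg (dq τ n u)]
  · have h1 := H.stiff_le_regForm U hn
    rw [show regForm a τ h N U U = 0 by linarith, mul_zero] at h1
    exact nonpos_of_mul_nonpos_right h1 hh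
  · exact (H.massSum_le z).trans (by linarith)
  · exact (H.massSum'_le Z).trans (by linarith)

end Definite

/-! ### From the concrete scheme to the abstract forms, and solvability. -/

section Bridge

variable {d : ℕ} {K : Geometry.SimplicialComplex ℝ (Euc d)}

/-- Extension by zero of a finite family of finite element functions to a sequence. -/
def extZ (I : Finset ℕ) : (I → FE K) →ₗ[ℝ] (ℕ → FE K) where
  toFun f k := if hk : k ∈ I then f ⟨k, hk⟩ else 0
  map_add' f g := by
    ext1 k
    by_cases hk : k ∈ I <;> simp [hk]
  map_smul' t f := by
    ext1 k
    by_cases hk : k ∈ I <;> simp [hk]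

theorem extZ_of_mem {I : Finset ℕ} (f : I → FE K) {k : ℕ} (hk : k ∈ I) :
    extZ I f k = f ⟨k, hk⟩ := dif_pos hk

theorem extZ_restrict (v : ℕ → FE K) {I : Finset ℕ} {k : ℕ} (hk : k ∈ I) :
    extZ I (fun n : I => v n) k = v k := dif_pos hk

theorem extZ_of_notMem {I : Finset ℕ} (f : I → FE K) {k : ℕ} (hk : k ∉ I) :
    extZ I f k = 0 := dif_neg hk

/-- The sequence of functions underlying a sequence in `𝕍_h`. -/
abbrev coeSeq (u : ℕ → FE K) (n : ℕ) : Euc d → ℝ := u n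

theorem feSeq_eq {I : Finset ℕ} (f : I → FE K) : feSeq f = coeSeq (extZ I f) := by
  ext1 k
  by_cases hk : k ∈ I
  · rw [coeSeq, extZ_of_mem f hk, feSeq, dif_pos hk]
  · rw [coeSeq, extZ_of_notMem f hk, feSeq, dif_neg hk]; rfl

theorem bd_coeSeq (τ : ℝ) (u : ℕ → FE K) (n : ℕ) :
    bd τ (coeSeq u) n = ((dq τ n u : FE K) : Euc d → ℝ) := by
  ext x
  simp [bd, dq_apply, div_eq_inv_mul]

theorem bd2_coeSeq (τ : ℝ) (u : ℕ → FE K) (n : ℕ) :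
    bd2 τ (coeSeq u) n = ((dq2 τ n u : FE K) : Euc d → ℝ) := by
  ext x
  simp [bd2, dq2_apply, div_eq_inv_mul]
  ring

theorem fd2_coeSeq (τ : ℝ) (u : ℕ → FE K) (n : ℕ) :
    fd2 τ (coeSeq u) n = ((dq2f τ n u : FE K) : Euc d → ℝ) := by
  ext x
  simp [fd2, dq2f_apply, div_eq_inv_mul]
  ring

theorem intg_coeSeq (τ : ℝ) (z : ℕ → FE K) (n : ℕ) :
    intg τ (coeSeq z) n = ((cum τ z n : FE K) : Euc d → ℝ) := by
  ext x
  simp [intg, cum]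

theorem intgB_coeSeq (τ : ℝ) (N : ℕ) (Z : ℕ → FE K) (n : ℕ) :
    intgB τ N (coeSeq Z) n = ((cumB τ N Z n : FE K) : Euc d → ℝ) := by
  ext x
  simp [intgB, cumB]

variable (hK : IsTriangulation K) (T : ℝ) {N : ℕ}

theorem stabilityNormSq_eq (x : State K N) :
    stabilityNormSq T K N x
      = endForm (massForm hK) (stiffForm hK) (T / N) N (extZ _ x.1) (extZ _ x.1)
        + regForm (stiffForm hK) (T / N) (meshSize K) N (extZ _ x.2.1) (extZ _ x.2.1)
        + meshSize K ^ 2 * energyF (massForm hK) (stiffForm hK) (T / N) N (extZ _ x.1)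
        + meshSize K ^ 2 * energyF' (massForm hK) (stiffForm hK) (T / N) N (extZ _ x.2.1)
        + energyD (massForm hK) (stiffForm hK) (T / N) N (extZ _ x.2.2.1)
        + energyD' (massForm hK) (stiffForm hK) (T / N) N (extZ _ x.2.2.2) := by
  rw [stabilityNormSq, State.u, State.U, State.z, State.Z]
  simp only [feSeq_eq, endForm_apply, regForm_apply, energyF, energyF', energyD, energyD', massSum,
    massSum', massForm_apply, stiffForm_apply, normR, normF, normF', normD, normD', gradSq, normSq,
    bd_coeSeq, bd2_coeSeq, intg_coeSeq, intgB_coeSeq, ← Finset.mul_sum]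
  ring

theorem continuityNormSq_eq (y : State K N) :
    continuityNormSq T K N y
      = endForm (massForm hK) (stiffForm hK) (T / N) N (extZ _ y.1) (extZ _ y.1)
        + regForm (stiffForm hK) (T / N) (meshSize K) N (extZ _ y.2.1) (extZ _ y.2.1)
        + massSum (massForm hK) (T / N) N (extZ _ y.2.2.1)
        + massSum' (massForm hK) (T / N) N (extZ _ y.2.2.2) := by
  rw [continuityNormSq, State.u, State.U, State.z, State.Z]
  simp only [feSeq_eq, endForm_apply, regForm_apply, massSum,
    massSum', massForm_apply, stiffForm_apply, normC, normR, gradSq, normSq,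
    bd_coeSeq, ← Finset.mul_sum]
  ring

variable {χh : Euc d → ℝ} {B : ℝ}
  (hk : AEStronglyMeasurable χh (volume.restrict (meshDomain K)))
  (hB : ∀ᵐ x ∂volume.restrict (meshDomain K), ‖χh x‖ ≤ B)

theorem weightedForm_apply (v w : FE K) : weightedForm hK hk hB v w
    = ip (meshDomain K) (fun x => χh x * (v : Euc d → ℝ) x) (w : Euc d → ℝ) := rfl

theorem formA_eq (x y : State K N) :
    formA T K N χh x y = waveA (massForm hK) (stiffForm hK) (weightedForm hK hk hB) (T / N)
      (meshSize K) N (extZ _ x.1) (extZ _ x.2.1) (extZ _ x.2.2.1) (extZ _ x.2.2.2)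
      (extZ _ y.1) (extZ _ y.2.1) (extZ _ y.2.2.1) (extZ _ y.2.2.2) := by
  simp only [formA, State.u, State.U, State.z, State.Z]
  simp only [feSeq_eq, waveA, waveG_apply, waveGs_apply, waveC_apply, endForm_apply, regForm_apply,
    massForm_apply, stiffForm_apply, weightedForm_apply, formA0, formA1, formA2, formA3, formG,
    formGstar, formChi, bd_coeSeq, bd2_coeSeq, fd2_coeSeq, ← Finset.mul_sum]
  ring

/-- The bilinear form `𝓐` as a bilinear map. -/
def systemForm : State K N →ₗ[ℝ] State K N →ₗ[ℝ] ℝ :=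
  LinearMap.mk₂ ℝ (fun x y => waveA (massForm hK) (stiffForm hK) (weightedForm hK hk hB) (T / N)
      (meshSize K) N (extZ _ x.1) (extZ _ x.2.1) (extZ _ x.2.2.1) (extZ _ x.2.2.2)
      (extZ _ y.1) (extZ _ y.2.1) (extZ _ y.2.2.1) (extZ _ y.2.2.2))
    (fun x x' y => by
      simp only [waveA, Prod.fst_add, Prod.snd_add, map_add, LinearMap.add_apply]; ring)
    (fun t x y => by
      simp only [waveA, Prod.smul_fst, Prod.smul_snd, map_smul, LinearMap.smul_apply, smul_eq_mul]
      ring)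
    (fun x y y' => by
      simp only [waveA, Prod.fst_add, Prod.snd_add, map_add, LinearMap.add_apply]; ring)
    (fun t x y => by
      simp only [waveA, Prod.smul_fst, Prod.smul_snd, map_smul, LinearMap.smul_apply, smul_eq_mul]
      ring)

theorem systemForm_apply (x y : State K N) :
    systemForm hK T hk hB x y = formA T K N χh x y := (formA_eq hK T hk hB x y).symm

/-- The functional `v ↦ (v, g)_h` on `𝕍_h`. -/
def massPairing {g : Euc d → ℝ} (hg : MemLp g 2 (volume.restrict (meshDomain K))) :
    FE K →ₗ[ℝ] ℝ where
  toFun v := ip (meshDomain K) (v : Euc d → ℝ) g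
  map_add' v w := by
    have hi (v : FE K) : Integrable (fun x => (v : Euc d → ℝ) x * g x)
        (volume.restrict (meshDomain K)) := (FE.memLp hK v).integrable_mul hg
    rw [ip, ip, ip, ← integral_add (hi v) (hi w)]
    congr 1; ext x
    simp only [Submodule.coe_add, Pi.add_apply]; ring
  map_smul' t v := by
    rw [ip, ip, RingHom.id_apply, smul_eq_mul, ← integral_const_mul]
    congr 1; ext x
    simp only [Submodule.coe_smul, Pi.smul_apply, smul_eq_mul]; ring

/-- The right-hand side of the discrete Euler–Lagrange system. -/
def dataFunctional {Dg₀ : Euc d → Euc d} {g₁ : Euc d → ℝ}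
    (h₀ : MemLp Dg₀ 2 (volume.restrict (meshDomain K)))
    (h₁ : MemLp g₁ 2 (volume.restrict (meshDomain K))) : State K N →ₗ[ℝ] ℝ :=
  (gradientPairing hK h₀ ∘ₗ pr 0 + massPairing hK h₁ ∘ₗ dq (T / N) 1) ∘ₗ
    extZ (Finset.range (N + 1)) ∘ₗ LinearMap.fst ℝ _ _

theorem dataFunctional_apply {Dg₀ : Euc d → Euc d} {g₁ : Euc d → ℝ}
    (h₀ : MemLp Dg₀ 2 (volume.restrict (meshDomain K)))
    (h₁ : MemLp g₁ 2 (volume.restrict (meshDomain K))) (y : State K N) :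
    dataFunctional hK T h₀ h₁ y
      = (∫ p in meshDomain K, inner ℝ (gradient (y.u 0) p) (Dg₀ p))
        + ip (meshDomain K) (bd (T / N) y.u 1) g₁ := by
  rw [State.u, feSeq_eq, bd_coeSeq]
  rfl

theorem existsUnique_of_forall_eq_zero (hK : IsTriangulation K) (hinj : ∀ x : State K N,
      (∀ y, formA T K N χh x y = 0) → x = 0) {Dg₀ : Euc d → Euc d} {g₁ : Euc d → ℝ}
    (h₀ : MemLp Dg₀ 2 (volume.restrict (meshDomain K)))
    (h₁ : MemLp g₁ 2 (volume.restrict (meshDomain K)))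
    (hk : AEStronglyMeasurable χh (volume.restrict (meshDomain K)))
    (hB : ∀ᵐ x ∂volume.restrict (meshDomain K), ‖χh x‖ ≤ B) :
    ∃! x : State K N, SolvesEulerLagrange T K N χh Dg₀ g₁ x := by
  have : FiniteDimensional ℝ (FE K) := FE.finiteDimensional hK
  have hi : Function.Injective (systemForm (N := N) hK T hk hB) :=
    (injective_iff_map_eq_zero _).2 fun x hx => hinj x fun y => by
      rw [← systemForm_apply hK T hk hB, hx, LinearMap.zero_apply]
  have hs : Function.Surjective (systemForm (N := N) hK T hk hB) :=
    (LinearMap.injective_iff_surjective_of_finrank_eq_finrank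
      (Subspace.dual_finrank_eq (K := ℝ) (V := State K N)).symm).1 hi
  have hiff : ∀ x : State K N, SolvesEulerLagrange T K N χh Dg₀ g₁ x
      ↔ systemForm hK T hk hB x = dataFunctional hK T h₀ h₁ := fun x => by
    rw [SolvesEulerLagrange, LinearMap.ext_iff]
    exact forall_congr' fun y => by rw [systemForm_apply, dataFunctional_apply]
  obtain ⟨x, hx⟩ := hs (dataFunctional hK T h₀ h₁)
  exact ⟨x, (hiff x).2 hx, fun x' hx' => hi (((hiff x').1 hx').trans hx.symm)⟩

end Bridge

end WaveControl

end

/-! ### The main theorem. -/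

theorem proposition3 (d : ℕ) (hd : d = 2 ∨ d = 3) (T : ℝ) (hT : 0 < T)
    (Ω : Set (Euc d)) (hΩ_open : IsOpen Ω) (hΩ_conn : IsConnected Ω)
    (hΩ_bdd : Bornology.IsBounded Ω) (hΩ_smooth : HasSmoothBoundary Ω)
    (ω₀ : Set (Euc d)) (hω_open : IsOpen ω₀) (hω_sub : ω₀ ⊆ Ω)
    (χ : Euc d → ℝ) (hχ_smooth : ContDiff ℝ ∞ χ) (hχ_nonneg : ∀ x ∈ closure Ω, 0 ≤ χ x)
    (hχ_supp : ∀ x ∈ Ω \ ω₀, χ x = 0)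
    (ρ cΓ cτ cχ : ℝ) (hρ : 0 < ρ) (hcΓ : 0 < cΓ) (hcτ : 0 < cτ) (hcχ : 0 < cχ) :
    ∃ h₀ : ℝ, 0 < h₀ ∧ ∃ C₁ : ℝ, 0 < C₁ ∧ ∃ C₂ : ℝ, 0 < C₂ ∧
      ∀ (N : ℕ) (K : Geometry.SimplicialComplex ℝ (Euc d)) (χh : Euc d → ℝ),
        IsDiscretization T Ω χ ρ cΓ cτ cχ N K χh → 0 < meshSize K → meshSize K < h₀ →
        (∀ x : State K N, ∃ y : State K N,
          C₁ * stabilityNormSq T K N x ≤ formA T K N χh x y ∧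
          C₂ * continuityNormSq T K N y ≤ stabilityNormSq T K N x) ∧
        (∀ (g₀ : Euc d → ℝ) (Dg₀ : Euc d → Euc d) (g₁ : Euc d → ℝ),
          HasWeakGradient (meshDomain K) g₀ Dg₀ → MemLp g₁ 2 (volume.restrict (meshDomain K)) →
          ∃! x : State K N, SolvesEulerLagrange T K N χh Dg₀ g₁ x) := by
  have hd1 : 1 ≤ d := by omega
  obtain ⟨R, hR0, hR⟩ := exists_radius hd1 hΩ_conn.nonempty hΩ_bdd hcΓ
  obtain ⟨M, hM⟩ := (isCompact_closedBall (0 : Euc d) R).exists_bound_of_continuousOn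
    hχ_smooth.continuous.continuousOn
  have hM0 : 0 ≤ M := (norm_nonneg _).trans (hM 0 (Metric.mem_closedBall_self hR0.le))
  have hCP : 0 < 4 * R ^ 2 := by positivity
  have hCI : 0 < 16 / ρ ^ 2 * (4 / ρ) ^ d := by positivity
  have hCχ : 0 < M + cχ := by positivity
  obtain ⟨C₁, hC₁, C₂, hC₂, hmain⟩ := exists_test_sequences hT hcτ hCP hCI hCχ
  -- Besides h ≤ 1, this threshold excludes N = 1, for which τ = T would contradict τ ≤ cτ h < T.
  refine ⟨min 1 (T / cτ), by positivity, C₁, hC₁, C₂, hC₂, ?_⟩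
  intro N K χh hD hh hlt
  have hh1 : meshSize K ≤ 1 := (hlt.trans_le (min_le_left _ _)).le
  have hhT : cτ * meshSize K < T := by
    have := hlt.trans_le (min_le_right _ _)
    rwa [lt_div_iff₀ hcτ, mul_comm] at this
  have hK := hD.triangulation
  have hN1 : 1 ≤ N := hD.one_le
  have hNpos : (0 : ℝ) < N := by exact_mod_cast hN1
  have hN2 : 2 ≤ N := by
    by_contra hN
    obtain rfl : N = 1 := by omega
    have := hD.timeStep
    rw [Nat.cast_one, div_one] at this
    linarith
  have hRK := hR K hK hD.boundary hh hh1
  have hkm := hD.chi_affine.aestronglyMeasurable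
  have hkB : ∀ᵐ x ∂volume.restrict (meshDomain K), ‖χh x‖ ≤ M + cχ := by
    have h1 : eLpNorm (χ - χh) ⊤ (volume.restrict (meshDomain K)) ≤ ENNReal.ofReal cχ :=
      le_self_add.trans (hD.chi_close.trans (ENNReal.ofReal_le_ofReal
        (mul_le_of_le_one_right hcχ.le (pow_le_one₀ hh.le hh1))))
    filter_upwards [ae_norm_le_of_eLpNorm_top hcχ.le h1,
      ae_restrict_mem isOpen_meshDomain.measurableSet] with x hx hxK
    -- The mesh domain may leave Ω, but it stays in the ball of radius R, where χ is bounded by M.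
    have h2 := hM x (by simpa using hRK x hxK)
    have h3 : χh x = χ x - (χ - χh) x := by simp
    rw [h3]
    exact (norm_sub_le _ _).trans (add_le_add h2 hx)
  have H : WaveForms (massForm hK) (stiffForm hK) (weightedForm hK hkm hkB) (T / N) (meshSize K) N
      T cτ (4 * R ^ 2) (16 / ρ ^ 2 * (4 / ρ) ^ d) (M + cχ) :=
    { mass := massForm_isSemiInner hK
      stiff := stiffForm_isSemiInner hK
      two_le := hN2
      τ_pos := by positivity
      mul_eq := mul_div_cancel₀ T hNpos.ne'
      h_pos := hh
      h_le_one := hh1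
      τ_le := hD.timeStep
      poincare := fun v => poincare_inequality hK ⟨0, hd1⟩ hRK v
      inverse := fun v => inverse_inequality hK hρ hD.quasiUniform hh v
      control := fun t ht v w => abs_weightedForm_le hK hkm hkB hCχ.le ht v w }
  have hstab : ∀ x : State K N, ∃ y : State K N,
      C₁ * stabilityNormSq T K N x ≤ formA T K N χh x y ∧
      C₂ * continuityNormSq T K N y ≤ stabilityNormSq T K N x := by
    intro x
    -- The required zero values of z and Z hold because their extensions vanish off the index sets.
    obtain ⟨v, V, w, W, h1, h2⟩ := hmain H (extZ _ x.1) (extZ _ x.2.1) (extZ _ x.2.2.1)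
      (extZ _ x.2.2.2) (extZ_of_notMem _ (by simp)) (extZ_of_notMem _ (by simp))
      (extZ_of_notMem _ (by simp)) (extZ_of_notMem _ (by simp))
    refine ⟨(fun n => v n, fun n => V n, fun n => w n, fun n => W n), ?_, ?_⟩
    · rw [stabilityNormSq_eq hK, formA_eq hK T hkm hkB]
      refine h1.trans (le_of_eq (waveA_congr _ _ _ _ _ _ _ _ _ hN1 ?_ ?_ ?_ ?_))
      · exact fun n hn => (extZ_restrict v (Finset.mem_range.2 (Nat.lt_succ_of_le hn))).symm
      · exact fun n hn => (extZ_restrict V (Finset.mem_range.2 (Nat.lt_succ_of_le hn))).symm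
      · exact fun n hn => (extZ_restrict w hn).symm
      · exact fun n hn => (extZ_restrict W hn).symm
    · rw [stabilityNormSq_eq hK, continuityNormSq_eq hK]
      refine le_trans (le_of_eq ?_) h2
      rw [endForm_self_congr _ _ _ hN1 (v' := v) fun n hn =>
          extZ_restrict v (Finset.mem_range.2 (Nat.lt_succ_of_le hn)),
        regForm_self_congr _ _ _ hN1 (V' := V) fun n hn =>
          extZ_restrict V (Finset.mem_range.2 (Nat.lt_succ_of_le hn)),
        massSum_congr _ _ (w' := w) fun n hn => extZ_restrict w hn,
        massSum'_congr _ _ (W' := W) fun n hn => extZ_restrict W hn]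
  refine ⟨hstab, fun g₀ Dg₀ g₁ hg₀ hg₁ =>
    existsUnique_of_forall_eq_zero T hK (fun x hx => ?_) hg₀.2.1 hg₁ hkm hkB⟩
  obtain ⟨y, hy, -⟩ := hstab x
  rw [hx y] at hy
  have hS : stabilityNormSq T K N x ≤ 0 := nonpos_of_mul_nonpos_right hy hC₁
  rw [stabilityNormSq_eq hK] at hS
  obtain ⟨e1, e2, e3, e4⟩ := H.eq_zero_of_energy_le (fun v hv => eq_zero_of_massForm_self hK hv)
    _ _ _ _ hS
  refine Prod.ext (funext fun n => ?_) (Prod.ext (funext fun n => ?_)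
    (Prod.ext (funext fun n => ?_) (funext fun n => ?_)))
  · exact (extZ_of_mem _ n.2).symm.trans (e1 n (Nat.le_of_lt_succ (Finset.mem_range.1 n.2)))
  · exact (extZ_of_mem _ n.2).symm.trans (e2 n (Nat.le_of_lt_succ (Finset.mem_range.1 n.2)))
  · exact (extZ_of_mem _ n.2).symm.trans (e3 n n.2)
  · exact (extZ_of_mem _ n.2).symm.trans (e4 n n.2)
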